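/- Let $H\subset G$ be an inclusion of connected (finite-dimensional, real) Lie groups with Lie algebras $\mathfrak h\subset\mathfrak g$, let $U\subset\mathfrak h^*$ be an $H$-invariant open subset, $Z\in(\wedge^3\mathfrak g)^{\mathfrak g}$, and let $r:U\to\wedge^2\mathfrak g$ be a smooth $\mathfrak h$-equivariant map with $\frac12[r,r]-\sum_i h_i\wedge\frac{\partial r}{\partial\lambda^i}=Z$, where $(h_i)$, $(\lambda^i)$ are dual bases of $\mathfrak h$, $\mathfrak h^*$. On $M=U\times G$ consider the bivector field $\pi_r=\pi_{lin}+\sum_i\frac{\partial}{\partial\lambda^i}\wedge\overrightarrow{h_i}+\overrightarrow{r(\lambda)}$, where $\pi_{lin}$ is the linear Poisson structure of $\mathfrak h^*$ and $\overrightarrow{x}$ is the left-invariant vector field of $x\in\mathfrak g$, and put $\{f,g\}=\langle\pi_r,df\wedge dg\rangle$ for $f,g\in\mathcal O_M=C^\infty(M)$. The group $G$ acts on $M$ by left translations of the second factor (with infinitesimal action $\rho$ of $\mathfrak g$), and $H$ acts on the right by $(\lambda,g)\cdot x=(\lambda\circ \mathrm{Ad}_x,gx)$. View $\mathfrak h\subset\mathcal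 O_M$ as the linear functions on $U$. Fix an associator $\Phi=1+O(\hbar^2)\in(\otimes^3U\mathfrak g)^{\mathfrak g}[[\hbar]]$ quantizing $Z$, i.e. $\Phi$ satisfies the pentagon and counit equations and $\sum_{\sigma\in S_3}\mathrm{sgn}(\sigma)\,\sigma(\Phi)=\hbar^2Z+O(\hbar^3)$. A quantization of $\pi_r$ is a series $f*g=\sum_{k\ge0}\hbar^kC_k(f,g)$ of $\mathfrak g$-invariant bidifferential operators on $M$ with $C_0(f,g)=fg$, $C_1(f,g)-C_1(g,f)=\{f,g\}$ and $m_*\circ(m_*\otimes\mathrm{id})=m_*\circ(\mathrm{id}\otimes m_*)\circ\rho^{\otimes3}(S^{\otimes3}(\Phi^{-1}))$, where $S$ is the antipode of $U\mathfrak g$. It is strongly invariant if $h*f-f*h=\hbar\{h,f\}$ for all $h\in\mathfrak h$, $f\in\mathcal O_M$. A strongly invariant equivalence is a series $Q=\mathrm{id}+O(\hbar)$ in $\hbar$ of $G\times H$-invariant differential operators on $M$ with $Q(h)=h$ for $h\in\mathfrak h$; it transforms $*$ into the product $*'$ determined by $Q(f*g)=Q(f)*'Q(g)$. A bivector field $\beta$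 is identified with the skew-symmetric biderivation $\beta(f,g)=\frac12\langle\beta,df\wedge dg\rangle$ (so $\pi_r(f,g)=\frac12\{f,g\}$), $[\cdot,\cdot]$ is the Schouten bracket (so $[\pi_r,X]=-L_X\pi_r$ for a vector field $X$) or the commutator of operators, and $(bP)(f,g)=fP(g)-P(fg)+P(f)g$ is the Hochschild coboundary. Proposition. Let $*_1,*_2$ be two strongly invariant quantizations of $\pi_r$ (for the same $\Phi$), $f*_ig=\sum_{k\ge0}\hbar^kC^i_k(f,g)$, and let $n\ge0$ be such that $C^1_k=C^2_k$ for all $k\le n$. Then: (1) there exist a $G\times H$-invariant bivector field $B$ on $M$ and a $G\times H$-invariant differential operator $E$ on $M$ such that $B(h,-)=0$ and $E(h)=0$ for all $h\in\mathfrak h$, $[\pi_r,B]=0$, and $(C^1_{n+1}-C^2_{n+1})(f,g)=B(f,g)+(bE)(f,g)$ for all $f,g\in\mathcal O_M$; (2) there exists a $G\times H$-invariant differential operator $P$ on $M$ with $P(h)=0$ for all $h\in\mathfrak h$ and $C^1_1=\pi_r+bP$ (and likewise for $C^2_1$); (3) let $B,E$ be as in (1), let $P$ be as in (2) for $C^1_1$,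 and suppose that $B=[\pi_r,X]$ for a $G\times H$-invariant vector field $X$ on $M$ with $X(h)=0$ for all $h\in\mathfrak h$; if $n=0$ suppose moreover that $X=0$. Put $$Q=1+\hbar^nX+\hbar^{n+1}\bigl(E+[X,P]\bigr)\quad\text{if } n\ne1,\qquad Q=1+\hbar X+\hbar^{2}\bigl(E+[X,P]+\tfrac12X^2\bigr)\quad\text{if } n=1$$ (for $n=0$ and $X=0$ this reads $Q=1+\hbar E$). Then $Q$ is a strongly invariant equivalence, and it transforms $*_1$ into a strongly invariant quantization of $\pi_r$ (for the same $\Phi$) which coincides with $*_2$ up to order $n+1$. -/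

import Mathlib

open scoped Manifold ContDiff TensorProduct
open TopologicalSpace

namespace QPois

set_option linter.unusedSectionVars false

attribute [local instance] LieRing.ofAssociativeRing

section Smooth

variable {E : Type*} [NormedAddCommGroup E] [NormedSpace ℝ E]
  {V : Type*} [NormedAddCommGroup V] [NormedSpace ℝ V]
  {G : Type*} [TopologicalSpace G] [ChartedSpace E G]
  {W : Type*} [NormedAddCommGroup W] [NormedSpace ℝ W]
  {N : Type*} [TopologicalSpace N] [ChartedSpace W N]

instance lieGroupThree [Group G] [LieGroup 𝓘(ℝ, E) ∞ G] : LieGroup 𝓘(ℝ, E) (minSmoothness ℝ 3) G :=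
  LieGroup.of_le (n := ∞) (by simp only [minSmoothness_of_isRCLikeNormedField]; exact ENat.LEInfty.out)

theorem contMDiff_partial {EN HN : Type*} [NormedAddCommGroup EN] [NormedSpace ℝ EN]
    [TopologicalSpace HN] {J : ModelWithCorners ℝ EN HN} {N : Type*} [TopologicalSpace N]
    [ChartedSpace HN N] [IsManifold J ∞ N] [IsManifold 𝓘(ℝ, E) ∞ G]
    (f : N → G → ℝ) (hf : ContMDiff (J.prod 𝓘(ℝ, E)) 𝓘(ℝ, ℝ) ∞ (Function.uncurry f))
    (p : G) (v : TangentSpace 𝓘(ℝ, E) p) :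
    ContMDiff J 𝓘(ℝ, ℝ) ∞ (fun n => mvfderiv 𝓘(ℝ, E) (f n) p v) := by
  intro n₀
  have h := ContMDiffAt.mfderiv_apply (I := 𝓘(ℝ, E)) (I' := 𝓘(ℝ, ℝ)) (J := J) (J' := J)
    (x₀ := n₀) (m := ∞) (n := ∞)
    f (fun _ => p) id (fun _ => v) (hf _) contMDiffAt_const contMDiffAt_id contMDiffAt_const
    (by simp)
  refine h.congr_of_eventuallyEq (Filter.Eventually.of_forall fun n => ?_)
  have e := DFunLike.congr_fun (inTangentCoordinates_eq (I := 𝓘(ℝ, E)) (I' := 𝓘(ℝ, ℝ))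
    (fun _ : N => p) (fun n => f n p) (fun n => mfderiv 𝓘(ℝ, E) 𝓘(ℝ, ℝ) (f n) p)
    (x₀ := n₀) (x := n) (mem_chart_source E p) (by rw [chartAt_self_eq]; trivial)) v
  refine Eq.trans ?_ e.symm
  have h1 := (tangentBundleCore 𝓘(ℝ, E) G).coordChange_self (achart E p) p (mem_chart_source E p) v
  refine Eq.trans ?_ (congrArg (fun w : E => (tangentBundleCore 𝓘(ℝ, ℝ) ℝ).coordChange
    (achart ℝ (f n p)) (achart ℝ (f n₀ p)) (f n p)
      ((mfderiv 𝓘(ℝ, E) 𝓘(ℝ, ℝ) (f n) p : E →L[ℝ] ℝ) w)) h1).symm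
  rw [TangentBundle.coordChange_model_space]
  rfl

theorem contMDiff_dirDeriv (U : Opens V)  {EN HN : Type*} [NormedAddCommGroup EN] [NormedSpace ℝ EN]
    [TopologicalSpace HN] {J : ModelWithCorners ℝ EN HN} {N : Type*} [TopologicalSpace N]
    [ChartedSpace HN N] [IsManifold J ∞ N]
    (f : U → N → ℝ) (hf : ContMDiff (𝓘(ℝ, V).prod J) 𝓘(ℝ, ℝ) ∞ (Function.uncurry f)) (ξ : V) :
    ContMDiff (𝓘(ℝ, V).prod J) 𝓘(ℝ, ℝ) ∞
      (fun m : U × N => mvfderiv 𝓘(ℝ, V) (fun μ => f μ m.2) m.1 ξ) := by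
  intro m₀
  have h := ContMDiffAt.mfderiv_apply (I := 𝓘(ℝ, V)) (I' := 𝓘(ℝ, ℝ)) (J := 𝓘(ℝ, V).prod J)
    (J' := 𝓘(ℝ, V).prod J)
    (x₀ := m₀) (m := ∞) (n := ∞)
    (fun (m : U × N) μ => f μ m.2) (fun m => m.1) id (fun _ => ξ)
    ((hf.comp (contMDiff_snd.prodMk (contMDiff_snd.comp contMDiff_fst))) _)
    contMDiffAt_fst contMDiffAt_id contMDiffAt_const (by simp)
  refine h.congr_of_eventuallyEq (Filter.Eventually.of_forall fun m => ?_)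
  have hs : ∀ a b : U, a ∈ (chartAt V b).source := fun a b => by
    rw [Opens.chartAt_eq, chartAt_self_eq]; simp
  have ha : achart V m₀.1 = achart V m.1 := by
    apply Subtype.ext
    simp only [achart, Opens.chartAt_eq, chartAt_self_eq]
  have e := DFunLike.congr_fun (inTangentCoordinates_eq (I := 𝓘(ℝ, V)) (I' := 𝓘(ℝ, ℝ))
    (fun m : U × N => m.1) (fun m => f m.1 m.2)
    (fun m => mfderiv 𝓘(ℝ, V) 𝓘(ℝ, ℝ) (fun μ => f μ m.2) m.1)
    (x₀ := m₀) (x := m) (hs _ _) (by rw [chartAt_self_eq]; trivial)) ξ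
  refine Eq.trans ?_ e.symm
  have h1 : (tangentBundleCore 𝓘(ℝ, V) U).coordChange (achart V m₀.1) (achart V m.1) m.1 ξ = ξ := by
    rw [ha]
    exact (tangentBundleCore 𝓘(ℝ, V) U).coordChange_self _ _ (hs _ _) _
  refine Eq.trans ?_ (congrArg (fun w : V => (tangentBundleCore 𝓘(ℝ, ℝ) ℝ).coordChange
    (achart ℝ (f m.1 m.2)) (achart ℝ (f m₀.1 m₀.2)) (f m.1 m.2)
      ((mfderiv 𝓘(ℝ, V) 𝓘(ℝ, ℝ) (fun μ => f μ m.2) m.1 : V →L[ℝ] ℝ) w)) h1).symm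
  rw [TangentBundle.coordChange_model_space]
  rfl

end Smooth

/-- The Lie algebra of the Lie group `G` modelled on `E`. -/
abbrev LieAlg (E : Type*) [NormedAddCommGroup E] [NormedSpace ℝ E] (G : Type*)
    [TopologicalSpace G] [ChartedSpace E G] [Group G] := GroupLieAlgebra 𝓘(ℝ, E) G

section Bracket

variable {E : Type*} [NormedAddCommGroup E] [NormedSpace ℝ E] [FiniteDimensional ℝ E]
  {G : Type*} [TopologicalSpace G] [ChartedSpace E G] [Group G] [LieGroup 𝓘(ℝ, E) ∞ G]

open VectorField

theorem contMDiff_lieDeriv (f : G → ℝ) (hf : ContMDiff 𝓘(ℝ, E) 𝓘(ℝ, ℝ) ∞ f) (x : LieAlg E G) :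
    ContMDiff 𝓘(ℝ, E) 𝓘(ℝ, ℝ) ∞ (fun g : G => mvfderiv 𝓘(ℝ, E) (fun a : G => f (g * a)) 1 x) :=
  contMDiff_partial (J := 𝓘(ℝ, E)) (fun g a : G => f (g * a))
    (hf.comp (contMDiff_mul 𝓘(ℝ, E) ∞)) 1 x

theorem lieDeriv_eq (f : G → ℝ) (hf : ContMDiff 𝓘(ℝ, E) 𝓘(ℝ, ℝ) ∞ f) (x : LieAlg E G) (g : G) :
    mvfderiv 𝓘(ℝ, E) (fun a : G => f (g * a)) 1 x =
      mvfderiv 𝓘(ℝ, E) f g (mulInvariantVectorField (I := 𝓘(ℝ, E)) x g) := by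
  have h := mvfderiv_comp_apply_of_eq (I := 𝓘(ℝ, E)) (I' := 𝓘(ℝ, E)) (f := fun a : G => g * a)
    (g := f) (1 : G) (y := g)
    ((hf g).mdifferentiableAt (by simp))
    ((contMDiff_mul_left (I := 𝓘(ℝ, E)) (n := ∞) (a := g) 1).mdifferentiableAt (by simp))
    (mul_one g) x
  exact h

theorem mlieBracket_smul_mulInvariant (f : G → ℝ) (hf : ContMDiff 𝓘(ℝ, E) 𝓘(ℝ, ℝ) ∞ f)
    (x w : LieAlg E G) :
    mlieBracket 𝓘(ℝ, E) (mulInvariantVectorField x) (f • mulInvariantVectorField w) =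
      (fun g : G => mvfderiv 𝓘(ℝ, E) (fun a : G => f (g * a)) 1 x) • mulInvariantVectorField w +
        f • mulInvariantVectorField ⁅x, w⁆ := by
  ext g
  rw [mlieBracket_smul_right ((hf g).mdifferentiableAt (by simp))
    (mdifferentiableAt_mulInvariantVectorField w), ← lieDeriv_eq f hf]
  rw [GroupLieAlgebra.bracket_def, mulInvariantVector_mlieBracket]
  rfl

theorem mulInvariantVectorField_ne_zero (w : LieAlg E G) (hw : w ≠ 0) (g : G) :
    mulInvariantVectorField (I := 𝓘(ℝ, E)) w g ≠ 0 := by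
  intro h
  apply hw
  have e : (fun x : G => g⁻¹ * x) ∘ (fun x : G => g * x) = id := by ext x; simp
  have h1 := mfderiv_comp_apply_of_eq (I := 𝓘(ℝ, E)) (I' := 𝓘(ℝ, E)) (I'' := 𝓘(ℝ, E))
    (f := fun x : G => g * x) (g := fun x : G => g⁻¹ * x) (1 : G) (y := g)
    ((contMDiff_mul_left (I := 𝓘(ℝ, E)) (n := ∞) (a := g⁻¹) g).mdifferentiableAt (by simp))
    ((contMDiff_mul_left (I := 𝓘(ℝ, E)) (n := ∞) (a := g) 1).mdifferentiableAt (by simp))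
    (mul_one g) w
  rw [e, mfderiv_id] at h1
  refine Eq.trans h1 ((congrArg (fun v : E => (mfderiv 𝓘(ℝ, E) 𝓘(ℝ, E) (fun x : G => g⁻¹ * x)
    g : E →L[ℝ] E) v) h).trans (map_zero _))

theorem mdifferentiableAt_smul_mulInvariant (f : G → ℝ) (hf : ContMDiff 𝓘(ℝ, E) 𝓘(ℝ, ℝ) ∞ f)
    (w : LieAlg E G) (g : G) :
    ContMDiffAt 𝓘(ℝ, E) 𝓘(ℝ, E).tangent (minSmoothness ℝ 2) (fun x : G =>
      (Bundle.TotalSpace.mk' E x ((f • mulInvariantVectorField (I := 𝓘(ℝ, E)) w) x) :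
        TangentBundle 𝓘(ℝ, E) G)) g := by
  refine ContMDiffAt.smul_section (n := minSmoothness ℝ 2) ?_ 
    (contMDiffAt_mulInvariantVectorField (I := 𝓘(ℝ, E)) w)
  refine (hf g).of_le ?_
  simp only [minSmoothness_of_isRCLikeNormedField]
  exact ENat.LEInfty.out

theorem lieDeriv_bracket (f : G → ℝ) (hf : ContMDiff 𝓘(ℝ, E) 𝓘(ℝ, ℝ) ∞ f) (x y : LieAlg E G)
    (g : G) :
    mvfderiv 𝓘(ℝ, E) (fun a : G => f (g * a)) 1 ⁅x, y⁆ =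
      mvfderiv 𝓘(ℝ, E) (fun a : G => mvfderiv 𝓘(ℝ, E) (fun b : G => f (g * a * b)) 1 y) 1 x -
      mvfderiv 𝓘(ℝ, E) (fun a : G => mvfderiv 𝓘(ℝ, E) (fun b : G => f (g * a * b)) 1 x) 1 y := by
  rcases subsingleton_or_nontrivial E with hE | hE
  · have hz : ∀ z : LieAlg E G, z = 0 := fun z => Subsingleton.elim (α := E) z 0
    rw [hz ⁅x, y⁆, hz x, hz y]
    simp
  obtain ⟨w, hw⟩ : ∃ w : LieAlg E G, w ≠ 0 := exists_ne (α := E) 0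
  have J := leibniz_identity_mlieBracket_apply (I := 𝓘(ℝ, E)) (x := g)
    (contMDiffAt_mulInvariantVectorField x) (contMDiffAt_mulInvariantVectorField y)
    (mdifferentiableAt_smul_mulInvariant f hf w g)
  have hx := contMDiff_lieDeriv f hf x
  have hy := contMDiff_lieDeriv f hf y
  rw [mlieBracket_smul_mulInvariant f hf x w, mlieBracket_smul_mulInvariant f hf y w,
    ← mulInvariantVector_mlieBracket x y, ← GroupLieAlgebra.bracket_def,
    mlieBracket_smul_mulInvariant f hf ⁅x, y⁆ w] at J
  have hd : ∀ (k : G → ℝ), ContMDiff 𝓘(ℝ, E) 𝓘(ℝ, ℝ) ∞ k → ∀ z : LieAlg E G,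
      MDifferentiableAt 𝓘(ℝ, E) 𝓘(ℝ, E).tangent (fun x : G =>
        (Bundle.TotalSpace.mk' E x ((k • mulInvariantVectorField (I := 𝓘(ℝ, E)) z) x) :
        TangentBundle 𝓘(ℝ, E) G)) g := fun k hk z =>
    (mdifferentiableAt_smul_mulInvariant k hk z g).mdifferentiableAt (by simp)
  rw [mlieBracket_add_right (hd _ hy w) (hd _ hf _), mlieBracket_add_right (hd _ hx w) (hd _ hf _),
    mlieBracket_smul_mulInvariant f hf x _, mlieBracket_smul_mulInvariant f hf y _,
    mlieBracket_smul_mulInvariant _ hy x w, mlieBracket_smul_mulInvariant _ hx y w,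
    leibniz_lie x y w, mulInvariantVectorField_add] at J
  have hW := mulInvariantVectorField_ne_zero w hw g
  simp only [Pi.add_apply, Pi.smul_apply', smul_add] at J
  have J' : (mvfderiv 𝓘(ℝ, E) (fun a : G => f (g * a)) 1 ⁅x, y⁆ -
      (mvfderiv 𝓘(ℝ, E) (fun a : G => mvfderiv 𝓘(ℝ, E) (fun b : G => f (g * a * b)) 1 y) 1 x -
      mvfderiv 𝓘(ℝ, E) (fun a : G => mvfderiv 𝓘(ℝ, E) (fun b : G => f (g * a * b)) 1 x) 1 y)) •
      mulInvariantVectorField (I := 𝓘(ℝ, E)) w g = 0 := by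
    rw [sub_smul, sub_smul, sub_eq_zero]
    have J2 := sub_eq_zero.2 J
    refine sub_eq_zero.1 ?_
    refine neg_eq_zero.1 (Eq.trans ?_ J2)
    abel
  exact sub_eq_zero.1 ((smul_eq_zero.1 J').resolve_right hW)

end Bracket

/-- The algebra of smooth functions on `M = U × G`, where `U` is an open subset of `F*`. -/
abbrev Fn {F : Type*} (E : Type*) [NormedAddCommGroup F] [NormedSpace ℝ F]
    [NormedAddCommGroup E] [NormedSpace ℝ E] (G : Type*) [TopologicalSpace G] [ChartedSpace E G]
    (U : Opens (StrongDual ℝ F)) :=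
  C^∞⟮(𝓘(ℝ, StrongDual ℝ F)).prod 𝓘(ℝ, E), U × G; 𝓘(ℝ, ℝ), ℝ⟯

section Operators

variable {F E : Type*} [NormedAddCommGroup F] [NormedSpace ℝ F] [FiniteDimensional ℝ F]
  [NormedAddCommGroup E] [NormedSpace ℝ E] [FiniteDimensional ℝ E]
  {G : Type*} [TopologicalSpace G] [ChartedSpace E G] [Group G] [LieGroup 𝓘(ℝ, E) ∞ G]
  {U : Opens (StrongDual ℝ F)}

theorem mvfderiv_const_mul {EN HN : Type*} [NormedAddCommGroup EN] [NormedSpace ℝ EN]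
    [TopologicalSpace HN] {J : ModelWithCorners ℝ EN HN} {N : Type*} [TopologicalSpace N]
    [ChartedSpace HN N] (c : ℝ) (f : N → ℝ) (p : N) (hf : MDifferentiableAt J 𝓘(ℝ, ℝ) f p)
    (v : TangentSpace J p) : mvfderiv J (fun a => c * f a) p v = c * mvfderiv J f p v := by
  have h := DFunLike.congr_fun
    (mvfderiv_smul (mdifferentiableAt_const (c := c) (I := J) (x := p)) hf) v
  rw [mvfderiv_const] at h
  refine h.trans ?_
  simp

theorem contMDiff_slice (f : Fn E G U) (l : U) :
    ContMDiff 𝓘(ℝ, E) 𝓘(ℝ, ℝ) ∞ (fun g : G => f (l, g)) :=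
  f.contMDiff.comp (contMDiff_const.prodMk contMDiff_id)

theorem contMDiff_sliceU (f : Fn E G U) (g : G) :
    ContMDiff 𝓘(ℝ, StrongDual ℝ F) 𝓘(ℝ, ℝ) ∞ (fun l : U => f (l, g)) :=
  f.contMDiff.comp (contMDiff_id.prodMk contMDiff_const)

/-- The left-invariant vector field of `x ∈ 𝔤` acting on functions on `U × G`:
the derivative of `a ↦ f (l, g a)` at `a = 1` in the direction `x`. -/
noncomputable def leftField (x : LieAlg E G) : Module.End ℝ (Fn E G U) where
  toFun f := ⟨fun m => mvfderiv 𝓘(ℝ, E) (fun a : G => f (m.1, m.2 * a)) 1 x, by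
    refine contMDiff_partial (J := (𝓘(ℝ, StrongDual ℝ F)).prod 𝓘(ℝ, E))
      (fun (m : U × G) (a : G) => f (m.1, m.2 * a)) ?_ 1 x
    exact f.contMDiff.comp ((contMDiff_fst.comp contMDiff_fst).prodMk
      ((contMDiff_mul 𝓘(ℝ, E) ∞).comp
        ((contMDiff_snd.comp contMDiff_fst).prodMk contMDiff_snd)))⟩
  map_add' f g := by
    ext m
    have hf := ((contMDiff_slice f m.1).comp
      (contMDiff_mul_left (a := m.2)) (1 : G)).mdifferentiableAt (by simp)
    have hg := ((contMDiff_slice g m.1).comp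
      (contMDiff_mul_left (a := m.2)) (1 : G)).mdifferentiableAt (by simp)
    exact DFunLike.congr_fun (mvfderiv_add hf hg) x
  map_smul' c f := by
    ext m
    have hf := ((contMDiff_slice f m.1).comp
      (contMDiff_mul_left (a := m.2)) (1 : G)).mdifferentiableAt (by simp)
    exact mvfderiv_const_mul c _ _ hf x

/-- The constant vector field `ξ ∈ F*` on `U` acting on functions on `U × G`. -/
noncomputable def dirField (ξ : StrongDual ℝ F) : Module.End ℝ (Fn E G U) where
  toFun f := ⟨fun m => mvfderiv 𝓘(ℝ, StrongDual ℝ F) (fun μ : U => f (μ, m.2)) m.1 ξ, by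
    exact contMDiff_dirDeriv U (J := 𝓘(ℝ, E)) (fun (μ : U) (g : G) => f (μ, g)) f.contMDiff ξ⟩
  map_add' f g := by
    ext m
    exact DFunLike.congr_fun (mvfderiv_add
      ((contMDiff_sliceU f m.2 m.1).mdifferentiableAt (by simp))
      ((contMDiff_sliceU g m.2 m.1).mdifferentiableAt (by simp))) ξ
  map_smul' c f := by
    ext m
    exact mvfderiv_const_mul c _ _
      ((contMDiff_sliceU f m.2 m.1).mdifferentiableAt (by simp)) ξ

theorem leftField_bracket (x y : LieAlg E G) (f : Fn E G U) :
    leftField ⁅x, y⁆ f = leftField x (leftField y f) - leftField y (leftField x f) := by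
  ext m
  exact lieDeriv_bracket (fun g : G => f (m.1, g)) (contMDiff_slice f m.1) x y m.2

/-- Pull-back along `(l, g) ↦ (l, g⁻¹)`. -/
noncomputable def invPull : Module.End ℝ (Fn E G U) where
  toFun f := ⟨fun m => f (m.1, m.2⁻¹),
    f.contMDiff.comp (contMDiff_fst.prodMk ((contMDiff_inv 𝓘(ℝ, E) ∞).comp contMDiff_snd))⟩
  map_add' _ _ := rfl
  map_smul' _ _ := rfl

/-- The infinitesimal action of `x ∈ 𝔤` on functions on `U × G` which generates the left
translations: `(x · f)(l, g)` is the derivative of `a ↦ f (l, a⁻¹ g)` at `a = 1` in the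
direction `x` (see `leftAction_apply`). -/
noncomputable def leftAction : LieAlg E G →ₗ⁅ℝ⁆ Module.End ℝ (Fn E G U) where
  toFun x := invPull * leftField x * invPull
  map_add' x y := by
    ext f m
    exact map_add (mvfderiv 𝓘(ℝ, E) (fun a : G => f (m.1, (m.2⁻¹ * a)⁻¹)) 1) x y
  map_smul' c x := by
    ext f m
    exact map_smul (mvfderiv 𝓘(ℝ, E) (fun a : G => f (m.1, (m.2⁻¹ * a)⁻¹)) 1) c x
  map_lie' {x y} := by
    have hi : ∀ f : Fn E G U, invPull (invPull f) = f := fun f => by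
      ext m
      change f (m.1, m.2⁻¹⁻¹) = f m
      rw [inv_inv]
    ext1 f
    change invPull (leftField ⁅x, y⁆ (invPull f)) = invPull (leftField x (invPull (invPull
      (leftField y (invPull f))))) - invPull (leftField y (invPull (invPull
      (leftField x (invPull f)))))
    rw [leftField_bracket, hi, hi, map_sub]

theorem leftAction_apply (x : LieAlg E G) (f : Fn E G U) (m : U × G) :
    leftAction x f m = mvfderiv 𝓘(ℝ, E) (fun a : G => f (m.1, a⁻¹ * m.2)) 1 x := by
  change mvfderiv 𝓘(ℝ, E) (fun a : G => f (m.1, (m.2⁻¹ * a)⁻¹)) 1 x = _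
  simp only [mul_inv_rev, inv_inv]

/-- Pull-back along the left translation `(l, g) ↦ (l, a g)`. -/
noncomputable def leftPull (a : G) : Module.End ℝ (Fn E G U) where
  toFun f := ⟨fun m => f (m.1, a * m.2),
    f.contMDiff.comp (contMDiff_fst.prodMk (contMDiff_mul_left.comp contMDiff_snd))⟩
  map_add' _ _ := rfl
  map_smul' _ _ := rfl

/-- The element `y ∈ 𝔥` seen as a linear function on `U ⊆ 𝔥*`, pulled back to `U × G`. -/
noncomputable def lin (y : F) : Fn E G U :=
  ⟨fun m => (m.1 : StrongDual ℝ F) y, by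
    have h : ContMDiff 𝓘(ℝ, StrongDual ℝ F) 𝓘(ℝ, ℝ) ∞ (fun l : StrongDual ℝ F => l y) :=
      (ContinuousLinearMap.apply ℝ ℝ y).contMDiff
    exact h.comp (contMDiff_subtype_val.comp contMDiff_fst)⟩

end Operators


section Base

/-- The adjoint action of `x ∈ H` on the Lie algebra of `H` (a copy of `F`): the derivative of
`y ↦ x y x⁻¹` at `1`. -/
noncomputable def Ad (F : Type*) {H : Type*} [NormedAddCommGroup F] [NormedSpace ℝ F]
    [TopologicalSpace H] [ChartedSpace F H] [Group H] (x : H) : F →L[ℝ] F :=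
  mfderiv 𝓘(ℝ, F) 𝓘(ℝ, F) (fun y : H => x * y * x⁻¹) 1

/-- An injective Lie group homomorphism `H → G` (a Lie subgroup of `G`; `H` and `G` are modelled
on `F` and `E`, so that the Lie algebras `𝔥` and `𝔤` are copies of `F` and `E`), together with an
open subset `U ⊆ 𝔥*` which is invariant under the coadjoint action `l ↦ l ∘ Ad_x` of `H`. -/
structure Base (F E H G : Type*) [NormedAddCommGroup F] [NormedSpace ℝ F]
    [NormedAddCommGroup E] [NormedSpace ℝ E]
    [TopologicalSpace H] [ChartedSpace F H] [Group H]
    [TopologicalSpace G] [ChartedSpace E G] [Group G] where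
  incl : ContMDiffMonoidMorphism 𝓘(ℝ, F) 𝓘(ℝ, E) ∞ H G
  injective : Function.Injective incl
  U : Opens (StrongDual ℝ F)
  invariant : ∀ (x : H), ∀ l ∈ U, l.comp (Ad F x) ∈ U

variable {F E H G : Type*} [NormedAddCommGroup F] [NormedSpace ℝ F] [FiniteDimensional ℝ F]
  [NormedAddCommGroup E] [NormedSpace ℝ E] [FiniteDimensional ℝ E]
  [TopologicalSpace H] [ChartedSpace F H] [Group H] [LieGroup 𝓘(ℝ, F) ∞ H]
  [TopologicalSpace G] [ChartedSpace E G] [Group G] [LieGroup 𝓘(ℝ, E) ∞ G]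

namespace Base

variable (D : Base F E H G)

/-- The inclusion `𝔥 → 𝔤` of Lie algebras (the derivative of `H → G` at `1`). -/
noncomputable def inclLie : LieAlg F H →ₗ[ℝ] LieAlg E G :=
  (mfderiv 𝓘(ℝ, F) 𝓘(ℝ, E) D.incl 1 : F →L[ℝ] E).toLinearMap

/-- The algebra `𝒪_M` of smooth functions on `M = U × G`. -/
abbrev Obs := Fn E G D.U

/-- The right action of `x ∈ H` on `M`: `(l, g) ↦ (l ∘ Ad_x, g x)`. -/
noncomputable def rightAct (x : H) (m : D.U × G) : D.U × G :=
  (⟨(m.1 : StrongDual ℝ F).comp (Ad F x),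
    D.invariant x m.1 m.1.2⟩, m.2 * D.incl x)

theorem contMDiff_rightAct (x : H) :
    ContMDiff ((𝓘(ℝ, StrongDual ℝ F)).prod 𝓘(ℝ, E)) ((𝓘(ℝ, StrongDual ℝ F)).prod 𝓘(ℝ, E)) ∞
      (D.rightAct x) := by
  refine ContMDiff.prodMk ?_ (contMDiff_mul_right.comp contMDiff_snd)
  intro m
  rw [← ContMDiffAt.subtypeVal_comp_iff]
  have h : ContMDiff 𝓘(ℝ, StrongDual ℝ F) 𝓘(ℝ, StrongDual ℝ F) ∞
      (fun l : StrongDual ℝ F => l.comp (Ad F x)) :=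
    ((ContinuousLinearMap.compL ℝ F F ℝ).flip
      (Ad F x)).contMDiff
  exact (h.comp (contMDiff_subtype_val.comp contMDiff_fst)) m

/-- Pull-back of functions along the right action of `x ∈ H`. -/
noncomputable def rightPull (x : H) : Module.End ℝ D.Obs where
  toFun f := ⟨fun m => f (D.rightAct x m), f.contMDiff.comp (D.contMDiff_rightAct x)⟩
  map_add' _ _ := rfl
  map_smul' _ _ := rfl

/-- `G × H`-invariance of a linear operator on `𝒪_M`. -/
def Invariant (P : Module.End ℝ D.Obs) : Prop :=
  (∀ a f, P (leftPull a f) = leftPull a (P f)) ∧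
    ∀ x f, P (D.rightPull x f) = D.rightPull x (P f)

/-- `G × H`-invariance of a bilinear operator on `𝒪_M`. -/
def Invariant₂ (B : D.Obs →ₗ[ℝ] D.Obs →ₗ[ℝ] D.Obs) : Prop :=
  (∀ a f g, B (leftPull a f) (leftPull a g) = leftPull a (B f g)) ∧
    ∀ x f g, B (D.rightPull x f) (D.rightPull x g) = D.rightPull x (B f g)

/-- The algebra `Diff(M)` of differential operators on `M`, generated by the multiplications by
functions and the vector fields (the derivations of `𝒪_M`). -/
noncomputable def Diff : Subalgebra ℝ (Module.End ℝ D.Obs) :=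
  Algebra.adjoin ℝ (Set.range (LinearMap.mulLeft ℝ : D.Obs → Module.End ℝ D.Obs) ∪
    Set.range (fun X : Derivation ℝ D.Obs D.Obs => (X : Module.End ℝ D.Obs)))

/-- The bidifferential operators on `M`: the finite sums of operators
`(f, g) ↦ P f * Q g` with `P` and `Q` in `Diff(M)`. -/
noncomputable def Bidiff : Submodule ℝ (D.Obs →ₗ[ℝ] D.Obs →ₗ[ℝ] D.Obs) :=
  Submodule.span ℝ {C | ∃ P ∈ D.Diff, ∃ Q ∈ D.Diff,
    C = (LinearMap.mul ℝ D.Obs).compl₁₂ P Q}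

/-- A bivector field, seen as a skew-symmetric biderivation of `𝒪_M`. -/
def IsBivector (B : D.Obs →ₗ[ℝ] D.Obs →ₗ[ℝ] D.Obs) : Prop :=
  (∀ f, B f f = 0) ∧ ∀ f g h, B f (g * h) = g * B f h + h * B f g

/-- The Hochschild coboundary `(bP)(f, g) = f P(g) - P(f g) + P(f) g`. -/
noncomputable def hoch (P : Module.End ℝ D.Obs) (f g : D.Obs) : D.Obs :=
  f * P g - P (f * g) + P f * g

/-- The Schouten bracket `[π, X]` of a bivector field and a vector field,
`[π, X](f, g) = π(X f, g) + π(f, X g) - X (π(f, g))`, that is, `-L_X π`. -/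
noncomputable def schoutenVec (π : D.Obs →ₗ[ℝ] D.Obs →ₗ[ℝ] D.Obs) (X : Derivation ℝ D.Obs D.Obs)
    (f g : D.Obs) : D.Obs :=
  π (X f) g + π f (X g) - X (π f g)

/-- The Schouten bracket `[π, B]` of two bivector fields, as a skew-symmetric triderivation
(up to a nonzero constant that depends on conventions). -/
noncomputable def schoutenBiv (π B : D.Obs →ₗ[ℝ] D.Obs →ₗ[ℝ] D.Obs) (f g h : D.Obs) : D.Obs :=
  (π (B f g) h + π (B g h) f + π (B h f) g) + (B (π f g) h + B (π g h) f + B (π h f) g)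

end Base
end Base

section Tensors

variable {E G : Type*} [NormedAddCommGroup E] [NormedSpace ℝ E] [FiniteDimensional ℝ E]
  [TopologicalSpace G] [ChartedSpace E G] [Group G] [LieGroup 𝓘(ℝ, E) ∞ G]

variable (L : Type*) [LieRing L] [LieAlgebra ℝ L]

/-- The Lie bracket as a linear map `L ⊗ L → L`. -/
noncomputable def brTensor : L ⊗[ℝ] L →ₗ[ℝ] L := TensorProduct.lift (LieModule.toEnd ℝ L L)

/-- `(a ⊗ b) ⊗ (c ⊗ d) ↦ [a, c] ⊗ b ⊗ d`, i.e. `s ⊗ t ↦ [s¹², t¹³]`. -/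
noncomputable def br₁ : (L ⊗[ℝ] L) ⊗[ℝ] (L ⊗[ℝ] L) →ₗ[ℝ] L ⊗[ℝ] (L ⊗[ℝ] L) :=
  (brTensor L).rTensor _ ∘ₗ (TensorProduct.tensorTensorTensorComm ℝ L L L L).toLinearMap

/-- `(a ⊗ b) ⊗ (c ⊗ d) ↦ a ⊗ [b, c] ⊗ d`, i.e. `s ⊗ t ↦ [s¹², t²³]`. -/
noncomputable def br₂ : (L ⊗[ℝ] L) ⊗[ℝ] (L ⊗[ℝ] L) →ₗ[ℝ] L ⊗[ℝ] (L ⊗[ℝ] L) :=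
  ((brTensor L).rTensor L ∘ₗ (TensorProduct.assoc ℝ L L L).symm.toLinearMap).lTensor L ∘ₗ
    (TensorProduct.assoc ℝ L L (L ⊗[ℝ] L)).toLinearMap

/-- `(a ⊗ b) ⊗ (c ⊗ d) ↦ a ⊗ c ⊗ [b, d]`, i.e. `s ⊗ t ↦ [s¹³, t²³]`. -/
noncomputable def br₃ : (L ⊗[ℝ] L) ⊗[ℝ] (L ⊗[ℝ] L) →ₗ[ℝ] L ⊗[ℝ] (L ⊗[ℝ] L) :=
  (TensorProduct.assoc ℝ L L L).toLinearMap ∘ₗ (brTensor L).lTensor _ ∘ₗ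
    (TensorProduct.tensorTensorTensorComm ℝ L L L L).toLinearMap

variable {L}

/-- `½ [s, s] = [s¹², s¹³] + [s¹², s²³] + [s¹³, s²³]` for `s ∈ ∧² L`. -/
noncomputable def halfBracket (s : L ⊗[ℝ] L) : L ⊗[ℝ] (L ⊗[ℝ] L) :=
  br₁ L (s ⊗ₜ s) + br₂ L (s ⊗ₜ s) + br₃ L (s ⊗ₜ s)

variable {V : Type*} [AddCommGroup V] [Module ℝ V]

/-- The transposition of the first two factors of `V ⊗ V ⊗ V`. -/
noncomputable def swap₁₂ : V ⊗[ℝ] (V ⊗[ℝ] V) →ₗ[ℝ] V ⊗[ℝ] (V ⊗[ℝ] V) :=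
  (TensorProduct.leftComm ℝ V V V).toLinearMap

/-- The transposition of the last two factors of `V ⊗ V ⊗ V`. -/
noncomputable def swap₂₃ : V ⊗[ℝ] (V ⊗[ℝ] V) →ₗ[ℝ] V ⊗[ℝ] (V ⊗[ℝ] V) :=
  (TensorProduct.comm ℝ V V).toLinearMap.lTensor V

/-- The (not normalized) alternation `∑ sgn(σ) σ` on `V ⊗ V ⊗ V`. -/
noncomputable def alt (t : V ⊗[ℝ] (V ⊗[ℝ] V)) : V ⊗[ℝ] (V ⊗[ℝ] V) :=
  t - swap₁₂ t - swap₂₃ t - swap₁₂ (swap₂₃ (swap₁₂ t)) + swap₁₂ (swap₂₃ t) + swap₂₃ (swap₁₂ t)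

/-- `c ∧ t` for `c ∈ V` and `t ∈ ∧² V`, where exterior powers are embedded in tensor powers by
`a ∧ b = a ⊗ b - b ⊗ a` (and similarly, without normalization, in degree three). -/
noncomputable def wedge (c : V) (t : V ⊗[ℝ] V) : V ⊗[ℝ] (V ⊗[ℝ] V) :=
  c ⊗ₜ t - swap₁₂ (c ⊗ₜ t) + swap₂₃ (swap₁₂ (c ⊗ₜ t))

/-- The adjoint action of `x` on `L ⊗ L`. -/
noncomputable def ad₂ (x : L) : L ⊗[ℝ] L →ₗ[ℝ] L ⊗[ℝ] L :=
  (LieModule.toEnd ℝ L L x).rTensor L + (LieModule.toEnd ℝ L L x).lTensor L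

/-- The adjoint action of `x` on `L ⊗ L ⊗ L`. -/
noncomputable def ad₃ (x : L) : L ⊗[ℝ] (L ⊗[ℝ] L) →ₗ[ℝ] L ⊗[ℝ] (L ⊗[ℝ] L) :=
  (LieModule.toEnd ℝ L L x).rTensor (L ⊗[ℝ] L) + (ad₂ x).lTensor L

/-- `Z ∈ (∧³ L)^L`. -/
def IsInvariantTrivector (Z : L ⊗[ℝ] (L ⊗[ℝ] L)) : Prop :=
  swap₁₂ Z = -Z ∧ swap₂₃ Z = -Z ∧ ∀ x : L, ad₃ x Z = 0

end Tensors

section Enveloping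

variable (L : Type*) [LieRing L] [LieAlgebra ℝ L]

/-- The universal enveloping algebra of `L`. -/
abbrev UEA := UniversalEnvelopingAlgebra ℝ L

/-- The coproduct of the enveloping algebra, `Δ x = x ⊗ 1 + 1 ⊗ x` for `x ∈ L`. -/
noncomputable def comul : UEA L →ₐ[ℝ] UEA L ⊗[ℝ] UEA L :=
  UniversalEnvelopingAlgebra.lift ℝ
    { toFun := fun x => UniversalEnvelopingAlgebra.ι ℝ x ⊗ₜ 1 + 1 ⊗ₜ UniversalEnvelopingAlgebra.ι ℝ x
      map_add' := fun x y => by simp only [map_add, TensorProduct.add_tmul, TensorProduct.tmul_add]; abel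
      map_smul' := fun c x => by
        simp only [map_smul, TensorProduct.smul_tmul', TensorProduct.tmul_smul, smul_add,
          RingHom.id_apply]
      map_lie' := fun {x y} => by
        simp only [LieHom.map_lie, LieRing.of_associative_ring_bracket, mul_add, add_mul,
          Algebra.TensorProduct.tmul_mul_tmul, one_mul, mul_one, TensorProduct.sub_tmul,
          TensorProduct.tmul_sub]
        abel }

/-- The counit of the enveloping algebra. -/
noncomputable def counit : UEA L →ₐ[ℝ] ℝ := UniversalEnvelopingAlgebra.lift ℝ 0

/-- The antipode of the enveloping algebra, as a morphism to the opposite algebra: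
`S x = -x` for `x ∈ L`. -/
noncomputable def antipodeOp : UEA L →ₐ[ℝ] (UEA L)ᵐᵒᵖ :=
  UniversalEnvelopingAlgebra.lift ℝ
    { toFun := fun x => MulOpposite.op (-UniversalEnvelopingAlgebra.ι ℝ x)
      map_add' := fun x y => by simp only [map_add, neg_add, MulOpposite.op_add]
      map_smul' := fun c x => by simp only [map_smul, ← smul_neg, MulOpposite.op_smul, RingHom.id_apply]
      map_lie' := fun {x y} => by
        simp only [LieHom.map_lie, LieRing.of_associative_ring_bracket, ← MulOpposite.op_mul,
          ← MulOpposite.op_sub, neg_mul_neg, neg_sub] }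

/-- The antipode of the enveloping algebra, as a linear map. -/
noncomputable def antipode : UEA L →ₗ[ℝ] UEA L :=
  (MulOpposite.opLinearEquiv ℝ).symm.toLinearMap ∘ₗ (antipodeOp L).toLinearMap

/-- `U(L) ⊗ U(L) ⊗ U(L)`. -/
abbrev UEA₃ := UEA L ⊗[ℝ] (UEA L ⊗[ℝ] UEA L)

/-- `U(L) ⊗ U(L) ⊗ U(L) ⊗ U(L)`. -/
abbrev UEA₄ := UEA L ⊗[ℝ] (UEA L ⊗[ℝ] (UEA L ⊗[ℝ] UEA L))

open Algebra.TensorProduct in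
/-- `id ⊗ id ⊗ Δ`. -/
noncomputable def face₃ : UEA₃ L →ₐ[ℝ] UEA₄ L :=
  map (AlgHom.id ℝ (UEA L)) (map (AlgHom.id ℝ (UEA L)) (comul L))

open Algebra.TensorProduct in
/-- `Δ ⊗ id ⊗ id`. -/
noncomputable def face₁ : UEA₃ L →ₐ[ℝ] UEA₄ L :=
  (Algebra.TensorProduct.assoc ℝ ℝ ℝ (UEA L) (UEA L) (UEA L ⊗[ℝ] UEA L)).toAlgHom.comp
    (map (comul L) (AlgHom.id ℝ (UEA L ⊗[ℝ] UEA L)))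

open Algebra.TensorProduct in
/-- `id ⊗ Δ ⊗ id`. -/
noncomputable def face₂ : UEA₃ L →ₐ[ℝ] UEA₄ L :=
  map (AlgHom.id ℝ (UEA L))
    ((Algebra.TensorProduct.assoc ℝ ℝ ℝ (UEA L) (UEA L) (UEA L)).toAlgHom.comp
      (map (comul L) (AlgHom.id ℝ (UEA L))))

open Algebra.TensorProduct in
/-- `T ↦ 1 ⊗ T`. -/
noncomputable def face₀ : UEA₃ L →ₐ[ℝ] UEA₄ L := includeRight

open Algebra.TensorProduct in
/-- `T ↦ T ⊗ 1`. -/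
noncomputable def face₄ : UEA₃ L →ₐ[ℝ] UEA₄ L :=
  map (AlgHom.id ℝ (UEA L)) (map (AlgHom.id ℝ (UEA L)) includeLeft)

variable {L}

/-- `x ⊗ 1 ⊗ 1 + 1 ⊗ x ⊗ 1 + 1 ⊗ 1 ⊗ x`. -/
noncomputable def diag₃ (x : L) : UEA₃ L :=
  UniversalEnvelopingAlgebra.ι ℝ x ⊗ₜ (1 ⊗ₜ 1) + 1 ⊗ₜ (UniversalEnvelopingAlgebra.ι ℝ x ⊗ₜ 1) +
    1 ⊗ₜ (1 ⊗ₜ UniversalEnvelopingAlgebra.ι ℝ x)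

/-- `Φ ∈ (U(L) ⊗ U(L) ⊗ U(L))^L[[ħ]]` is an associator quantizing `Z ∈ (∧³ L)^L`: it is
`L`-invariant, satisfies the pentagon equation
`Φ^{1,2,34} Φ^{12,3,4} = Φ^{2,3,4} Φ^{1,23,4} Φ^{1,2,3}` and the counit axiom in each of the three
factors, and `Φ = 1 + O(ħ²)` with `Alt(Φ) = ħ² Z + O(ħ³)`. -/
structure IsAssociator (Z : L ⊗[ℝ] (L ⊗[ℝ] L)) (Φ : (PowerSeries (UEA₃ L))ˣ) : Prop where
  invariant : ∀ (x : L) (k : ℕ), diag₃ x * PowerSeries.coeff k Φ.1 =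
    PowerSeries.coeff k Φ.1 * diag₃ x
  pentagon : PowerSeries.map (face₃ L).toRingHom Φ.1 * PowerSeries.map (face₁ L).toRingHom Φ.1 =
    PowerSeries.map (face₀ L).toRingHom Φ.1 * PowerSeries.map (face₂ L).toRingHom Φ.1 *
      PowerSeries.map (face₄ L).toRingHom Φ.1
  counit₁ : ∀ k, (counit L).toLinearMap.rTensor (UEA L ⊗[ℝ] UEA L) (PowerSeries.coeff k Φ.1) =
    if k = 0 then 1 ⊗ₜ (1 ⊗ₜ 1) else 0
  counit₂ : ∀ k, ((counit L).toLinearMap.rTensor (UEA L)).lTensor (UEA L)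
    (PowerSeries.coeff k Φ.1) = if k = 0 then 1 ⊗ₜ (1 ⊗ₜ 1) else 0
  counit₃ : ∀ k, ((counit L).toLinearMap.lTensor (UEA L)).lTensor (UEA L)
    (PowerSeries.coeff k Φ.1) = if k = 0 then 1 ⊗ₜ (1 ⊗ₜ 1) else 0
  coeff_zero : PowerSeries.coeff 0 Φ.1 = 1
  coeff_one : PowerSeries.coeff 1 Φ.1 = 0
  quantizes : alt (PowerSeries.coeff 2 Φ.1) =
    TensorProduct.map (UniversalEnvelopingAlgebra.ι ℝ : L →ₗ⁅ℝ⁆ UEA L).toLinearMap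
      (TensorProduct.map (UniversalEnvelopingAlgebra.ι ℝ : L →ₗ⁅ℝ⁆ UEA L).toLinearMap
        (UniversalEnvelopingAlgebra.ι ℝ : L →ₗ⁅ℝ⁆ UEA L).toLinearMap) Z

/-- The coefficients of `S^{⊗3}(Φ⁻¹)`. -/
noncomputable def twistedCoeff (Φ : (PowerSeries (UEA₃ L))ˣ) (k : ℕ) : UEA₃ L :=
  TensorProduct.map (antipode L) (TensorProduct.map (antipode L) (antipode L))
    (PowerSeries.coeff k (Φ⁻¹).1)

end Enveloping

section Quantization

variable {F E H G : Type*} [NormedAddCommGroup F] [NormedSpace ℝ F] [FiniteDimensional ℝ F]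
  [NormedAddCommGroup E] [NormedSpace ℝ E] [FiniteDimensional ℝ E]
  [TopologicalSpace H] [ChartedSpace F H] [Group H] [LieGroup 𝓘(ℝ, F) ∞ H]
  [TopologicalSpace G] [ChartedSpace E G] [Group G] [LieGroup 𝓘(ℝ, E) ∞ G]

/-- A basis `(h_i)` of `𝔥` (nothing below depends on its choice). -/
noncomputable def hBasis (F : Type*) [NormedAddCommGroup F] [NormedSpace ℝ F]
    [FiniteDimensional ℝ F] : Module.Basis (Fin (Module.finrank ℝ F)) ℝ F :=
  Module.finBasis ℝ F

/-- The dual basis `(λ^i)` of `𝔥*`. -/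
noncomputable def hDual (F : Type*) [NormedAddCommGroup F] [NormedSpace ℝ F]
    [FiniteDimensional ℝ F] (i : Fin (Module.finrank ℝ F)) : StrongDual ℝ F :=
  LinearMap.toContinuousLinearMap ((hBasis F).coord i)

/-- The Lie brackets `[h_i, h_j]` of the basis vectors of the Lie algebra `𝔥` of `H`. -/
noncomputable def hBracket (F H : Type*) [NormedAddCommGroup F] [NormedSpace ℝ F]
    [FiniteDimensional ℝ F] [TopologicalSpace H] [ChartedSpace F H] [Group H]
    (i j : Fin (Module.finrank ℝ F)) : LieAlg F H :=
  let x : LieAlg F H := hBasis F i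
  let y : LieAlg F H := hBasis F j
  ⁅x, y⁆

/-- A basis of `𝔤` (nothing below depends on its choice). -/
noncomputable def gBasis (E G : Type*) [NormedAddCommGroup E] [NormedSpace ℝ E]
    [FiniteDimensional ℝ E] [TopologicalSpace G] [ChartedSpace E G] [Group G] :
    Module.Basis (Fin (Module.finrank ℝ E)) ℝ (LieAlg E G) :=
  Module.finBasis ℝ E

namespace Base

variable (D : Base F E H G)

/-- A smooth map `U → 𝔤 ⊗ 𝔤`. -/
structure SmoothTensor where
  toFun : D.U → LieAlg E G ⊗[ℝ] LieAlg E G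
  smooth : ∀ φ : LieAlg E G ⊗[ℝ] LieAlg E G →ₗ[ℝ] ℝ,
    ContMDiff 𝓘(ℝ, StrongDual ℝ F) 𝓘(ℝ, ℝ) ∞ (fun l : D.U => φ (toFun l))

/-- The derivative at `l ∈ U` in the direction `ξ ∈ 𝔥*` of a function on `U`. -/
noncomputable def dirDeriv (f : D.U → ℝ) (l : D.U) (ξ : StrongDual ℝ F) : ℝ :=
  mvfderiv 𝓘(ℝ, StrongDual ℝ F) f l ξ

/-- `l ∘ ad_y ∈ 𝔥*`, for `l ∈ 𝔥*` and `y ∈ 𝔥`. -/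
noncomputable def coadLie (_D : Base F E H G) (y : LieAlg F H) (l : StrongDual ℝ F) :
    StrongDual ℝ F :=
  LinearMap.toContinuousLinearMap (E := F)
    ((l : F →ₗ[ℝ] ℝ) ∘ₗ (LieModule.toEnd ℝ (LieAlg F H) (LieAlg F H) y : F →ₗ[ℝ] F))

/-- `r : U → ∧² 𝔤` is a dynamical `r`-matrix with `Z`: it is `𝔥`-equivariant and satisfies the
classical dynamical Yang-Baxter equation `½ [r, r] - ∑ h_i ∧ ∂r/∂λ^i = Z`. The values in the
finite-dimensional spaces `𝔤 ⊗ 𝔤` and `𝔤 ⊗ 𝔤 ⊗ 𝔤` are tested against all linear forms `φ`. -/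
structure IsRMatrix (r : D.SmoothTensor) (Z : LieAlg E G ⊗[ℝ] (LieAlg E G ⊗[ℝ] LieAlg E G)) :
    Prop where
  skew : ∀ l, TensorProduct.comm ℝ (LieAlg E G) (LieAlg E G) (r.toFun l) = -r.toFun l
  equivariant : ∀ (y : LieAlg F H) (l : D.U) (φ : LieAlg E G ⊗[ℝ] LieAlg E G →ₗ[ℝ] ℝ),
    D.dirDeriv (fun μ => φ (r.toFun μ)) l (D.coadLie y l) +
      φ (ad₂ (D.inclLie y) (r.toFun l)) = 0
  invariant : IsInvariantTrivector Z
  yangBaxter : ∀ (l : D.U) (φ : LieAlg E G ⊗[ℝ] (LieAlg E G ⊗[ℝ] LieAlg E G) →ₗ[ℝ] ℝ),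
    φ (halfBracket (r.toFun l)) -
      ∑ i, D.dirDeriv (fun μ => φ (wedge (D.inclLie (hBasis F i)) (r.toFun μ))) l (hDual F i) =
    φ Z

/-- The coefficient functions of `r` in the basis of `𝔤 ⊗ 𝔤`, as functions on `M`. -/
noncomputable def rCoeff (r : D.SmoothTensor) (k l : Fin (Module.finrank ℝ E)) : D.Obs :=
  ⟨fun m => ((gBasis E G).tensorProduct (gBasis E G)).coord (k, l) (r.toFun m.1),
    (r.smooth (((gBasis E G).tensorProduct (gBasis E G)).coord (k, l))).comp contMDiff_fst⟩

/-- The bilinear operator `(f, g) ↦ c * P f * Q g`. -/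
noncomputable def biOp (c : D.Obs) (P Q : Module.End ℝ D.Obs) : D.Obs →ₗ[ℝ] D.Obs →ₗ[ℝ] D.Obs :=
  ((LinearMap.mul ℝ D.Obs).compl₁₂ P Q).compr₂ (LinearMap.mulLeft ℝ c)

/-- The bracket `{f, g} = ⟨π_r, df ∧ dg⟩` of the bivector field
`π_r = π_lin + ∑ ∂/∂λ^i ∧ h_i + r(λ)` on `M = U × G`, where elements of `𝔤` stand for
left-invariant vector fields and `π_lin` is the linear Poisson structure of `𝔥*`. -/
noncomputable def bracket (r : D.SmoothTensor) : D.Obs →ₗ[ℝ] D.Obs →ₗ[ℝ] D.Obs :=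
  (∑ i, ∑ j, D.biOp (lin (hBracket F H i j))
      (dirField (hDual F i)) (dirField (hDual F j))) +
  (∑ i, (D.biOp 1 (dirField (hDual F i)) (leftField (D.inclLie (hBasis F i))) -
      D.biOp 1 (leftField (D.inclLie (hBasis F i))) (dirField (hDual F i)))) +
  ∑ k, ∑ l, D.biOp (D.rCoeff r k l) (leftField (gBasis E G k)) (leftField (gBasis E G l))

/-- The bivector field `π_r` as a bidifferential operator, with the convention
`(X ∧ Y)(f, g) = ½ (X f Y g - Y f X g)` for which `C₁ - C₁^op = {·, ·}` says that the
skew-symmetric part of `C₁` is `π_r`. -/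
noncomputable def piOp (r : D.SmoothTensor) : D.Obs →ₗ[ℝ] D.Obs →ₗ[ℝ] D.Obs :=
  (1 / 2 : ℝ) • D.bracket r

/-- The action of `U(𝔤)^{⊗3}` on `𝒪_M^{⊗3}` induced by the infinitesimal left translations. -/
noncomputable def act₃ : UEA₃ (LieAlg E G) →ₗ[ℝ]
    Module.End ℝ (D.Obs ⊗[ℝ] (D.Obs ⊗[ℝ] D.Obs)) :=
  let ρ : UEA (LieAlg E G) →ₗ[ℝ] Module.End ℝ D.Obs :=
    (UniversalEnvelopingAlgebra.lift ℝ (leftAction (U := D.U))).toLinearMap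
  TensorProduct.homTensorHomMap (RingHom.id ℝ) D.Obs (D.Obs ⊗[ℝ] D.Obs) D.Obs (D.Obs ⊗[ℝ] D.Obs) ∘ₗ
    TensorProduct.map ρ
      (TensorProduct.homTensorHomMap (RingHom.id ℝ) D.Obs D.Obs D.Obs D.Obs ∘ₗ TensorProduct.map ρ ρ)

/-- `f * g = ∑ ħ^k C_k(f, g)` is a quantization of the quasi-Poisson manifold `(M, π_r, Z)`, with
respect to the associator `Φ`: the `C_k` are `𝔤`-invariant bidifferential operators,
`f * g = f g + O(ħ)`, `f * g - g * f = ħ {f, g} + O(ħ²)` and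
`m_* ∘ (m_* ⊗ id) = m_* ∘ (id ⊗ m_*) ∘ ρ^{⊗3}(S^{⊗3}(Φ⁻¹))`. -/
structure IsQuantization (r : D.SmoothTensor) (Φ : (PowerSeries (UEA₃ (LieAlg E G)))ˣ)
    (C : ℕ → D.Obs →ₗ[ℝ] D.Obs →ₗ[ℝ] D.Obs) : Prop where
  bidiff : ∀ k, C k ∈ D.Bidiff
  invariant : ∀ k (x : LieAlg E G) f g,
    leftAction x (C k f g) = C k (leftAction x f) g + C k f (leftAction x g)
  zero : ∀ f g, C 0 f g = f * g
  one : ∀ f g, C 1 f g - C 1 g f = D.bracket r f g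
  assoc : ∀ N f g h, ∑ p ∈ Finset.HasAntidiagonal.antidiagonal N, C p.1 (C p.2 f g) h =
    ∑ p ∈ Finset.HasAntidiagonal.antidiagonal N, ∑ q ∈ Finset.HasAntidiagonal.antidiagonal p.2,
      TensorProduct.lift (C p.1) ((TensorProduct.lift (C q.1)).lTensor D.Obs
        (D.act₃ (twistedCoeff Φ q.2) (f ⊗ₜ (g ⊗ₜ h))))

/-- A quantization is strongly `𝔥`-invariant if the momentum map `M → 𝔥*` is itself a quantum
momentum map: `y * f - f * y = ħ {y, f}` for all `y ∈ 𝔥 ⊆ 𝒪_{𝔥*}` and `f ∈ 𝒪_M`. -/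
structure IsStronglyInvariant (r : D.SmoothTensor) (Φ : (PowerSeries (UEA₃ (LieAlg E G)))ˣ)
    (C : ℕ → D.Obs →ₗ[ℝ] D.Obs →ₗ[ℝ] D.Obs) : Prop extends D.IsQuantization r Φ C where
  momentum : ∀ k (y : F) f,
    C k (lin y) f - C k f (lin y) = if k = 1 then D.bracket r (lin y) f else 0

/-- `Q = ∑ ħ^k Q_k` is a strongly invariant equivalence: `Q = id + O(ħ) ∈ Diff(M)^{G × H}[[ħ]]`
and `Q(y) = y` for all `y ∈ 𝔥`. -/
structure IsStrongEquivalence (Q : ℕ → Module.End ℝ D.Obs) : Prop where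
  zero : Q 0 = 1
  diff : ∀ k, Q k ∈ D.Diff
  invariant : ∀ k, D.Invariant (Q k)
  fixes : ∀ k (y : F), Q k (lin y) = if k = 0 then lin y else 0

/-- `Q (f * g) = Q f *' Q g`: the equivalence `Q` transforms `*` into `*'`. -/
def Transforms (Q : ℕ → Module.End ℝ D.Obs) (C C' : ℕ → D.Obs →ₗ[ℝ] D.Obs →ₗ[ℝ] D.Obs) : Prop :=
  ∀ N f g, ∑ p ∈ Finset.HasAntidiagonal.antidiagonal N, Q p.1 (C p.2 f g) =
    ∑ p ∈ Finset.HasAntidiagonal.antidiagonal N, ∑ q ∈ Finset.HasAntidiagonal.antidiagonal p.2, C' p.1 (Q q.1 f) (Q q.2 g)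

/-- The conditions on the pair `(B, E)` in the decomposition `A = B + bE`. -/
structure IsSplitting (r : D.SmoothTensor) (A B : D.Obs →ₗ[ℝ] D.Obs →ₗ[ℝ] D.Obs)
    (P : Module.End ℝ D.Obs) : Prop where
  bivector : D.IsBivector B
  invariantB : D.Invariant₂ B
  killsB : ∀ (y : F) f, B (lin y) f = 0
  closed : ∀ f g h, D.schoutenBiv (D.piOp r) B f g h = 0
  diff : P ∈ D.Diff
  invariantP : D.Invariant P
  killsP : ∀ y : F, P (lin y) = 0
  eq : ∀ f g, A f g = B f g + D.hoch P f g

/-- The conditions on `P` in the decomposition `C₁ = π_r + bP`. -/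
structure IsFirstOrder (r : D.SmoothTensor) (C₁ : D.Obs →ₗ[ℝ] D.Obs →ₗ[ℝ] D.Obs)
    (P : Module.End ℝ D.Obs) : Prop where
  diff : P ∈ D.Diff
  invariant : D.Invariant P
  kills : ∀ y : F, P (lin y) = 0
  eq : ∀ f g, C₁ f g = D.piOp r f g + D.hoch P f g

/-- The coefficients of `Q = 1 + ħ^n X + ħ^{n+1} (E + [X, P])`, with the additional term
`½ ħ² X²` if `n = 1`. -/
noncomputable def obsEquiv (n : ℕ) (X E P : Module.End ℝ D.Obs) (k : ℕ) : Module.End ℝ D.Obs :=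
  (if k = 0 then 1 else 0) + (if k = n then X else 0) +
    (if k = n + 1 then E + (X * P - P * X) + (if n = 1 then (1 / 2 : ℝ) • (X * X) else 0) else 0)

end Base
end Quantization

end QPois

/-!
Strongly invariant star-products on `M = U × G` are compared order by order with the Hochschild
complex of `𝒪_M`, in the way familiar from the classification of star-products; the associator and
the momentum map condition are what has to be controlled.

*The associator is harmless.* By the counit axioms `Φ` acts trivially on `f ⊗ g ⊗ h` as soon as one
of the factors is a linear function `y ∈ 𝔥`, since these are killed by `𝔤` (`Base.act₃_lin₁` and its
companions). Hence the inner derivations `{y, ·}` of a strongly invariant star-product are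
derivations of each of its terms (`Base.IsStronglyInvariant.bracket_lin`). They generate the right
action of `H` (`Base.famDeriv_rightPull`), and `H` and `G` are connected, so that the terms are
`G × H`-invariant (`Base.invariant₂_of_infinitesimal`). Moreover `Φ = 1 + O(ħ²)`, so that `Φ` drops
out of the first two equations satisfied by the difference of two star-products which agree up to
order `n`: at order `n + 1` the difference `A` of the terms of that order is a Hochschild cocycle
(`IsAssoc.isCocycle_sub`), and the alternation of the equation at order `n + 2` says that the
skew-symmetric part `B` of `A` satisfies `[π_r, B] = 0` (`schouten_eq_zero_of_assoc`). For `n = 0` this `B`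
vanishes, since both star-products quantize `π_r`.

*Symmetric cocycles are coboundaries.* The skew-symmetric part of a cocycle is a biderivation, and
its symmetric part is a coboundary `bE` (`exists_hochMap_eq`), by an induction on the order in
which the symbol of `E` is obtained from those of the operators `C f = E f - [E, f]`. This
uses only that the derivations of `𝒪_M` are a free module, and on `U × G` they are: a global frame
consists of constant and left-invariant vector fields (`exists_basis_eq_frame`). The operator `E` is
made unique by the requirement that it has no first-order part with respect to this frame. The group
`G × H` transforms the frame by constant matrices, so that `E` inherits the invariance of the
cocycle (`map_apply_of_hochMap_invariant`). The subtraction of an invariant vector field makes it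
kill `𝔥` (`Base.exists_split`). This applies to the difference of the star-products
as well as to `C₁`, whose skew-symmetric part is `π_r`.

*The equivalence.* Let `R` be the inverse of `Q`. The product `f *' g = Q (R f * R g)`, whose
coefficients are computed with products of formal series (`conv`, `transport`), is again associative
up to `Φ`, because `R` commutes with `𝔤`, and it is strongly invariant, because `Q` fixes `𝔥` and
commutes with the derivations `{y, ·}` (`Base.IsStronglyInvariant.transport`). That it agrees with
the second star-product up to order `n + 1` is the formula `Q (f * g) = Q f *' Q g` at these orders:
with `C₁ = π_r + bP` the commutator of `C₁` with `X` is the sum of `-[π_r, X] = -B` and `b[X, P]`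
(`derivation_comm_first_order`), and for `n = 1` the operator `½ X²` compensates the term `X f X g`
(`compS_eq_of_splitting`).
-/

open scoped Manifold ContDiff TensorProduct
open TopologicalSpace

namespace QPois

set_option linter.unusedSectionVars false

attribute [local instance] LieRing.ofAssociativeRing

/-! ### Differential operators on a commutative algebra and their symbols -/

section SymmetricCalculus

/-- `T` is invariant under the permutations of its arguments, on words of length `k`. -/
def IsSymTensor {A ι : Type*} (k : ℕ) (T : List ι → A) : Prop :=
  ∀ l l' : List ι, l.length = k → l.Perm l' → T l = T l'

theorem IsSymTensor.cons {A ι : Type*} {k : ℕ} {T : List ι → A} (h : IsSymTensor (k + 1) T) (i : ι) :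
    IsSymTensor k (fun l => T (i :: l)) :=
  fun l l' hl hp => h _ _ (by simp [hl]) (hp.cons i)

variable {A : Type*} [CommRing A] [Algebra ℝ A]

/-- The commutator `[P, f]` of an operator with the multiplication by `f`, as an `A`-linear
function of `P`. -/
noncomputable def fcomm (f : A) : Module.End ℝ A →ₗ[A] Module.End ℝ A where
  toFun P := P * LinearMap.mulLeft ℝ f - f • P
  map_add' P Q := by ext x; simp; ring
  map_smul' a P := by ext x; simp; ring

theorem fcomm_apply (f : A) (P : Module.End ℝ A) (x : A) :
    fcomm f P x = P (f * x) - f * P x := by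
  simp [fcomm]

theorem fcomm_mul (f : A) (P Q : Module.End ℝ A) :
    fcomm f (P * Q) = fcomm f P * Q + P * fcomm f Q := by
  ext x
  simp [fcomm_apply]

theorem fcomm_comm (f g : A) (P : Module.End ℝ A) :
    fcomm f (fcomm g P) = fcomm g (fcomm f P) := by
  ext x
  simp only [fcomm_apply, mul_sub, mul_left_comm f g]
  ring

theorem fcomm_mul_left (f g : A) (P : Module.End ℝ A) :
    fcomm (f * g) P = f • fcomm g P + g • fcomm f P + fcomm g (fcomm f P) := by
  ext x
  simp only [fcomm_apply, LinearMap.add_apply, LinearMap.smul_apply, smul_eq_mul, mul_assoc]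
  ring

theorem fcomm_add_left (f g : A) (P : Module.End ℝ A) :
    fcomm (f + g) P = fcomm f P + fcomm g P := by
  ext x
  simp only [fcomm_apply, LinearMap.add_apply, add_mul, map_add]
  ring

theorem fcomm_smul_left (c : ℝ) (f : A) (P : Module.End ℝ A) :
    fcomm (c • f) P = c • fcomm f P := by
  ext x
  simp only [fcomm_apply, LinearMap.smul_apply, smul_mul_assoc, map_smul, smul_sub]

theorem fcomm_derivation (f : A) (X : Derivation ℝ A A) :
    fcomm f (X : Module.End ℝ A) = X f • (1 : Module.End ℝ A) := by
  ext x
  simp [fcomm_apply, mul_comm]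

theorem fcomm_smul_one (f a : A) : fcomm f (a • (1 : Module.End ℝ A)) = 0 := by
  ext x
  simp only [fcomm_apply, LinearMap.smul_apply, Module.End.one_apply, smul_eq_mul,
    LinearMap.zero_apply]
  ring

variable (A) in
/-- The operators of order `< k` in the sense of Grothendieck: those whose `k`-fold commutators
with functions vanish. -/
noncomputable def ordLT : ℕ → Submodule A (Module.End ℝ A)
  | 0 => ⊥
  | k + 1 => ⨅ f : A, (ordLT k).comap (fcomm f)

theorem mem_ordLT_zero {P : Module.End ℝ A} : P ∈ ordLT A 0 ↔ P = 0 := Iff.rfl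

theorem mem_ordLT_succ {k : ℕ} {P : Module.End ℝ A} :
    P ∈ ordLT A (k + 1) ↔ ∀ f, fcomm f P ∈ ordLT A k := by
  simp [ordLT]

theorem ordLT_le_succ (k : ℕ) : ordLT A k ≤ ordLT A (k + 1) := by
  induction k with
  | zero =>
    intro P hP
    rw [mem_ordLT_zero.1 hP]
    exact Submodule.zero_mem _
  | succ k ih =>
    intro P hP
    exact mem_ordLT_succ.2 fun f => ih (mem_ordLT_succ.1 hP f)

theorem ordLT_mono {j k : ℕ} (h : j ≤ k) : ordLT A j ≤ ordLT A k :=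
  monotone_nat_of_le_succ ordLT_le_succ h

theorem mem_ordLT_one {P : Module.End ℝ A} : P ∈ ordLT A 1 ↔ P = P 1 • 1 := by
  rw [mem_ordLT_succ]
  constructor
  · intro h
    ext x
    have := DFunLike.congr_fun (mem_ordLT_zero.1 (h x)) 1
    simp only [fcomm_apply, mul_one, LinearMap.zero_apply] at this
    simp only [LinearMap.smul_apply, Module.End.one_apply, smul_eq_mul]
    linear_combination this
  · intro h f
    rw [h, fcomm_smul_one]
    exact Submodule.zero_mem _

theorem smul_one_mem_ordLT (a : A) : a • (1 : Module.End ℝ A) ∈ ordLT A 1 :=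
  mem_ordLT_succ.2 fun f => by rw [fcomm_smul_one]; exact Submodule.zero_mem _

theorem derivation_mem_ordLT (X : Derivation ℝ A A) : (X : Module.End ℝ A) ∈ ordLT A 2 :=
  mem_ordLT_succ.2 fun f => by rw [fcomm_derivation]; exact smul_one_mem_ordLT _

theorem mul_mem_ordLT {P Q : Module.End ℝ A} {j k : ℕ} (hP : P ∈ ordLT A j) (hQ : Q ∈ ordLT A k) :
    P * Q ∈ ordLT A (j + k) := by
  induction hn : j + k generalizing j k P Q with
  | zero =>
    obtain ⟨rfl, rfl⟩ : j = 0 ∧ k = 0 := by omega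
    rw [mem_ordLT_zero.1 hP, zero_mul]
    exact Submodule.zero_mem _
  | succ n ih =>
    refine mem_ordLT_succ.2 fun f => ?_
    rw [fcomm_mul]
    refine Submodule.add_mem _ ?_ ?_
    · cases j with
      | zero =>
        rw [mem_ordLT_zero.1 hP, map_zero, zero_mul]
        exact Submodule.zero_mem _
      | succ j => exact ih (mem_ordLT_succ.1 hP f) hQ (by omega)
    · cases k with
      | zero =>
        rw [mem_ordLT_zero.1 hQ, map_zero, mul_zero]
        exact Submodule.zero_mem _
      | succ k => exact ih hP (mem_ordLT_succ.1 hQ f) (by omega)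

theorem mul_smul_one_mem_ordLT {P : Module.End ℝ A} {k : ℕ} (hP : P ∈ ordLT A k) (a : A) :
    P * (a • 1) ∈ ordLT A k := by
  induction k generalizing P with
  | zero =>
    rw [mem_ordLT_zero.1 hP, zero_mul]
    exact Submodule.zero_mem _
  | succ k ih =>
    refine mem_ordLT_succ.2 fun f => ?_
    rw [fcomm_mul, fcomm_smul_one, mul_zero, add_zero]
    exact ih (mem_ordLT_succ.1 hP f)

theorem mul_derivation_mem_ordLT {P : Module.End ℝ A} {k : ℕ} (hP : P ∈ ordLT A k)
    (X : Derivation ℝ A A) : P * (X : Module.End ℝ A) ∈ ordLT A (k + 1) := by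
  induction k generalizing P with
  | zero =>
    rw [mem_ordLT_zero.1 hP, zero_mul]
    exact Submodule.zero_mem _
  | succ k ih =>
    refine mem_ordLT_succ.2 fun f => ?_
    rw [fcomm_mul, fcomm_derivation]
    exact Submodule.add_mem _ (ih (mem_ordLT_succ.1 hP f)) (mul_smul_one_mem_ordLT hP _)

variable {ι : Type*} [Fintype ι]

/-- The differential operator `∑ T(i₁, …, iₖ) e_{iₖ} ⋯ e_{i₁}` of order `≤ k`, where the coefficient
tensor `T` is given as a function on words, of which only the words of length `k` matter. -/
noncomputable def symOp (e : ι → Derivation ℝ A A) :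
    (k : ℕ) → (List ι → A) →ₗ[A] Module.End ℝ A
  | 0 =>
    { toFun := fun T => T [] • 1
      map_add' := fun S T => by ext x; simp [add_mul]
      map_smul' := fun a T => by ext x; simp [mul_assoc] }
  | k + 1 =>
    { toFun := fun T => ∑ i, symOp e k (fun l => T (i :: l)) * (e i : Module.End ℝ A)
      map_add' := fun S T => by
        rw [← Finset.sum_add_distrib]
        refine Finset.sum_congr rfl fun i _ => ?_
        rw [← add_mul, ← map_add]
        rfl
      map_smul' := fun a T => by
        rw [RingHom.id_apply, Finset.smul_sum]
        refine Finset.sum_congr rfl fun i _ => ?_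
        rw [← smul_mul_assoc, ← map_smul]
        rfl }

theorem symOp_zero (e : ι → Derivation ℝ A A) (T : List ι → A) : symOp e 0 T = T [] • 1 := rfl

theorem symOp_succ (e : ι → Derivation ℝ A A) (k : ℕ) (T : List ι → A) :
    symOp e (k + 1) T = ∑ i, symOp e k (fun l => T (i :: l)) * (e i : Module.End ℝ A) := rfl

theorem symOp_congr (e : ι → Derivation ℝ A A) {k : ℕ} {S T : List ι → A}
    (h : ∀ l : List ι, l.length = k → S l = T l) : symOp e k S = symOp e k T := by
  induction k generalizing S T with
  | zero => rw [symOp_zero, symOp_zero, h [] rfl]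
  | succ k ih =>
    rw [symOp_succ, symOp_succ]
    refine Finset.sum_congr rfl fun i _ => ?_
    rw [ih fun l hl => h (i :: l) (by simp [hl])]

theorem symOp_mem_ordLT (e : ι → Derivation ℝ A A) (k : ℕ) (T : List ι → A) :
    symOp e k T ∈ ordLT A (k + 1) := by
  induction k generalizing T with
  | zero => exact smul_one_mem_ordLT _
  | succ k ih =>
    rw [symOp_succ]
    exact Submodule.sum_mem _ fun i _ => mul_derivation_mem_ordLT (ih _) _

/-- The symbol calculus: the commutator with `f` of the operator with symmetric coefficients `T` is,
up to lower order, `k + 1` times the operator of the contraction of `T` with `df`. -/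
theorem fcomm_symOp (e : ι → Derivation ℝ A A) {k : ℕ} {T : List ι → A}
    (h : IsSymTensor (k + 1) T) (f : A) :
    fcomm f (symOp e (k + 1) T) -
      ((k : A) + 1) • symOp e k (fun l => ∑ i, e i f * T (i :: l)) ∈ ordLT A k := by
  induction k generalizing T with
  | zero =>
    rw [mem_ordLT_zero, sub_eq_zero, symOp_succ, map_sum]
    simp only [symOp_zero, fcomm_mul, fcomm_smul_one, zero_mul, zero_add, fcomm_derivation]
    ext x
    simp [Finset.sum_mul, mul_assoc, mul_left_comm]
  | succ k ih =>
    have e1 : (((k + 1 : ℕ) : A) + 1) • symOp e (k + 1) (fun l => ∑ i, e i f * T (i :: l)) =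
        (∑ i, ((k : A) + 1) • symOp e k (fun l => ∑ j, e j f * T (i :: j :: l)) *
          (e i : Module.End ℝ A)) + ∑ i, e i f • symOp e (k + 1) (fun l => T (i :: l)) := by
      have : symOp e (k + 1) (fun l => ∑ i, e i f * T (i :: l)) =
          ∑ i, e i f • symOp e (k + 1) (fun l => T (i :: l)) := by
        simp only [← map_smul, ← map_sum]
        congr 1
        ext l
        simp
      rw [Nat.cast_succ, add_smul, one_smul]
      nth_rw 2 [this]
      congr 1
      rw [symOp_succ, Finset.smul_sum]
      refine Finset.sum_congr rfl fun i _ => ?_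
      rw [smul_mul_assoc]
      congr 2
      refine symOp_congr e fun l hl => Finset.sum_congr rfl fun j _ => ?_
      -- the symmetry of `T` makes the `k + 1` contractions with `df` equal
      rw [h (j :: i :: l) (i :: j :: l) (by simp [hl]) (List.Perm.swap _ _ _)]
    rw [e1, symOp_succ, map_sum, ← Finset.sum_add_distrib, ← Finset.sum_sub_distrib]
    refine Submodule.sum_mem _ fun i _ => ?_
    have e2 : fcomm f (symOp e (k + 1) (fun l => T (i :: l)) * (e i : Module.End ℝ A)) -
        (((k : A) + 1) • symOp e k (fun l => ∑ j, e j f * T (i :: j :: l)) *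
          (e i : Module.End ℝ A) + e i f • symOp e (k + 1) (fun l => T (i :: l))) =
        (fcomm f (symOp e (k + 1) (fun l => T (i :: l))) -
          ((k : A) + 1) • symOp e k (fun l => ∑ j, e j f * T (i :: j :: l))) *
            (e i : Module.End ℝ A) + fcomm (e i f) (symOp e (k + 1) (fun l => T (i :: l))) := by
      rw [fcomm_mul, fcomm_derivation]
      ext x
      simp only [LinearMap.sub_apply, LinearMap.add_apply, Module.End.mul_apply,
        LinearMap.smul_apply, Module.End.one_apply, smul_eq_mul, fcomm_apply]
      ring
    rw [e2]
    exact Submodule.add_mem _ (mul_derivation_mem_ordLT (ih (h.cons i)) _)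
      (mem_ordLT_succ.1 (symOp_mem_ordLT e _ _) _)

end SymmetricCalculus

/-! ### Symmetric Hochschild cocycles -/

section Hochschild

variable {A : Type*} [CommRing A] [Algebra ℝ A] {ι : Type*} [Fintype ι]
  (b : Module.Basis ι A (Derivation ℝ A A))

theorem derivation_apply_eq_sum (X : Derivation ℝ A A) (f : A) :
    X f = ∑ i, b.repr X i * b i f := by
  conv_lhs => rw [← b.sum_repr X]
  rw [← Derivation.coeFnAddMonoidHom_apply, map_sum, Finset.sum_apply]
  simp

theorem eq_zero_of_sum_basis_apply {c : ι → A} (h : ∀ f, ∑ i, c i * b i f = 0) (i : ι) :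
    c i = 0 := by
  refine Fintype.linearIndependent_iff.1 b.linearIndependent c ?_ i
  ext f
  rw [← Derivation.coeFnAddMonoidHom_apply, map_sum, Finset.sum_apply]
  simpa using h f

theorem mem_ordLT_of_smul {k n : ℕ} {P : Module.End ℝ A}
    (h : ((k : A) + 1) • P ∈ ordLT A n) : P ∈ ordLT A n := by
  have e : P = algebraMap ℝ A ((k : ℝ) + 1)⁻¹ • ((k : A) + 1) • P := by
    have : ((k : A) + 1) = algebraMap ℝ A ((k : ℝ) + 1) := by simp
    rw [this, smul_smul, ← map_mul, inv_mul_cancel₀ (by positivity), map_one, one_smul]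
  rw [e]
  exact Submodule.smul_mem _ _ h

theorem IsSymTensor.contract {k : ℕ} {T : List ι → A} (h : IsSymTensor (k + 1) T) (c : ι → A) :
    IsSymTensor k (fun l => ∑ i, c i * T (i :: l)) := fun l l' hl hp =>
  Finset.sum_congr rfl fun i _ => congrArg (c i * ·) (h.cons i l l' hl hp)

theorem IsSymTensor.sub {k : ℕ} {S T : List ι → A} (hS : IsSymTensor k S) (hT : IsSymTensor k T) :
    IsSymTensor k (S - T) := fun l l' hl hp => by
  simp only [Pi.sub_apply, hS l l' hl hp, hT l l' hl hp]

/-- The coefficients of an operator `symOp` are determined modulo operators of lower order. -/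
theorem eq_zero_of_symOp_mem_ordLT {k : ℕ} {T : List ι → A} (h : IsSymTensor k T)
    (hT : symOp b k T ∈ ordLT A k) (l : List ι) (hl : l.length = k) : T l = 0 := by
  induction k generalizing T l with
  | zero =>
    obtain rfl := List.length_eq_zero_iff.1 hl
    simpa [symOp_zero] using DFunLike.congr_fun (mem_ordLT_zero.1 hT) 1
  | succ k ih =>
    cases l with
    | nil => simp at hl
    | cons i l =>
      refine eq_zero_of_sum_basis_apply b (c := fun i => T (i :: l)) (fun f => ?_) i
      have h1 := Submodule.sub_mem _ (mem_ordLT_succ.1 hT f) (fcomm_symOp b h f)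
      rw [sub_sub_cancel] at h1
      rw [← ih (h.contract _) (mem_ordLT_of_smul h1) l (by simpa using hl)]
      exact Finset.sum_congr rfl fun i _ => mul_comm _ _

/-- A tensor is symmetric as soon as it is symmetric in its first two arguments, and in all
arguments but the first one. -/
theorem isSymTensor_succ {k : ℕ} {T : List ι → A} (h : ∀ i, IsSymTensor k (fun l => T (i :: l)))
    (hswap : ∀ i j l, l.length + 1 = k → T (i :: j :: l) = T (j :: i :: l)) :
    IsSymTensor (k + 1) T := by
  intro l l' hl hp
  induction hp with
  | nil => rfl
  | cons x hp _ => exact h x _ _ (by simpa using hl) hp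
  | swap x y l => exact hswap _ _ _ (by simpa using hl)
  | trans h₁ _ ih₁ ih₂ => exact (ih₁ hl).trans (ih₂ (h₁.length_eq ▸ hl))

/-- Symbols of a family `D f`, which behaves like a commutator `[P, f]`, can be integrated: the
symbol of `P` is recovered, up to a factor, from those of the `D f`. -/
theorem exists_symOp_fcomm_sub_mem {k : ℕ} (D : A →ₗ[ℝ] Module.End ℝ A)
    (hD : ∀ f, D f ∈ ordLT A (k + 1))
    (hmul : ∀ f g, D (f * g) - f • D g - g • D f ∈ ordLT A k)
    (hsym : ∀ f g, fcomm g (D f) = fcomm f (D g))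
    (hsur : ∀ P ∈ ordLT A (k + 1), ∃ T, IsSymTensor k T ∧ P - symOp b k T ∈ ordLT A k) :
    ∃ T, IsSymTensor (k + 1) T ∧ ∀ f, fcomm f (symOp b (k + 1) T) - D f ∈ ordLT A k := by
  -- the symbol `τ f` of `D f` is a derivation in `f`: symbols are unique, and `D` is a derivation up
  -- to operators of lower order
  choose τ hτ hτD using fun f => hsur (D f) (hD f)
  have hadd : ∀ f g, ∀ l : List ι, l.length = k → τ (f + g) l = τ f l + τ g l := by
    intro f g l hl
    have hs : IsSymTensor k (τ (f + g) - τ f - τ g) := ((hτ _).sub (hτ _)).sub (hτ _)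
    have := eq_zero_of_symOp_mem_ordLT b hs (by
      have := Submodule.sub_mem _ (Submodule.add_mem _ (hτD f) (hτD g)) (hτD (f + g))
      rw [map_add] at this
      rw [map_sub, map_sub]
      convert this using 1
      abel) l hl
    simp only [Pi.sub_apply] at this
    linear_combination this
  have hsmul : ∀ (c : ℝ) f, ∀ l : List ι, l.length = k → τ (c • f) l = c • τ f l := by
    intro c f l hl
    have hs : IsSymTensor k (τ (c • f) - algebraMap ℝ A c • τ f) := (hτ _).sub
      fun l l' hl hp => congrArg (algebraMap ℝ A c * ·) (hτ f l l' hl hp)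
    have := eq_zero_of_symOp_mem_ordLT b hs (by
      have := Submodule.sub_mem _ (Submodule.smul_mem _ (algebraMap ℝ A c) (hτD f)) (hτD (c • f))
      rw [map_smul, smul_sub, algebraMap_smul] at this
      rw [map_sub, map_smul]
      convert this using 1
      abel) l hl
    simp only [Pi.sub_apply, Pi.smul_apply, smul_eq_mul] at this
    rw [Algebra.smul_def c (τ f l)]
    linear_combination this
  have hleib : ∀ f g, ∀ l : List ι, l.length = k → τ (f * g) l = f * τ g l + g * τ f l := by
    intro f g l hl
    have hs : IsSymTensor k (τ (f * g) - f • τ g - g • τ f) :=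
      ((hτ _).sub fun l l' hl hp => congrArg (f * ·) (hτ g l l' hl hp)).sub
        fun l l' hl hp => congrArg (g * ·) (hτ f l l' hl hp)
    have := eq_zero_of_symOp_mem_ordLT b hs (by
      have := Submodule.sub_mem _ (Submodule.add_mem _ (Submodule.smul_mem _ f (hτD g))
        (Submodule.add_mem _ (Submodule.smul_mem _ g (hτD f)) (hmul f g))) (hτD (f * g))
      rw [map_sub, map_sub, map_smul, map_smul]
      convert this using 1
      rw [smul_sub, smul_sub]
      abel) l hl
    simp only [Pi.sub_apply, Pi.smul_apply, smul_eq_mul] at this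
    linear_combination this
  have hder : ∀ l : List ι, l.length = k → ∃ c : ι → A, ∀ f, τ f l = ∑ i, c i * b i f := by
    intro l hl
    let X : Derivation ℝ A A := Derivation.mk'
      { toFun := fun f => τ f l
        map_add' := fun f g => hadd f g l hl
        map_smul' := fun c f => hsmul c f l hl } (fun f g => hleib f g l hl)
    exact ⟨b.repr X, fun f => derivation_apply_eq_sum b X f⟩
  choose! c hc using hder
  have hcperm : ∀ l l' : List ι, l.length = k → l.Perm l' → ∀ i, c l i = c l' i := by
    intro l l' hl hp i
    refine sub_eq_zero.1 (eq_zero_of_sum_basis_apply b (c := fun i => c l i - c l' i)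
      (fun f => ?_) i)
    simp only [sub_mul, Finset.sum_sub_distrib]
    rw [← hc l hl, ← hc l' (hp.length_eq ▸ hl), hτ f l l' hl hp, sub_self]
  -- `c` becomes a symmetric tensor of degree `k + 1`: compare the symbols of `[D f, g] = [D g, f]`
  have hcswap : ∀ i j (l : List ι), l.length + 1 = k → c (j :: l) i = c (i :: l) j := by
    intro i j l hl
    obtain ⟨k, rfl⟩ : ∃ k', k = k' + 1 := ⟨_, hl.symm⟩
    have hl' : l.length = k := by omega
    have h1 : ∀ f g, ∑ i, b i g * τ f (i :: l) = ∑ i, b i f * τ g (i :: l) := by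
      intro f g
      have h2 : ∀ f g, fcomm g (D f) - ((k : A) + 1) • symOp b k (fun l => ∑ i, b i g * τ f (i :: l))
          ∈ ordLT A k := by
        intro f g
        have := Submodule.add_mem _ (mem_ordLT_succ.1 (hτD f) g) (fcomm_symOp b (hτ f) g)
        rwa [map_sub, sub_add_sub_cancel] at this
      have h3 : ((k : A) + 1) • symOp b k ((fun l => ∑ i, b i g * τ f (i :: l)) -
          fun l => ∑ i, b i f * τ g (i :: l)) ∈ ordLT A k := by
        rw [map_sub, smul_sub]
        convert Submodule.sub_mem _ (h2 g f) (h2 f g) using 1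
        rw [hsym f g]
        abel
      have := eq_zero_of_symOp_mem_ordLT b (((hτ f).contract _).sub ((hτ g).contract _))
        (mem_ordLT_of_smul h3) l hl'
      simpa only [Pi.sub_apply, sub_eq_zero] using this
    have h4 : ∀ f i, ∑ j, (c (i :: l) j - c (j :: l) i) * b j f = 0 := by
      intro f i
      refine eq_zero_of_sum_basis_apply b
        (c := fun i => ∑ j, (c (i :: l) j - c (j :: l) i) * b j f) (fun g => ?_) i
      have := h1 f g
      simp only [hc _ (show (_ :: l).length = k + 1 by simp [hl']), Finset.mul_sum] at this
      rw [Finset.sum_comm (f := fun i j => b i f * (c (i :: l) j * b j g))] at this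
      simp only [sub_mul, Finset.sum_mul, Finset.sum_sub_distrib]
      rw [sub_eq_zero]
      refine Eq.trans ?_ (this.trans ?_) <;>
        exact Finset.sum_congr rfl fun _ _ => Finset.sum_congr rfl fun _ _ => by ring
    exact (sub_eq_zero.1 (eq_zero_of_sum_basis_apply b (fun f => h4 f i) j)).symm
  -- the factor compensates the one in `fcomm_symOp`
  let T : List ι → A := fun l => l.casesOn 0 fun i l => algebraMap ℝ A ((k : ℝ) + 1)⁻¹ * c l i
  have hT : IsSymTensor (k + 1) T := isSymTensor_succ
    (fun i l l' hl hp => congrArg (algebraMap ℝ A ((k : ℝ) + 1)⁻¹ * ·) (hcperm l l' hl hp i))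
    fun i j l hl => congrArg (algebraMap ℝ A ((k : ℝ) + 1)⁻¹ * ·) (hcswap i j l hl)
  refine ⟨T, hT, fun f => ?_⟩
  have e1 : ((k : A) + 1) • symOp b k (fun l => ∑ i, b i f * T (i :: l)) = symOp b k (τ f) := by
    rw [← map_smul]
    refine symOp_congr _ fun l hl => ?_
    have : ((k : A) + 1) * algebraMap ℝ A ((k : ℝ) + 1)⁻¹ = 1 := by
      have : ((k : A) + 1) = algebraMap ℝ A ((k : ℝ) + 1) := by simp
      rw [this, ← map_mul, mul_inv_cancel₀ (by positivity), map_one]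
    simp only [Pi.smul_apply, smul_eq_mul, Finset.mul_sum, hc l hl, T]
    refine Finset.sum_congr rfl fun i _ => ?_
    linear_combination c l i * b i f * this
  have := Submodule.sub_mem _ (fcomm_symOp b hT f) (hτD f)
  rw [e1] at this
  convert this using 1
  abel

/-- Every operator of order `≤ k` has a symbol. -/
theorem exists_sub_symOp_mem (k : ℕ) (P : Module.End ℝ A) (hP : P ∈ ordLT A (k + 1)) :
    ∃ T, IsSymTensor k T ∧ P - symOp b k T ∈ ordLT A k := by
  induction k generalizing P with
  | zero =>
    refine ⟨fun _ => P 1, fun _ _ _ _ => rfl, ?_⟩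
    rw [mem_ordLT_zero, symOp_zero, sub_eq_zero]
    exact mem_ordLT_one.1 hP
  | succ k ih =>
    obtain ⟨T, hT, h⟩ := exists_symOp_fcomm_sub_mem b
      { toFun := fun f => fcomm f P
        map_add' := fun f g => fcomm_add_left f g P
        map_smul' := fun c f => fcomm_smul_left c f P }
      (fun f => mem_ordLT_succ.1 hP f)
      (fun f g => by
        have := mem_ordLT_succ.1 (mem_ordLT_succ.1 hP f) g
        convert this using 1
        change fcomm (f * g) P - f • fcomm g P - g • fcomm f P = _
        rw [fcomm_mul_left]
        abel)
      (fun f g => fcomm_comm _ _ _) ih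
    refine ⟨T, hT, mem_ordLT_succ.2 fun f => ?_⟩
    have := Submodule.neg_mem _ (h f)
    rw [neg_sub] at this
    rwa [map_sub]

/-- The operators without first-order part: the sums of operators `symOp b k T` with `T` symmetric
and `k ≠ 1`, `k < m`. Inside the operators of order `< m` they form a complement of the derivations,
which depends on the real span of the basis only. -/
noncomputable def normalOps : ℕ → Submodule A (Module.End ℝ A)
  | 0 => ⊥
  | k + 1 => normalOps k ⊔
    Submodule.span A {P | k ≠ 1 ∧ ∃ T, IsSymTensor k T ∧ P = symOp b k T}

theorem normalOps_le_succ (k : ℕ) : normalOps b k ≤ normalOps b (k + 1) := le_sup_left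

theorem symOp_mem_normalOps {k : ℕ} (hk : k ≠ 1) {T : List ι → A} (hT : IsSymTensor k T) :
    symOp b k T ∈ normalOps b (k + 1) :=
  Submodule.mem_sup_right (Submodule.subset_span ⟨hk, T, hT, rfl⟩)

theorem mem_normalOps_succ {k : ℕ} {P : Module.End ℝ A} (hP : P ∈ normalOps b (k + 1)) :
    ∃ Q ∈ normalOps b k, P = Q ∨ k ≠ 1 ∧ ∃ T, IsSymTensor k T ∧ P = Q + symOp b k T := by
  obtain ⟨Q, hQ, R, hR, rfl⟩ := Submodule.mem_sup.1 hP
  refine ⟨Q, hQ, ?_⟩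
  by_cases hk : k = 1
  · left
    rw [Submodule.span_eq_bot.2 (fun x hx => absurd hk hx.1), Submodule.mem_bot] at hR
    rw [hR, add_zero]
  · right
    refine ⟨hk, ?_⟩
    suffices ∃ T, IsSymTensor k T ∧ R = symOp b k T by
      obtain ⟨T, hT, rfl⟩ := this
      exact ⟨T, hT, rfl⟩
    clear hQ hP
    induction hR using Submodule.span_induction with
    | mem x h => exact h.2
    | zero => exact ⟨0, fun _ _ _ _ => rfl, by rw [map_zero]⟩
    | add x y _ _ hx hy =>
      obtain ⟨S, hS, rfl⟩ := hx
      obtain ⟨T, hT, rfl⟩ := hy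
      exact ⟨S + T, fun l l' hl hp => congrArg₂ (· + ·) (hS l l' hl hp) (hT l l' hl hp),
        by rw [map_add]⟩
    | smul a x _ hx =>
      obtain ⟨S, hS, rfl⟩ := hx
      exact ⟨a • S, fun l l' hl hp => congrArg (a * ·) (hS l l' hl hp), by rw [map_smul]⟩

theorem normalOps_le_ordLT (k : ℕ) : normalOps b k ≤ ordLT A k := by
  induction k with
  | zero => exact bot_le
  | succ k ih =>
    refine sup_le (ih.trans (ordLT_le_succ k)) (Submodule.span_le.2 ?_)
    rintro _ ⟨_, T, _, rfl⟩
    exact symOp_mem_ordLT _ _ _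

/-- A derivation without first-order part vanishes. -/
theorem eq_zero_of_mem_normalOps {k : ℕ} {P : Module.End ℝ A} (hP : P ∈ normalOps b k)
    (h : P ∈ ordLT A 2) (h1 : P 1 = 0) : P = 0 := by
  induction k generalizing P with
  | zero => exact hP
  | succ k ih =>
    obtain ⟨Q, hQ, rfl | ⟨hk, T, hT, rfl⟩⟩ := mem_normalOps_succ b hP
    · exact ih hQ h h1
    · obtain rfl | hk2 : k = 0 ∨ 2 ≤ k := by omega
      · obtain rfl : Q = 0 := hQ
        rw [zero_add, symOp_zero] at h1 ⊢
        have : T [] = 0 := by simpa using h1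
        rw [this, zero_smul]
      · have h2 : symOp b k T ∈ ordLT A k := by
          have := Submodule.sub_mem _ (ordLT_mono hk2 h) (normalOps_le_ordLT b k hQ)
          rwa [add_sub_cancel_left] at this
        have h3 : symOp b k T = 0 := by
          rw [symOp_congr b (T := 0) fun l hl => eq_zero_of_symOp_mem_ordLT b hT h2 l hl, map_zero]
        rw [h3, add_zero] at hP h h1 ⊢
        exact ih hQ h h1

/-- The Hochschild coboundary `f P(g) - P(f g) + P(f) g` of an operator, as a bilinear map. -/
noncomputable def hochMap (P : Module.End ℝ A) : A →ₗ[ℝ] A →ₗ[ℝ] A :=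
  (LinearMap.mul ℝ A).compl₂ P - (LinearMap.mul ℝ A).compr₂ P + (LinearMap.mul ℝ A).comp P

theorem hochMap_apply (P : Module.End ℝ A) (f g : A) :
    hochMap P f g = f * P g - P (f * g) + P f * g := rfl

/-- Hochschild `2`-cocycles of a commutative algebra. -/
def IsCocycle (C : A →ₗ[ℝ] A →ₗ[ℝ] A) : Prop :=
  ∀ f g h, f * C g h - C (f * g) h + C f (g * h) - C f g * h = 0

theorem isCocycle_hochMap (P : Module.End ℝ A) : IsCocycle (hochMap P) := by
  intro f g h
  simp only [hochMap_apply, mul_assoc]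
  ring

theorem IsCocycle.add {C C' : A →ₗ[ℝ] A →ₗ[ℝ] A} (h : IsCocycle C) (h' : IsCocycle C') :
    IsCocycle (C + C') := fun f g k => by
  simp only [LinearMap.add_apply]
  linear_combination h f g k + h' f g k

theorem IsCocycle.sub {C C' : A →ₗ[ℝ] A →ₗ[ℝ] A} (h : IsCocycle C) (h' : IsCocycle C') :
    IsCocycle (C - C') := fun f g k => by
  simp only [LinearMap.sub_apply]
  linear_combination h f g k - h' f g k

/-- Symmetric Hochschild cocycles which are differential operators in the second argument are
coboundaries of operators without first-order part. The symbol of the primitive `E` of highest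
order is found by integrating the symbols of the operators `C f = E f - [E, f]`, and the order
of what remains is lower. -/
theorem exists_hochMap_eq {m : ℕ} (C : A →ₗ[ℝ] A →ₗ[ℝ] A) (hC : IsCocycle C)
    (hs : ∀ f g, C f g = C g f) (hm : ∀ f, C f ∈ ordLT A m) :
    ∃ P ∈ normalOps b (m + 1), C = hochMap P := by
  induction m generalizing C with
  | zero =>
    refine ⟨0, Submodule.zero_mem _, ?_⟩
    ext f g
    rw [mem_ordLT_zero.1 (hm f), hochMap_apply]
    simp
  | succ m ih =>
    cases m with
    | zero =>
      refine ⟨symOp b 0 (fun _ => C 1 1), normalOps_le_succ _ _ (symOp_mem_normalOps _ zero_ne_one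
        fun _ _ _ _ => rfl), ?_⟩
      ext f g
      have h1 := DFunLike.congr_fun (mem_ordLT_one.1 (hm f)) g
      have h2 := hC f 1 1
      simp only [mul_one] at h2
      rw [h1, hochMap_apply, symOp_zero]
      simp only [LinearMap.smul_apply, Module.End.one_apply, smul_eq_mul]
      linear_combination -g * h2
    | succ m =>
      -- the cocycle identity, for the operators `C f`
      have hmul : ∀ f g, C (f * g) = f • C g + g • C f + fcomm g (C f) - C f g • 1 := by
        intro f g
        ext h
        simp only [LinearMap.add_apply, LinearMap.sub_apply, LinearMap.smul_apply, fcomm_apply,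
          Module.End.one_apply, smul_eq_mul]
        linear_combination -hC f g h
      obtain ⟨T, hT, h⟩ := exists_symOp_fcomm_sub_mem b (k := m + 1) (-C)
        (fun f => Submodule.neg_mem _ (hm f))
        (fun f g => by
          have := Submodule.sub_mem _ (Submodule.smul_mem _ (C f g)
            (ordLT_mono (show 1 ≤ m + 1 by omega) (smul_one_mem_ordLT (1 : A))))
            (mem_ordLT_succ.1 (hm f) g)
          convert this using 1
          rw [LinearMap.neg_apply, LinearMap.neg_apply, LinearMap.neg_apply, hmul, one_smul]
          ext x
          simp only [LinearMap.sub_apply, LinearMap.neg_apply, LinearMap.add_apply,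
            LinearMap.smul_apply, smul_eq_mul]
          ring)
        (fun f g => by
          have h1 := hmul f g
          rw [mul_comm f g, hmul g f, hs g f] at h1
          rw [LinearMap.neg_apply, LinearMap.neg_apply, map_neg, map_neg, neg_inj]
          have h2 := sub_eq_zero.2 h1
          refine (sub_eq_zero.1 ?_)
          rw [← neg_eq_zero, ← h2]
          abel)
        (fun P hP => exists_sub_symOp_mem b (m + 1) P hP)
      set S := symOp b (m + 1 + 1) T with hS
      obtain ⟨P, hP, hPC⟩ := ih (C - hochMap S) (hC.sub (isCocycle_hochMap S))
        (fun f g => by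
          simp only [LinearMap.sub_apply, hochMap_apply, hs f g, mul_comm f g]
          ring)
        (fun f => by
          have := Submodule.sub_mem _ (h f) (Submodule.smul_mem _ (S f)
            (ordLT_mono (show 1 ≤ m + 1 by omega) (smul_one_mem_ordLT (1 : A))))
          convert this using 1
          ext x
          simp only [LinearMap.sub_apply, hochMap_apply, LinearMap.neg_apply, fcomm_apply,
            LinearMap.smul_apply, smul_eq_mul, Module.End.one_apply]
          ring)
      refine ⟨P + S, Submodule.add_mem _ (normalOps_le_succ _ _ hP)
        (symOp_mem_normalOps b (by omega) hT), ?_⟩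
      ext f g
      have := DFunLike.congr_fun (DFunLike.congr_fun hPC f) g
      simp only [LinearMap.sub_apply, hochMap_apply] at this
      rw [sub_eq_iff_eq_add.1 this]
      simp only [LinearMap.add_apply, hochMap_apply]
      ring

/-- The transformation of coefficient tensors under the automorphism `τ`, when `τ` transforms
the basis by the matrix `t`. -/
noncomputable def transTensor (τ : A ≃ₐ[ℝ] A) (t : ι → ι → ℝ) (T : List ι → A) : List ι → A
  | [] => τ (T [])
  | j :: l => ∑ i, t i j • transTensor τ t (fun l => T (i :: l)) l

theorem transTensor_congr (τ : A ≃ₐ[ℝ] A) (t : ι → ι → ℝ) {S T : List ι → A} (l : List ι)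
    (h : ∀ l' : List ι, l'.length = l.length → S l' = T l') :
    transTensor τ t S l = transTensor τ t T l := by
  induction l generalizing S T with
  | nil => simp only [transTensor]; rw [h [] rfl]
  | cons j l ih =>
    simp only [transTensor]
    refine Finset.sum_congr rfl fun i _ => ?_
    rw [ih fun l' hl' => h (i :: l') (by simp [hl'])]

theorem IsSymTensor.transTensor (τ : A ≃ₐ[ℝ] A) (t : ι → ι → ℝ) {k : ℕ} {T : List ι → A}
    (hT : IsSymTensor k T) : IsSymTensor k (transTensor τ t T) := by
  induction k generalizing T with
  | zero =>
    intro l l' hl hp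
    obtain rfl := List.length_eq_zero_iff.1 hl
    rw [List.nil_perm.1 hp]
  | succ k ih =>
    refine isSymTensor_succ (fun j l l' hl hp => ?_) fun j j' l hl => ?_
    · simp only [QPois.transTensor]
      refine Finset.sum_congr rfl fun i _ => ?_
      rw [ih (hT.cons i) l l' hl hp]
    · simp only [QPois.transTensor, Finset.smul_sum]
      rw [Finset.sum_comm]
      refine Finset.sum_congr rfl fun i _ => Finset.sum_congr rfl fun i' _ => ?_
      rw [smul_comm, transTensor_congr τ t l fun l' hl' =>
        hT (i' :: i :: l') (i :: i' :: l') (by simp [hl', hl]) (List.Perm.swap _ _ _)]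

variable {b} in
theorem conj_symOp (τ : A ≃ₐ[ℝ] A) (t : ι → ι → ℝ)
    (ht : ∀ i f, τ (b i f) = ∑ j, t i j • b j (τ f)) (k : ℕ) (T : List ι → A) (f : A) :
    τ (symOp b k T f) = symOp b k (transTensor τ t T) (τ f) := by
  induction k generalizing T f with
  | zero => simp [symOp_zero, transTensor]
  | succ k ih =>
    rw [symOp_succ, symOp_succ, LinearMap.sum_apply, LinearMap.sum_apply, map_sum]
    simp only [Module.End.mul_apply, Derivation.coeFn_coe, ih]
    have e : ∀ j, symOp b k (fun l => transTensor τ t T (j :: l)) =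
        ∑ i, t i j • symOp b k (transTensor τ t (fun l => T (i :: l))) := by
      intro j
      have : (fun l => transTensor τ t T (j :: l)) =
          ∑ i, algebraMap ℝ A (t i j) • transTensor τ t (fun l => T (i :: l)) := by
        ext l
        simp [transTensor, Algebra.smul_def]
      rw [this, map_sum]
      simp
    simp only [ht, map_sum, map_smul, e, LinearMap.sum_apply, LinearMap.smul_apply]
    rw [Finset.sum_comm]

variable {b} in
theorem exists_conj_mem_normalOps (τ : A ≃ₐ[ℝ] A) (t : ι → ι → ℝ)
    (ht : ∀ i f, τ (b i f) = ∑ j, t i j • b j (τ f)) {k : ℕ} {P : Module.End ℝ A}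
    (hP : P ∈ normalOps b k) : ∃ P' ∈ normalOps b k, ∀ f, τ (P f) = P' (τ f) := by
  induction k generalizing P with
  | zero => exact ⟨0, Submodule.zero_mem _, fun f => by rw [show P = 0 from hP]; simp⟩
  | succ k ih =>
    obtain ⟨Q, hQ, h⟩ := mem_normalOps_succ b hP
    obtain ⟨Q', hQ', h'⟩ := ih hQ
    obtain rfl | ⟨hk, T, hT, rfl⟩ := h
    · exact ⟨Q', normalOps_le_succ _ _ hQ', h'⟩
    · refine ⟨Q' + symOp b k (transTensor τ t T), Submodule.add_mem _ (normalOps_le_succ _ _ hQ')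
        (symOp_mem_normalOps b hk (hT.transTensor τ t)), fun f => ?_⟩
      rw [LinearMap.add_apply, map_add, h', conj_symOp τ t ht, LinearMap.add_apply]

variable {b} in
/-- The primitive without first-order part of a cocycle is unique, hence inherits the symmetries of
the cocycle. -/
theorem map_apply_of_hochMap_invariant (τ : A ≃ₐ[ℝ] A) (t : ι → ι → ℝ)
    (ht : ∀ i f, τ (b i f) = ∑ j, t i j • b j (τ f)) {k : ℕ} {P : Module.End ℝ A}
    (hP : P ∈ normalOps b k) (h : ∀ f g, τ (hochMap P f g) = hochMap P (τ f) (τ g)) (f : A) :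
    τ (P f) = P (τ f) := by
  obtain ⟨P', hP', hPP'⟩ := exists_conj_mem_normalOps τ t ht hP
  have hX : ∀ f g, hochMap (P' - P) f g = 0 := by
    intro f g
    have := h (τ.symm f) (τ.symm g)
    simp only [hochMap_apply, map_add, map_sub, map_mul, hPP', AlgEquiv.apply_symm_apply] at this
    simp only [hochMap_apply, LinearMap.sub_apply]
    linear_combination this
  have h1 : (P' - P) 1 = 0 := by
    have := hX 1 1
    rw [hochMap_apply] at this
    simpa using this
  -- `P' - P` is a cocycle of degree one which kills `1`, that is, a derivation
  have h2 : P' - P ∈ ordLT A 2 := mem_ordLT_succ.2 fun f => by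
    have : fcomm f (P' - P) = (P' - P) f • 1 := by
      ext g
      have := hX f g
      rw [hochMap_apply] at this
      simp only [fcomm_apply, LinearMap.smul_apply, Module.End.one_apply, smul_eq_mul]
      linear_combination -this
    rw [this]
    exact smul_one_mem_ordLT _
  have := eq_zero_of_mem_normalOps b (Submodule.sub_mem _ hP' hP) h2 h1
  rw [hPP', sub_eq_zero.1 this]

end Hochschild

/-! ### Partial derivatives on manifolds -/

section Partial

variable {V W : Type*} [NormedAddCommGroup V] [NormedSpace ℝ V] [NormedAddCommGroup W]
  [NormedSpace ℝ W] {N : Type*} [TopologicalSpace N] [ChartedSpace V N] [IsManifold 𝓘(ℝ, V) ∞ N]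
  {K : Type*} [TopologicalSpace K] [ChartedSpace W K] [IsManifold 𝓘(ℝ, W) ∞ K]

/-- The curve through `p` which is the line with direction `v` in the chart at `p`. -/
noncomputable def chartLine (p : N) (v : V) (t : ℝ) : N :=
  (extChartAt 𝓘(ℝ, V) p).symm (extChartAt 𝓘(ℝ, V) p p + t • v)

theorem chartLine_zero (p : N) (v : V) : chartLine p v 0 = p := by
  simp [chartLine]

theorem contMDiffAt_chartLine (p : N) (v : V) :
    ContMDiffAt 𝓘(ℝ, ℝ) 𝓘(ℝ, V) ∞ (chartLine p v) 0 := by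
  have h1 : ContMDiffAt 𝓘(ℝ, V) 𝓘(ℝ, V) ∞ (extChartAt 𝓘(ℝ, V) p).symm
      (extChartAt 𝓘(ℝ, V) p p + (0 : ℝ) • v) := by
    rw [zero_smul, add_zero]
    exact (contMDiffOn_extChartAt_symm p).contMDiffAt (extChartAt_target_mem_nhds p)
  refine ContMDiffAt.comp (0 : ℝ) h1 (ContDiffAt.contMDiffAt ?_)
  exact (contDiff_const.add (contDiff_id.smul contDiff_const)).contDiffAt

theorem mvfderiv_eq_deriv {f : N → ℝ} {p : N} (hf : MDifferentiableAt 𝓘(ℝ, V) 𝓘(ℝ, ℝ) f p)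
    (v : V) : mvfderiv 𝓘(ℝ, V) f p v = deriv (fun t => f (chartLine p v t)) 0 := by
  have h1 := hf.differentiableWithinAt_writtenInExtChartAt
  simp only [chartAt_self_eq, mfld_simps, writtenInExtChartAt, differentiableWithinAt_univ] at h1
  have h2 : mvfderiv 𝓘(ℝ, V) f p v =
      fderiv ℝ (f ∘ (extChartAt 𝓘(ℝ, V) p).symm) (extChartAt 𝓘(ℝ, V) p p) v := by
    refine (congrArg (fun L : V →L[ℝ] ℝ => L v) hf.mfderiv).trans ?_
    simp only [writtenInExtChartAt, chartAt_self_eq, mfld_simps, fderivWithin_univ]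
  rw [h2]
  have h3 : HasDerivAt (fun t : ℝ => extChartAt 𝓘(ℝ, V) p p + t • v) v 0 := by
    simpa using ((hasDerivAt_id (0 : ℝ)).smul_const v).const_add (extChartAt 𝓘(ℝ, V) p p)
  have h4 : HasFDerivAt (f ∘ (extChartAt 𝓘(ℝ, V) p).symm)
      (fderiv ℝ (f ∘ (extChartAt 𝓘(ℝ, V) p).symm) (extChartAt 𝓘(ℝ, V) p p))
      (extChartAt 𝓘(ℝ, V) p p + (0 : ℝ) • v) := by
    rw [zero_smul, add_zero]
    exact DifferentiableAt.hasFDerivAt (by simpa [mfld_simps] using h1)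
  exact (h4.comp_hasDerivAt (0 : ℝ) h3).deriv.symm

theorem hasDerivAt_mk_left (s t : ℝ) :
    HasDerivAt (fun s : ℝ => (s, t)) ((1 : ℝ), (0 : ℝ)) s :=
  (hasDerivAt_id s).prodMk (hasDerivAt_const s t)

theorem hasDerivAt_mk_right (s t : ℝ) :
    HasDerivAt (fun t : ℝ => (s, t)) ((0 : ℝ), (1 : ℝ)) t :=
  (hasDerivAt_const t s).prodMk (hasDerivAt_id t)

theorem deriv_deriv_comm {φ : ℝ × ℝ → ℝ} (h : ContDiffAt ℝ 2 φ (0, 0)) :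
    deriv (fun s => deriv (fun t => φ (s, t)) 0) 0 =
      deriv (fun t => deriv (fun s => φ (s, t)) 0) 0 := by
  have hd : ∀ᶠ x in nhds ((0 : ℝ), (0 : ℝ)), DifferentiableAt ℝ φ x :=
    (h.eventually (by simp)).mono fun x hx => hx.differentiableAt (by simp)
  have h' : DifferentiableAt ℝ (fderiv ℝ φ) ((0 : ℝ), (0 : ℝ)) :=
    (h.fderiv_right (m := 1) (by norm_num)).differentiableAt (by simp)
  have a1 : ∀ s t : ℝ, DifferentiableAt ℝ φ (s, t) →
      deriv (fun t => φ (s, t)) t = fderiv ℝ φ (s, t) (0, 1) := fun s t hx =>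
    (hx.hasFDerivAt.comp_hasDerivAt t ((hasDerivAt_const t s).prodMk (hasDerivAt_id t))).deriv
  have a2 : ∀ s t : ℝ, DifferentiableAt ℝ φ (s, t) →
      deriv (fun s => φ (s, t)) s = fderiv ℝ φ (s, t) (1, 0) := fun s t hx =>
    (hx.hasFDerivAt.comp_hasDerivAt s ((hasDerivAt_id s).prodMk (hasDerivAt_const s t))).deriv
  have c1 : Filter.Tendsto (fun s : ℝ => (s, (0 : ℝ))) (nhds 0) (nhds (0, 0)) :=
    (Continuous.prodMk continuous_id continuous_const).tendsto 0
  have c2 : Filter.Tendsto (fun s : ℝ => ((0 : ℝ), s)) (nhds 0) (nhds (0, 0)) :=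
    (Continuous.prodMk continuous_const continuous_id).tendsto 0
  rw [Filter.EventuallyEq.deriv_eq ((c1.eventually hd).mono fun s hs => a1 s 0 hs),
    Filter.EventuallyEq.deriv_eq ((c2.eventually hd).mono fun t ht => a2 0 t ht)]
  have b1 := ((HasFDerivAt.comp_hasDerivAt (f := fun s : ℝ => (s, (0 : ℝ))) 0 h'.hasFDerivAt
    (hasDerivAt_mk_left 0 0)).clm_apply (hasDerivAt_const (0 : ℝ) ((0 : ℝ), (1 : ℝ)))).deriv
  have b2 := ((HasFDerivAt.comp_hasDerivAt (f := fun t : ℝ => ((0 : ℝ), t)) 0 h'.hasFDerivAt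
    (hasDerivAt_mk_right 0 0)).clm_apply (hasDerivAt_const (0 : ℝ) ((1 : ℝ), (0 : ℝ)))).deriv
  refine Eq.trans b1 (Eq.trans ?_ b2.symm)
  simp only [map_zero, add_zero]
  exact (h.isSymmSndFDerivAt (by simp)).eq _ _

theorem contDiffAt_chartLine_prod {f : N → K → ℝ}
    (hf : ContMDiff (𝓘(ℝ, V).prod 𝓘(ℝ, W)) 𝓘(ℝ, ℝ) ∞ (Function.uncurry f))
    (p : N) (v : V) (q : K) (w : W) :
    ContDiffAt ℝ ∞ (fun x : ℝ × ℝ => f (chartLine p v x.1) (chartLine q w x.2)) (0, 0) := by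
  rw [← contMDiffAt_iff_contDiffAt]
  have h1 : ContMDiffAt 𝓘(ℝ, ℝ × ℝ) 𝓘(ℝ, V) ∞ (fun x : ℝ × ℝ => chartLine p v x.1) (0, 0) :=
    ContMDiffAt.comp (I' := 𝓘(ℝ, ℝ)) (g := chartLine p v) (f := Prod.fst) ((0 : ℝ), (0 : ℝ))
      (contMDiffAt_chartLine p v)
      contDiff_fst.contMDiff.contMDiffAt
  have h2 : ContMDiffAt 𝓘(ℝ, ℝ × ℝ) 𝓘(ℝ, W) ∞ (fun x : ℝ × ℝ => chartLine q w x.2) (0, 0) :=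
    ContMDiffAt.comp (I' := 𝓘(ℝ, ℝ)) (g := chartLine q w) (f := Prod.snd) ((0 : ℝ), (0 : ℝ))
      (contMDiffAt_chartLine q w)
      contDiff_snd.contMDiff.contMDiffAt
  exact (hf.contMDiffAt (x := (chartLine p v 0, chartLine q w 0))).comp ((0 : ℝ), (0 : ℝ))
    (h1.prodMk h2)

theorem contMDiff_left {f : N → K → ℝ}
    (hf : ContMDiff (𝓘(ℝ, V).prod 𝓘(ℝ, W)) 𝓘(ℝ, ℝ) ∞ (Function.uncurry f)) (q : K) :
    ContMDiff 𝓘(ℝ, V) 𝓘(ℝ, ℝ) ∞ (fun n => f n q) :=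
  hf.comp (contMDiff_id.prodMk contMDiff_const)

theorem contMDiff_right {f : N → K → ℝ}
    (hf : ContMDiff (𝓘(ℝ, V).prod 𝓘(ℝ, W)) 𝓘(ℝ, ℝ) ∞ (Function.uncurry f)) (p : N) :
    ContMDiff 𝓘(ℝ, W) 𝓘(ℝ, ℝ) ∞ (f p) :=
  hf.comp (contMDiff_const.prodMk contMDiff_id)

/-- Partial derivatives of a smooth function on a product of manifolds commute. -/
theorem mvfderiv_mvfderiv_comm {f : N → K → ℝ}
    (hf : ContMDiff (𝓘(ℝ, V).prod 𝓘(ℝ, W)) 𝓘(ℝ, ℝ) ∞ (Function.uncurry f))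
    (p : N) (v : V) (q : K) (w : W) :
    mvfderiv 𝓘(ℝ, V) (fun n => mvfderiv 𝓘(ℝ, W) (f n) q w) p v =
      mvfderiv 𝓘(ℝ, W) (fun m => mvfderiv 𝓘(ℝ, V) (fun n => f n m) p v) q w := by
  have hswap : ContMDiff (𝓘(ℝ, W).prod 𝓘(ℝ, V)) 𝓘(ℝ, ℝ) ∞
      (Function.uncurry fun m n => f n m) := hf.comp (contMDiff_snd.prodMk contMDiff_fst)
  have h1 := contMDiff_partial f hf q w
  have h2 := contMDiff_partial (fun m n => f n m) hswap p v
  refine (mvfderiv_eq_deriv (V := V) (h1.mdifferentiableAt (by simp)) v).trans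
    (Eq.trans ?_ (mvfderiv_eq_deriv (V := W) (h2.mdifferentiableAt (by simp)) w).symm)
  have e1 : ∀ n, mvfderiv 𝓘(ℝ, W) (f n) q w = deriv (fun t => f n (chartLine q w t)) 0 := fun n =>
    mvfderiv_eq_deriv (V := W) ((contMDiff_right hf n).mdifferentiableAt (by simp)) w
  have e2 : ∀ m, mvfderiv 𝓘(ℝ, V) (fun n => f n m) p v = deriv (fun t => f (chartLine p v t) m) 0 :=
    fun m => mvfderiv_eq_deriv (V := V) ((contMDiff_left hf m).mdifferentiableAt (by simp)) v
  simp only [e1, e2]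
  exact deriv_deriv_comm ((contDiffAt_chartLine_prod hf p v q w).of_le (by norm_cast))

/-- The derivative of a function of two variables along the diagonal. -/
theorem mvfderiv_diag {f : N → N → ℝ}
    (hf : ContMDiff (𝓘(ℝ, V).prod 𝓘(ℝ, V)) 𝓘(ℝ, ℝ) ∞ (Function.uncurry f))
    (p : N) (v : V) :
    mvfderiv 𝓘(ℝ, V) (fun n => f n n) p v =
      mvfderiv 𝓘(ℝ, V) (fun n => f n p) p v + mvfderiv 𝓘(ℝ, V) (f p) p v := by
  have h0 : ContMDiff 𝓘(ℝ, V) 𝓘(ℝ, ℝ) ∞ (fun n => f n n) :=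
    hf.comp (contMDiff_id.prodMk contMDiff_id)
  refine (mvfderiv_eq_deriv (V := V) (h0.mdifferentiableAt (by simp)) v).trans
    (Eq.trans ?_ (congrArg₂ (· + ·)
      (mvfderiv_eq_deriv (V := V) ((contMDiff_left hf p).mdifferentiableAt (by simp)) v)
      (mvfderiv_eq_deriv (V := V) ((contMDiff_right hf p).mdifferentiableAt (by simp)) v)).symm)
  have hd := ((contDiffAt_chartLine_prod hf p v p v).differentiableAt (by simp)).hasFDerivAt
  have d0 := (HasFDerivAt.comp_hasDerivAt (f := fun s : ℝ => (s, s)) 0 hd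
    ((hasDerivAt_id (0 : ℝ)).prodMk (hasDerivAt_id (0 : ℝ)))).deriv
  have d1 := (HasFDerivAt.comp_hasDerivAt (f := fun s : ℝ => (s, (0 : ℝ))) 0 hd
    (hasDerivAt_mk_left 0 0)).deriv
  have d2 := (HasFDerivAt.comp_hasDerivAt (f := fun t : ℝ => ((0 : ℝ), t)) 0 hd
    (hasDerivAt_mk_right 0 0)).deriv
  simp only [Function.comp_def, chartLine_zero] at d0 d1 d2
  rw [d0]
  refine Eq.trans ?_ (congrArg₂ (· + ·) d1 d2).symm
  rw [← map_add]
  simp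

/-- A smooth function with vanishing derivative on a connected manifold is constant. -/
theorem eq_of_mvfderiv_eq_zero [PreconnectedSpace N] {f : N → ℝ}
    (hf : ContMDiff 𝓘(ℝ, V) 𝓘(ℝ, ℝ) ∞ f)
    (h : ∀ p (v : TangentSpace 𝓘(ℝ, V) p), mvfderiv 𝓘(ℝ, V) f p v = 0) (p q : N) : f p = f q := by
  refine IsLocallyConstant.apply_eq_of_preconnectedSpace ?_ p q
  rw [IsLocallyConstant.iff_eventually_eq]
  intro p
  obtain ⟨ε, hε, hb⟩ := Metric.mem_nhds_iff.1 (extChartAt_target_mem_nhds (I := 𝓘(ℝ, V)) p)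
  have hd : ∀ y ∈ Metric.ball (extChartAt 𝓘(ℝ, V) p p) ε,
      HasFDerivAt (f ∘ (extChartAt 𝓘(ℝ, V) p).symm) (0 : V →L[ℝ] ℝ) y := by
    intro y hy
    have hs : MDifferentiableAt 𝓘(ℝ, V) 𝓘(ℝ, V) (extChartAt 𝓘(ℝ, V) p).symm y :=
      ((contMDiffOn_extChartAt_symm (n := ∞) p).contMDiffAt
        ((isOpen_extChartAt_target p).mem_nhds (hb hy))).mdifferentiableAt (by simp)
    have h1 := mfderiv_comp y (hf.mdifferentiableAt (by simp)) hs
    have h2 : mfderiv 𝓘(ℝ, V) 𝓘(ℝ, ℝ) f ((extChartAt 𝓘(ℝ, V) p).symm y) = 0 := by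
      ext v
      exact h _ v
    rw [h2, mfderiv_eq_fderiv] at h1
    have h3 : DifferentiableAt ℝ (f ∘ (extChartAt 𝓘(ℝ, V) p).symm) y :=
      mdifferentiableAt_iff_differentiableAt.1 ((hf.mdifferentiableAt (by simp)).comp y hs)
    have := h3.hasFDerivAt
    rw [h1] at this
    exact this.congr_fderiv (by ext v; rfl)
  have hc : ∀ y ∈ Metric.ball (extChartAt 𝓘(ℝ, V) p p) ε,
      (f ∘ (extChartAt 𝓘(ℝ, V) p).symm) y = f p := by
    intro y hy
    have := Metric.isOpen_ball.is_const_of_fderiv_eq_zero (𝕜 := ℝ)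
      (convex_ball (extChartAt 𝓘(ℝ, V) p p) ε).isPreconnected
      (fun y hy => (hd y hy).differentiableAt.differentiableWithinAt)
      (fun y hy => (hd y hy).fderiv) hy (Metric.mem_ball_self hε)
    rw [this]
    simp
  filter_upwards [extChartAt_source_mem_nhds (I := 𝓘(ℝ, V)) p,
    (continuousAt_extChartAt (I := 𝓘(ℝ, V)) p).preimage_mem_nhds (Metric.ball_mem_nhds _ hε)]
    with q hq hq'
  have := hc _ hq'
  rwa [Function.comp_apply, (extChartAt 𝓘(ℝ, V) p).left_inv hq] at this

end Partial

/-! ### Derivations of the algebra of smooth functions -/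

section Hadamard

variable {V : Type*} [NormedAddCommGroup V] [NormedSpace ℝ V] [FiniteDimensional ℝ V]

theorem hasFDerivAt_parametric_integral {φ : V × ℝ → ℝ} (h : ContDiff ℝ 1 φ) (y : V) :
    HasFDerivAt (fun y => ∫ t in (0 : ℝ)..1, φ (y, t))
      (∫ t in (0 : ℝ)..1, (fderiv ℝ φ (y, t)).comp (ContinuousLinearMap.inl ℝ V ℝ)) y := by
  have hc : Continuous fun x : V × ℝ => (fderiv ℝ φ x).comp (ContinuousLinearMap.inl ℝ V ℝ) :=
    (h.continuous_fderiv (by simp)).clm_comp continuous_const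
  have hy : ∀ y : V, Continuous fun t : ℝ => (y, t) := fun y => Continuous.prodMk_right y
  obtain ⟨C, hC⟩ := ((isCompact_closedBall y 1).prod (isCompact_Icc (a := (0 : ℝ)) (b := 1))).exists_bound_of_continuousOn
    hc.continuousOn
  refine intervalIntegral.hasFDerivAt_integral_of_dominated_of_fderiv_le
    (F := fun y t => φ (y, t))
    (F' := fun y t => (fderiv ℝ φ (y, t)).comp (ContinuousLinearMap.inl ℝ V ℝ))
    (bound := fun _ => C)
    (Metric.closedBall_mem_nhds y one_pos) ?_ ?_ ?_ ?_ ?_ ?_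
  · exact Filter.Eventually.of_forall fun y =>
      (h.continuous.comp (hy y)).aestronglyMeasurable
  · exact (h.continuous.comp (hy y)).intervalIntegrable _ _
  · exact (hc.comp (hy y)).aestronglyMeasurable
  · refine Filter.Eventually.of_forall fun t ht x hx => hC (x, t) ⟨hx, ?_⟩
    rw [Set.uIoc_of_le zero_le_one] at ht
    exact Set.Ioc_subset_Icc_self ht
  · exact intervalIntegrable_const
  · refine Filter.Eventually.of_forall fun t _ x _ => ?_
    have h1 := (h.differentiable (by simp) (x, t)).hasFDerivAt
    exact HasFDerivAt.comp (f := fun y => (y, t)) x h1 (hasFDerivAt_prodMk_left x t)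

theorem contDiff_parametric_integral {φ : V × ℝ → ℝ} (h : ContDiff ℝ ∞ φ) :
    ContDiff ℝ ∞ (fun y => ∫ t in (0 : ℝ)..1, φ (y, t)) := by
  rw [contDiff_infty]
  intro n
  induction n generalizing φ with
  | zero =>
    rw [Nat.cast_zero, contDiff_zero, continuous_iff_continuousAt]
    exact fun y => (hasFDerivAt_parametric_integral (h.of_le (by norm_cast)) y).continuousAt
  | succ n ih =>
    have h1 := hasFDerivAt_parametric_integral (h.of_le (n := ∞) (m := 1) (by norm_cast))
    rw [Nat.cast_succ, contDiff_succ_iff_fderiv_apply]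
    refine ⟨fun y => (h1 y).differentiableAt, fun h => absurd h (by simp), fun v => ?_⟩
    have h2 : ContDiff ℝ ∞ fun x : V × ℝ => fderiv ℝ φ x (v, 0) :=
      (h.fderiv_right (m := ∞) (by simp)).clm_apply contDiff_const
    convert ih h2 using 2 with y
    rw [(h1 y).fderiv, ContinuousLinearMap.intervalIntegral_apply]
    · simp
    · have hc : Continuous fun x : V × ℝ => (fderiv ℝ φ x).comp (ContinuousLinearMap.inl ℝ V ℝ) :=
        (h.continuous_fderiv (by simp)).clm_comp continuous_const
      exact (hc.comp (Continuous.prodMk_right y)).intervalIntegrable _ _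

/-- Hadamard's lemma. -/
theorem exists_contDiff_eq_sum {ι : Type*} [Fintype ι] (w : Module.Basis ι ℝ V) {k : V → ℝ}
    (hk : ContDiff ℝ ∞ k) (x₀ : V) : ∃ g : ι → V → ℝ, (∀ i, ContDiff ℝ ∞ (g i)) ∧
      (∀ i, g i x₀ = fderiv ℝ k x₀ (w i)) ∧
      ∀ y, k y = k x₀ + ∑ i, w.repr (y - x₀) i * g i y := by
  have hline : ContDiff ℝ ∞ fun x : V × ℝ => x₀ + x.2 • (x.1 - x₀) :=
    contDiff_const.add (contDiff_snd.smul (contDiff_fst.sub contDiff_const))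
  have hd : ∀ v, ContDiff ℝ ∞ fun x : V × ℝ => fderiv ℝ k (x₀ + x.2 • (x.1 - x₀)) v := fun v =>
    ((hk.fderiv_right (m := ∞) (by simp)).comp hline).clm_apply contDiff_const
  refine ⟨fun i y => ∫ t in (0 : ℝ)..1, fderiv ℝ k (x₀ + t • (y - x₀)) (w i),
    fun i => contDiff_parametric_integral (hd (w i)), fun i => by simp, fun y => ?_⟩
  have h1 : ∀ t ∈ Set.uIcc (0 : ℝ) 1, HasDerivAt (fun t : ℝ => k (x₀ + t • (y - x₀)))
      (fderiv ℝ k (x₀ + t • (y - x₀)) (y - x₀)) t := by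
    intro t _
    have h2 : HasDerivAt (fun t : ℝ => x₀ + t • (y - x₀)) (y - x₀) t := by
      simpa using ((hasDerivAt_id t).smul_const (y - x₀)).const_add x₀
    exact ((hk.differentiable (by simp) _).hasFDerivAt).comp_hasDerivAt t h2
  have hc : ∀ v, Continuous fun t : ℝ => fderiv ℝ k (x₀ + t • (y - x₀)) v := fun v =>
    (hd v).continuous.comp (Continuous.prodMk_right y)
  have h3 := intervalIntegral.integral_eq_sub_of_hasDerivAt h1 ((hc _).intervalIntegrable _ _)
  simp only [one_smul, zero_smul, add_zero, add_sub_cancel] at h3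
  rw [← sub_eq_iff_eq_add', ← h3]
  simp only [← intervalIntegral.integral_const_mul]
  refine Eq.trans ?_ (intervalIntegral.integral_finsetSum
    (f := fun i t => w.repr (y - x₀) i * fderiv ℝ k (x₀ + t • (y - x₀)) (w i))
    fun i _ => (continuous_const.mul (hc (w i))).intervalIntegrable _ _)
  congr 1
  ext t
  generalize fderiv ℝ k (x₀ + t • (y - x₀)) = L
  conv_lhs => rw [← w.sum_repr (y - x₀)]
  simp only [map_sum, map_smul, smul_eq_mul]

end Hadamard

section Derivations

variable {V : Type*} [NormedAddCommGroup V] [NormedSpace ℝ V] [FiniteDimensional ℝ V]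
  {H' : Type*} [TopologicalSpace H'] {I : ModelWithCorners ℝ V H'} [I.Boundaryless]
  {M : Type*} [TopologicalSpace M] [ChartedSpace H' M] [IsManifold I ∞ M] [T2Space M]

theorem mvfderiv_eq_fderiv {f : M → ℝ} {m : M} (hf : MDifferentiableAt I 𝓘(ℝ, ℝ) f m) (v : V) :
    mvfderiv I f m v = fderiv ℝ (f ∘ (extChartAt I m).symm) (extChartAt I m m) v := by
  refine (congrArg (fun L : V →L[ℝ] ℝ => L v) hf.mfderiv).trans ?_
  simp only [writtenInExtChartAt, chartAt_self_eq, mfld_simps]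
  rw [I.range_eq_univ, fderivWithin_univ]

theorem contMDiffOn_extChartAt_source (m : M) :
    ContMDiffOn I 𝓘(ℝ, V) ∞ (extChartAt I m) (chartAt H' m).source :=
  contMDiffOn_extChartAt

/-- Smooth functions with prescribed differential at a point. -/
theorem exists_mvfderiv_eq (m : M) (ℓ : V →ₗ[ℝ] ℝ) :
    ∃ f : C^∞⟮I, M; 𝓘(ℝ, ℝ), ℝ⟯, ∀ v : V, mvfderiv I f m v = ℓ v := by
  obtain ⟨χ⟩ : Nonempty (SmoothBumpFunction I m) := inferInstance
  have hℓ : ContDiff ℝ ∞ ℓ := (LinearMap.toContinuousLinearMap ℓ).contDiff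
  let f : C^∞⟮I, M; 𝓘(ℝ, ℝ), ℝ⟯ := ⟨_, χ.contMDiff_smul
    (hℓ.contMDiff.comp_contMDiffOn (contMDiffOn_extChartAt_source m))⟩
  refine ⟨f, fun v => ?_⟩
  rw [mvfderiv_eq_fderiv (f.contMDiff.mdifferentiableAt (by simp))]
  have h : f ∘ (extChartAt I m).symm =ᶠ[nhds (extChartAt I m m)] ℓ := by
    have h1 : Filter.Tendsto (extChartAt I m).symm (nhds (extChartAt I m m)) (nhds m) := by
      have := (continuousAt_extChartAt_symm (I := I) m).tendsto
      rwa [extChartAt_to_inv] at this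
    filter_upwards [h1.eventually χ.eventuallyEq_one, extChartAt_target_mem_nhds (I := I) m]
      with y hy hy'
    change χ _ • ℓ (extChartAt I m ((extChartAt I m).symm y)) = _
    rw [hy, (extChartAt I m).right_inv hy']
    simp
  rw [h.fderiv_eq]
  exact DFunLike.congr_fun (LinearMap.toContinuousLinearMap ℓ).fderiv v

/-- A derivation of the algebra of smooth functions depends on the differential only. -/
theorem derivation_apply_eq_zero
    (X : Derivation ℝ C^∞⟮I, M; 𝓘(ℝ, ℝ), ℝ⟯ C^∞⟮I, M; 𝓘(ℝ, ℝ), ℝ⟯)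
    (f : C^∞⟮I, M; 𝓘(ℝ, ℝ), ℝ⟯) (m : M) (hf0 : f m = 0)
    (hf : ∀ v : V, mvfderiv I f m v = 0) : X f m = 0 := by
  obtain ⟨χ⟩ : Nonempty (SmoothBumpFunction I m) := inferInstance
  set φ := extChartAt I m
  let w := Module.finBasis ℝ V
  -- `f` in the chart, extended by zero
  let k : V → ℝ := fun y => χ.toContDiffBump y * f (φ.symm y)
  have hk : ContDiff ℝ ∞ k := by
    rw [contDiff_iff_contDiffAt]
    intro y
    by_cases hy : y ∈ φ.target
    · refine χ.toContDiffBump.contDiff.contDiffAt.mul ?_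
      have : ContMDiffAt 𝓘(ℝ, V) 𝓘(ℝ, ℝ) ∞ (fun y => f (φ.symm y)) y :=
        f.contMDiff.contMDiffAt.comp y ((contMDiffOn_extChartAt_symm m).contMDiffAt
          ((isOpen_extChartAt_target m).mem_nhds hy))
      exact contMDiffAt_iff_contDiffAt.1 this
    · have hy' : y ∉ Metric.closedBall (φ m) χ.rOut := fun h => hy (χ.closedBall_subset ⟨h, by
        rw [I.range_eq_univ]; trivial⟩)
      have : k =ᶠ[nhds y] fun _ => 0 := by
        filter_upwards [Metric.isClosed_closedBall.isOpen_compl.mem_nhds hy'] with z hz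
        have : χ.toContDiffBump z = 0 := χ.toContDiffBump.zero_of_le_dist (by
          simp only [Set.mem_compl_iff, Metric.mem_closedBall, not_le] at hz
          exact hz.le)
        simp only [k]
        rw [this, zero_mul]
      exact contDiffAt_const.congr_of_eventuallyEq this
  obtain ⟨g, hg, hg0, hgk⟩ := exists_contDiff_eq_sum w hk (φ m)
  have hg0' : ∀ i, g i (φ m) = 0 := by
    intro i
    rw [hg0, ← hf (w i), mvfderiv_eq_fderiv (f.contMDiff.mdifferentiableAt (by simp))]
    refine DFunLike.congr_fun (Filter.EventuallyEq.fderiv_eq ?_) _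
    filter_upwards [χ.toContDiffBump.eventuallyEq_one] with y hy
    simp only [k]
    rw [hy]
    simp [φ]
  have hk0 : k (φ m) = 0 := by
    simp [k, φ, hf0]
  let c : C^∞⟮I, M; 𝓘(ℝ, ℝ), ℝ⟯ := ⟨χ, χ.contMDiff⟩
  have hcoord : ∀ i, ContDiff ℝ ∞ fun y => w.repr (y - φ m) i := fun i =>
    (LinearMap.toContinuousLinearMap (w.coord i)).contDiff.comp (contDiff_id.sub contDiff_const)
  let u : Fin (Module.finrank ℝ V) → C^∞⟮I, M; 𝓘(ℝ, ℝ), ℝ⟯ := fun i => ⟨_, χ.contMDiff_smul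
    ((hcoord i).contMDiff.comp_contMDiffOn (contMDiffOn_extChartAt_source m))⟩
  let v : Fin (Module.finrank ℝ V) → C^∞⟮I, M; 𝓘(ℝ, ℝ), ℝ⟯ := fun i => ⟨_, χ.contMDiff_smul
    ((hg i).contMDiff.comp_contMDiffOn (contMDiffOn_extChartAt_source m))⟩
  -- up to the bump function, `f` is a sum of products of functions which vanish at `m`
  have key : c * (c * (c * f)) = ∑ i, u i * v i := by
    ext q
    have e1 : (c * (c * (c * f))) q = χ q * (χ q * (χ q * f q)) := rfl
    have e2 : (∑ i, u i * v i) q = ∑ i, (χ q * w.repr (φ q - φ m) i) * (χ q * g i (φ q)) := by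
      rw [← ContMDiffMap.coeFnAddMonoidHom_apply, map_sum, Finset.sum_apply]
      rfl
    rw [e1, e2]
    by_cases hq : q ∈ (chartAt H' m).source
    · have h1 : χ q * f q = k (φ q) := by
        simp only [k]
        rw [χ.eqOn_source hq, φ.left_inv (by simpa [φ] using hq)]
        rfl
      rw [h1, hgk, hk0, zero_add, Finset.mul_sum, Finset.mul_sum]
      exact Finset.sum_congr rfl fun i _ => by ring
    · have h1 : χ q = 0 := by
        by_contra h
        exact hq (χ.support_subset_source h)
      simp [h1]
  have hX := congrArg (fun F => F m) (congrArg X key)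
  simp only [map_sum, Derivation.leibniz, smul_eq_mul] at hX
  have hc1 : c m = 1 := χ.eq_one
  have hu : ∀ i, u i m = 0 := by
    intro i
    change χ m • w.repr (φ m - φ m) i = 0
    simp
  have hv : ∀ i, v i m = 0 := by
    intro i
    change χ m • g i (φ m) = 0
    rw [hg0', smul_zero]
  have e2 : (∑ i, (u i * X (v i) + v i * X (u i))) m = 0 := by
    rw [← ContMDiffMap.coeFnAddMonoidHom_apply, map_sum, Finset.sum_apply]
    refine Finset.sum_eq_zero fun i _ => ?_
    change u i m * X (v i) m + v i m * X (u i) m = 0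
    rw [hu, hv, zero_mul, zero_mul, add_zero]
  rw [e2] at hX
  have e1 : (c * (c * (c * X f + f * X c) + c * f * X c) + c * (c * f) * X c) m = X f m := by
    change c m * (c m * (c m * X f m + f m * X c m) + c m * f m * X c m) +
      c m * (c m * f m) * X c m = X f m
    rw [hc1, hf0]
    ring
  rw [e1] at hX
  exact hX

theorem smoothMap_sum_apply {ι : Type*} (s : Finset ι) (f : ι → C^∞⟮I, M; 𝓘(ℝ, ℝ), ℝ⟯) (m : M) :
    (∑ i ∈ s, f i) m = ∑ i ∈ s, f i m := by
  rw [← ContMDiffMap.coeFnAddMonoidHom_apply, map_sum, Finset.sum_apply]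
  rfl

theorem contMDiff_matrix_det {ι : Type*} [Fintype ι] [DecidableEq ι] {Y : M → Matrix ι ι ℝ}
    (hY : ∀ i j, ContMDiff I 𝓘(ℝ, ℝ) ∞ fun m => Y m i j) :
    ContMDiff I 𝓘(ℝ, ℝ) ∞ fun m => (Y m).det := by
  simp only [Matrix.det_apply']
  refine contMDiff_finsetSum fun σ _ => contMDiff_const.mul ?_
  exact contMDiff_finsetProd fun i _ => hY _ _

/-- Vector fields which form a basis of each tangent space form a basis of the module of
derivations of the algebra of smooth functions. -/
theorem exists_basis_derivation {ι : Type*} [Fintype ι]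
    (e : ι → Derivation ℝ C^∞⟮I, M; 𝓘(ℝ, ℝ), ℝ⟯ C^∞⟮I, M; 𝓘(ℝ, ℝ), ℝ⟯)
    (w : M → Module.Basis ι ℝ V) (he : ∀ i f m, e i f m = mvfderiv I f m (w m i)) :
    ∃ b : Module.Basis ι C^∞⟮I, M; 𝓘(ℝ, ℝ), ℝ⟯
      (Derivation ℝ C^∞⟮I, M; 𝓘(ℝ, ℝ), ℝ⟯ C^∞⟮I, M; 𝓘(ℝ, ℝ), ℝ⟯), ⇑b = e := by
  classical
  choose y hy using fun (m : M) (k : ι) => exists_mvfderiv_eq (I := I) m ((w m).coord k)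
  have hye : ∀ m k j, e j (y m k) m = if j = k then 1 else 0 := by
    intro m k j
    rw [he, hy]
    simp [Finsupp.single_apply]
  have hli : LinearIndependent C^∞⟮I, M; 𝓘(ℝ, ℝ), ℝ⟯ e := by
    rw [Fintype.linearIndependent_iff]
    intro c hc k
    ext m
    have h1 := congrArg (fun X : Derivation ℝ C^∞⟮I, M; 𝓘(ℝ, ℝ), ℝ⟯ C^∞⟮I, M; 𝓘(ℝ, ℝ), ℝ⟯ =>
      X (y m k) m) hc
    simp only [← Derivation.coeFnAddMonoidHom_apply, map_sum, Finset.sum_apply] at h1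
    rw [smoothMap_sum_apply] at h1
    have h2 : ∀ j, Derivation.coeFnAddMonoidHom (c j • e j) (y m k) m =
        c j m * if j = k then 1 else 0 := fun j => by rw [← hye m k j]; rfl
    rw [Finset.sum_congr rfl fun j _ => h2 j] at h1
    simpa using h1
  refine ⟨Module.Basis.mk hli fun X _ => ?_, Module.Basis.coe_mk _ _⟩
  -- the coefficients of `X`, computed at each point with functions adapted to this point
  let β : ι → M → ℝ := fun k m => X (y m k) m
  have hX : ∀ f m, X f m = ∑ k, β k m * e k f m := by
    intro f m
    let C : ℝ → C^∞⟮I, M; 𝓘(ℝ, ℝ), ℝ⟯ := algebraMap ℝ _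
    let f' : C^∞⟮I, M; 𝓘(ℝ, ℝ), ℝ⟯ := f - ∑ k, e k f m • y m k
    let f'' := f' - C (f' m)
    have h0 : f'' m = 0 := sub_self (f' m)
    have he' : ∀ j, e j f'' m = 0 := by
      intro j
      have : e j f'' = e j f - ∑ k, e k f m • e j (y m k) := by
        simp only [f'', f', C, map_sub, Derivation.map_algebraMap, sub_zero, map_sum,
          Derivation.map_smul]
      rw [this]
      change e j f m - (∑ k, e k f m • e j (y m k)) m = 0
      rw [smoothMap_sum_apply]
      have h2 : ∀ k, (e k f m • e j (y m k)) m = e k f m * if j = k then 1 else 0 := fun k => by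
        rw [← hye m k j]; rfl
      simp [h2]
    have hd : ∀ v : V, mvfderiv I f'' m v = 0 := by
      intro v
      have : v = ∑ i, (w m).repr v i • w m i := ((w m).sum_repr v).symm
      rw [this]
      refine (map_sum (mvfderiv I f'' m : V →L[ℝ] ℝ) _ _).trans
        (Finset.sum_eq_zero fun i _ => ?_)
      refine (map_smul (mvfderiv I f'' m : V →L[ℝ] ℝ) _ _).trans ?_
      have := he' i
      rw [he] at this
      exact (congrArg ((w m).repr v i • ·) this).trans (smul_zero _)
    have h3 := derivation_apply_eq_zero X f'' m h0 hd
    have h4 : X f'' = X f - ∑ k, e k f m • X (y m k) := by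
      simp only [f'', f', C, map_sub, Derivation.map_algebraMap, sub_zero, map_sum,
        Derivation.map_smul]
    rw [h4] at h3
    replace h3 : X f m - (∑ k, e k f m • X (y m k)) m = 0 := h3
    rw [smoothMap_sum_apply, sub_eq_zero] at h3
    rw [h3]
    exact Finset.sum_congr rfl fun k _ => mul_comm _ _
  have hβ : ∀ k, ContMDiff I 𝓘(ℝ, ℝ) ∞ (β k) := by
    intro k m₀
    let Y : M → Matrix ι ι ℝ := fun m => Matrix.of fun i j => e j (y m₀ i) m
    have hY : ∀ i j, ContMDiff I 𝓘(ℝ, ℝ) ∞ fun m => Y m i j := fun i j =>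
      (e j (y m₀ i)).contMDiff
    have hdet := contMDiff_matrix_det hY
    have hdet0 : (Y m₀).det ≠ 0 := by
      have : Y m₀ = 1 := by
        ext i j
        simp only [Y, Matrix.of_apply, hye, Matrix.one_apply, eq_comm]
      rw [this, Matrix.det_one]
      exact one_ne_zero
    -- the coefficients solve a linear system with smooth coefficients near `m₀`
    have hcr : ∀ m, (Y m).det * β k m =
        ((Y m).updateCol k fun i => X (y m₀ i) m).det := by
      intro m
      have h1 : (fun i => X (y m₀ i) m) = (Y m).mulVec fun k => β k m := by
        ext i
        rw [hX]
        simp only [Matrix.mulVec, dotProduct, Y, Matrix.of_apply]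
        exact Finset.sum_congr rfl fun k _ => mul_comm _ _
      rw [← Matrix.cramer_apply, h1, Matrix.cramer_eq_adjugate_mulVec, Matrix.mulVec_mulVec,
        Matrix.adjugate_mul, Matrix.smul_mulVec, Matrix.one_mulVec]
      rfl
    have hnum : ContMDiff I 𝓘(ℝ, ℝ) ∞ fun m =>
        ((Y m).updateCol k fun i => X (y m₀ i) m).det := by
      refine contMDiff_matrix_det fun i j => ?_
      by_cases hj : j = k
      · subst hj
        simpa using (X (y m₀ i)).contMDiff
      · simpa [Matrix.updateCol_apply, hj] using hY i j
    refine ((hnum m₀).div₀ (hdet m₀) hdet0).congr_of_eventuallyEq ?_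
    filter_upwards [(hdet m₀).continuousAt.eventually_ne hdet0] with m hm
    change β k m = ((Y m).updateCol k fun i => X (y m₀ i) m).det / (Y m).det
    rw [← hcr, mul_div_cancel_left₀ _ hm]
  let B : ι → C^∞⟮I, M; 𝓘(ℝ, ℝ), ℝ⟯ := fun k => ⟨β k, hβ k⟩
  have : X = ∑ k, B k • e k := by
    ext f m
    rw [hX, ← Derivation.coeFnAddMonoidHom_apply, map_sum, Finset.sum_apply, smoothMap_sum_apply]
    rfl
  rw [this]
  exact Submodule.sum_mem _ fun k _ => Submodule.smul_mem _ _ (Submodule.subset_span ⟨k, rfl⟩)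

end Derivations

/-! ### The global frame of `U × G` -/

section Frame

variable {F E : Type*} [NormedAddCommGroup F] [NormedSpace ℝ F] [FiniteDimensional ℝ F]
  [NormedAddCommGroup E] [NormedSpace ℝ E] [FiniteDimensional ℝ E]
  {G : Type*} [TopologicalSpace G] [ChartedSpace E G] [Group G] [LieGroup 𝓘(ℝ, E) ∞ G]
  {U : Opens (StrongDual ℝ F)}

/-- The left-invariant vector field of `x ∈ 𝔤` as a derivation of the functions on `U × G`. -/
noncomputable def leftDer (x : LieAlg E G) : Derivation ℝ (Fn E G U) (Fn E G U) :=
  Derivation.mk' (leftField x) fun f g => by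
    ext m
    have hf := ((contMDiff_slice f m.1).comp
      (contMDiff_mul_left (a := m.2)) (1 : G)).mdifferentiableAt (by simp)
    have hg := ((contMDiff_slice g m.1).comp
      (contMDiff_mul_left (a := m.2)) (1 : G)).mdifferentiableAt (by simp)
    refine (DFunLike.congr_fun (mvfderiv_mul hf hg) x).trans ?_
    change f (m.1, m.2 * 1) * leftField x g m + g (m.1, m.2 * 1) * leftField x f m = _
    rw [mul_one]
    rfl

/-- The constant vector field `ξ` as a derivation of the functions on `U × G`. -/
noncomputable def dirDer (ξ : StrongDual ℝ F) : Derivation ℝ (Fn E G U) (Fn E G U) :=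
  Derivation.mk' (dirField ξ) fun f g => by
    ext m
    exact (DFunLike.congr_fun (mvfderiv_mul
      ((contMDiff_sliceU f m.2 m.1).mdifferentiableAt (by simp))
      ((contMDiff_sliceU g m.2 m.1).mdifferentiableAt (by simp))) ξ)

/-- The basis of `𝔥*` formed by the `λ^i`. -/
noncomputable def hDualBasis (F : Type*) [NormedAddCommGroup F] [NormedSpace ℝ F]
    [FiniteDimensional ℝ F] :
    Module.Basis (Fin (Module.finrank ℝ F)) ℝ (StrongDual ℝ F) :=
  (hBasis F).dualBasis.map LinearMap.toContinuousLinearMap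

theorem hDualBasis_apply (i : Fin (Module.finrank ℝ F)) : hDualBasis F i = hDual F i := by
  simp [hDualBasis, hDual]

theorem sum_apply_smul_hDual (ξ : StrongDual ℝ F) : ξ = ∑ i, ξ (hBasis F i) • hDual F i := by
  ext y
  conv_lhs => rw [← (hBasis F).sum_repr y]
  simp only [map_sum, map_smul, sum_apply, smul_apply]
  exact Finset.sum_congr rfl fun i _ => mul_comm _ _

/-- The derivative at `1` of the left translation by `g`. -/
noncomputable def leftTransport (g : G) : E →L[ℝ] E :=
  mfderiv 𝓘(ℝ, E) 𝓘(ℝ, E) (fun a : G => g * a) 1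

theorem leftTransport_injective (g : G) : Function.Injective (leftTransport (E := E) g) := by
  rw [injective_iff_map_eq_zero]
  intro w hw
  by_contra h
  exact mulInvariantVectorField_ne_zero (G := G) w h g hw

/-- The basis of `T_g G` formed by the left-invariant vector fields. -/
noncomputable def leftBasis (g : G) : Module.Basis (Fin (Module.finrank ℝ E)) ℝ E :=
  (Module.finBasis ℝ E).map (LinearEquiv.ofInjectiveEndo (leftTransport (E := E) g).toLinearMap
    (leftTransport_injective g))

theorem leftBasis_apply (g : G) (k : Fin (Module.finrank ℝ E)) :
    leftBasis g k = mulInvariantVectorField (I := 𝓘(ℝ, E)) (gBasis E G k) g := by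
  simp only [leftBasis, Module.Basis.map_apply]
  rfl

/-- The global frame of `U × G` formed by the constant vector fields `λ^i` and the left-invariant
vector fields of the basis of `𝔤`. -/
noncomputable def frame :
    Fin (Module.finrank ℝ F) ⊕ Fin (Module.finrank ℝ E) → Derivation ℝ (Fn E G U) (Fn E G U) :=
  Sum.elim (fun i => dirDer (hDual F i)) (fun k => leftDer (gBasis E G k))

variable (F E G U) in
theorem exists_basis_eq_frame [T2Space G] :
    ∃ b : Module.Basis (Fin (Module.finrank ℝ F) ⊕ Fin (Module.finrank ℝ E)) (Fn E G U)
      (Derivation ℝ (Fn E G U) (Fn E G U)), ⇑b = frame := by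
  refine exists_basis_derivation (V := StrongDual ℝ F × E) frame
    (fun m => (hDualBasis F).prod (leftBasis m.2)) fun i f m => ?_
  have hf := f.contMDiff.mdifferentiableAt (x := m) (by simp)
  have h1 : ∀ v : StrongDual ℝ F × E, mvfderiv ((𝓘(ℝ, StrongDual ℝ F)).prod 𝓘(ℝ, E)) f m v =
      mvfderiv 𝓘(ℝ, StrongDual ℝ F) (fun μ : U => f (μ, m.2)) m.1 v.1 +
        mvfderiv 𝓘(ℝ, E) (fun a : G => f (m.1, a)) m.2 v.2 := fun v =>
    mfderiv_prod_eq_add_apply hf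
  rw [h1]
  cases i with
  | inl i =>
    simp only [Module.Basis.prod_apply_inl_fst, Module.Basis.prod_apply_inl_snd]
    rw [hDualBasis_apply]
    have h0 : mvfderiv 𝓘(ℝ, E) (fun a : G => f (m.1, a)) m.2 (0 : E) = 0 :=
      map_zero (mvfderiv 𝓘(ℝ, E) (fun a : G => f (m.1, a)) m.2)
    rw [h0, add_zero]
    rfl
  | inr k =>
    simp only [Module.Basis.prod_apply_inr_fst, Module.Basis.prod_apply_inr_snd]
    have h0 : mvfderiv 𝓘(ℝ, StrongDual ℝ F) (fun μ : U => f (μ, m.2)) m.1 (0 : StrongDual ℝ F) = 0 :=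
      map_zero (mvfderiv 𝓘(ℝ, StrongDual ℝ F) (fun μ : U => f (μ, m.2)) m.1)
    rw [h0, zero_add, leftBasis_apply]
    exact lieDeriv_eq (fun g : G => f (m.1, g)) (contMDiff_slice f m.1) (gBasis E G k) m.2

theorem derivation_eq_sum_frame [T2Space G] (X : Derivation ℝ (Fn E G U) (Fn E G U)) :
    ∃ c : Fin (Module.finrank ℝ F) ⊕ Fin (Module.finrank ℝ E) → Fn E G U,
      ∀ f, X f = ∑ i, c i * frame i f := by
  obtain ⟨b, hb⟩ := exists_basis_eq_frame F E G U
  exact ⟨_, fun f => hb ▸ derivation_apply_eq_sum b X f⟩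

theorem dirField_lin (ξ : StrongDual ℝ F) (y : F) :
    dirField ξ (lin y : Fn E G U) = algebraMap ℝ _ (ξ y) := by
  ext m
  have hφ : ∀ x : U, extChartAt 𝓘(ℝ, StrongDual ℝ F) m.1 x = (x : StrongDual ℝ F) := fun x => by
    simp only [extChartAt, mfld_simps, Opens.chartAt_eq, chartAt_self_eq]
    rfl
  have hs : ContMDiff 𝓘(ℝ, StrongDual ℝ F) 𝓘(ℝ, ℝ) ∞
      (fun μ : U => (lin y : Fn E G U) (μ, m.2)) := contMDiff_sliceU _ _
  refine (mvfderiv_eq_fderiv (hs.mdifferentiableAt (by simp)) ξ).trans ?_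
  have h : (fun μ : U => (lin y : Fn E G U) (μ, m.2)) ∘ (extChartAt 𝓘(ℝ, StrongDual ℝ F) m.1).symm
      =ᶠ[nhds (extChartAt 𝓘(ℝ, StrongDual ℝ F) m.1 m.1)] ContinuousLinearMap.apply ℝ ℝ y := by
    filter_upwards [extChartAt_target_mem_nhds (I := 𝓘(ℝ, StrongDual ℝ F)) m.1] with z hz
    change (((extChartAt 𝓘(ℝ, StrongDual ℝ F) m.1).symm z : U) : StrongDual ℝ F) y = z y
    rw [← hφ, (extChartAt 𝓘(ℝ, StrongDual ℝ F) m.1).right_inv hz]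
  rw [h.fderiv_eq, ContinuousLinearMap.fderiv]
  rfl

theorem leftField_lin (x : LieAlg E G) (y : F) : leftField x (lin y : Fn E G U) = 0 := by
  ext m
  exact DFunLike.congr_fun (mvfderiv_const (I := 𝓘(ℝ, E)) (M := G) ((m.1 : StrongDual ℝ F) y)
    (x := 1)) x

theorem leftAction_lin (x : LieAlg E G) (y : F) : leftAction x (lin y : Fn E G U) = 0 := by
  ext m
  rw [leftAction_apply]
  exact DFunLike.congr_fun (mvfderiv_const (I := 𝓘(ℝ, E)) (M := G) ((m.1 : StrongDual ℝ F) y)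
    (x := 1)) x

end Frame

/-! ### Smooth families of functions -/

section Families

variable {F E H : Type*} [NormedAddCommGroup F] [NormedSpace ℝ F] [FiniteDimensional ℝ F]
  [NormedAddCommGroup E] [NormedSpace ℝ E] [FiniteDimensional ℝ E]
  [TopologicalSpace H] [ChartedSpace F H] [Group H]
  {G : Type*} [TopologicalSpace G] [ChartedSpace E G] [Group G] [LieGroup 𝓘(ℝ, E) ∞ G]
  {U : Opens (StrongDual ℝ F)}
  {V : Type*} [NormedAddCommGroup V] [NormedSpace ℝ V]
  {N : Type*} [TopologicalSpace N] [ChartedSpace V N] [IsManifold 𝓘(ℝ, V) ∞ N]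

/-- A family of functions on `U × G` which depends smoothly on a parameter `n ∈ N`. -/
def IsSmoothFamily (V : Type*) [NormedAddCommGroup V] [NormedSpace ℝ V]
    {N : Type*} [TopologicalSpace N] [ChartedSpace V N] (φ : N → Fn E G U) : Prop :=
  ContMDiff (𝓘(ℝ, V).prod ((𝓘(ℝ, StrongDual ℝ F)).prod 𝓘(ℝ, E))) 𝓘(ℝ, ℝ) ∞
    (fun x : N × (U × G) => φ x.1 x.2)

/-- The derivative of a smooth family with respect to the parameter. -/
noncomputable def famDeriv (φ : N → Fn E G U) (hφ : IsSmoothFamily V φ) (p : N) (v : V) :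
    Fn E G U :=
  ⟨fun m => mvfderiv 𝓘(ℝ, V) (fun n => φ n m) p v,
    contMDiff_partial (J := (𝓘(ℝ, StrongDual ℝ F)).prod 𝓘(ℝ, E)) (fun m n => φ n m)
      (hφ.comp (contMDiff_snd.prodMk contMDiff_fst)) p v⟩

theorem IsSmoothFamily.apply {φ : N → Fn E G U} (hφ : IsSmoothFamily V φ) (m : U × G) :
    ContMDiff 𝓘(ℝ, V) 𝓘(ℝ, ℝ) ∞ (fun n => φ n m) :=
  ContMDiff.comp (g := fun x : N × (U × G) => φ x.1 x.2) hφ (contMDiff_id.prodMk contMDiff_const)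

theorem IsSmoothFamily.leftField {φ : N → Fn E G U} (hφ : IsSmoothFamily V φ) (x : LieAlg E G) :
    IsSmoothFamily V fun n => leftField x (φ n) := by
  refine contMDiff_partial (J := 𝓘(ℝ, V).prod ((𝓘(ℝ, StrongDual ℝ F)).prod 𝓘(ℝ, E)))
    (fun (m : N × (U × G)) (a : G) => φ m.1 (m.2.1, m.2.2 * a)) ?_ 1 x
  exact ContMDiff.comp (g := fun x : N × (U × G) => φ x.1 x.2) hφ
    ((contMDiff_fst.comp contMDiff_fst).prodMk
      ((contMDiff_fst.comp (contMDiff_snd.comp contMDiff_fst)).prodMk ((contMDiff_mul 𝓘(ℝ, E) ∞).comp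
        ((contMDiff_snd.comp (contMDiff_snd.comp contMDiff_fst)).prodMk contMDiff_snd))))

theorem IsSmoothFamily.dirField {φ : N → Fn E G U} (hφ : IsSmoothFamily V φ) (ξ : StrongDual ℝ F) :
    IsSmoothFamily V fun n => dirField ξ (φ n) := by
  have h := contMDiff_dirDeriv U (J := 𝓘(ℝ, V).prod 𝓘(ℝ, E))
    (fun (μ : U) (x : N × G) => φ x.1 (μ, x.2))
    (ContMDiff.comp (g := fun x : N × (U × G) => φ x.1 x.2) hφ
      ((contMDiff_fst.comp contMDiff_snd).prodMk (contMDiff_fst.prodMk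
        (contMDiff_snd.comp contMDiff_snd)))) ξ
  exact h.comp ((contMDiff_fst.comp contMDiff_snd).prodMk
    (contMDiff_fst.prodMk (contMDiff_snd.comp contMDiff_snd)))

theorem famDeriv_leftField {φ : N → Fn E G U} (hφ : IsSmoothFamily V φ) (x : LieAlg E G) (p : N)
    (v : V) : famDeriv _ (hφ.leftField x) p v = leftField x (famDeriv φ hφ p v) := by
  ext m
  refine mvfderiv_mvfderiv_comm (W := E) (f := fun (n : N) (a : G) => φ n (m.1, m.2 * a)) ?_ p v 1 x
  exact ContMDiff.comp (g := fun x : N × (U × G) => φ x.1 x.2) hφ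
    (contMDiff_fst.prodMk (contMDiff_const.prodMk (contMDiff_mul_left.comp contMDiff_snd)))

theorem famDeriv_dirField {φ : N → Fn E G U} (hφ : IsSmoothFamily V φ) (ξ : StrongDual ℝ F) (p : N)
    (v : V) : famDeriv _ (hφ.dirField ξ) p v = dirField ξ (famDeriv φ hφ p v) := by
  ext m
  refine mvfderiv_mvfderiv_comm (f := fun (n : N) (μ : U) => φ n (μ, m.2)) ?_ p v m.1 ξ
  exact ContMDiff.comp (g := fun x : N × (U × G) => φ x.1 x.2) hφ
    (contMDiff_fst.prodMk (contMDiff_snd.prodMk contMDiff_const))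

theorem IsSmoothFamily.const (f : Fn E G U) : IsSmoothFamily V fun _ : N => f :=
  f.contMDiff.comp contMDiff_snd

theorem IsSmoothFamily.add {φ ψ : N → Fn E G U} (hφ : IsSmoothFamily V φ)
    (hψ : IsSmoothFamily V ψ) : IsSmoothFamily V fun n => φ n + ψ n :=
  ContMDiff.add hφ hψ

theorem IsSmoothFamily.mul {φ ψ : N → Fn E G U} (hφ : IsSmoothFamily V φ)
    (hψ : IsSmoothFamily V ψ) : IsSmoothFamily V fun n => φ n * ψ n :=
  ContMDiff.mul hφ hψ

theorem famDeriv_add {φ ψ : N → Fn E G U} (hφ : IsSmoothFamily V φ)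
    (hψ : IsSmoothFamily V ψ) (p : N) (v : V) :
    famDeriv _ (hφ.add hψ) p v = famDeriv φ hφ p v + famDeriv ψ hψ p v := by
  ext m
  exact DFunLike.congr_fun (mvfderiv_add ((hφ.apply m p).mdifferentiableAt (by simp))
    ((hψ.apply m p).mdifferentiableAt (by simp))) v

theorem famDeriv_mul {φ ψ : N → Fn E G U} (hφ : IsSmoothFamily V φ)
    (hψ : IsSmoothFamily V ψ) (p : N) (v : V) :
    famDeriv _ (hφ.mul hψ) p v = φ p * famDeriv ψ hψ p v + ψ p * famDeriv φ hφ p v := by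
  ext m
  exact DFunLike.congr_fun (mvfderiv_mul ((hφ.apply m p).mdifferentiableAt (by simp))
    ((hψ.apply m p).mdifferentiableAt (by simp))) v

theorem famDeriv_const (f : Fn E G U) (p : N) (v : V) :
    famDeriv _ (IsSmoothFamily.const (N := N) f) p v = 0 := by
  ext m
  exact DFunLike.congr_fun (mvfderiv_const (I := 𝓘(ℝ, V)) (M := N) (f m) (x := p)) v

variable (E G U V N) in
/-- The operators which preserve smooth families and commute with the derivative with respect to
the parameter. -/
noncomputable def paramAlg : Subalgebra ℝ (Module.End ℝ (Fn E G U)) where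
  carrier := {P | ∀ (φ : N → Fn E G U) (hφ : IsSmoothFamily V φ),
    ∃ h : IsSmoothFamily V fun n => P (φ n),
      ∀ p v, famDeriv (fun n => P (φ n)) h p v = P (famDeriv φ hφ p v)}
  mul_mem' {P Q} hP hQ φ hφ := by
    obtain ⟨h1, h2⟩ := hQ φ hφ
    obtain ⟨h3, h4⟩ := hP _ h1
    exact ⟨h3, fun p v => by rw [Module.End.mul_apply, ← h2]; exact h4 p v⟩
  add_mem' {P Q} hP hQ φ hφ := by
    obtain ⟨h1, h2⟩ := hQ φ hφ
    obtain ⟨h3, h4⟩ := hP φ hφ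
    exact ⟨h3.add h1, fun p v => by rw [LinearMap.add_apply, ← h2, ← h4]; exact famDeriv_add h3 h1 p v⟩
  algebraMap_mem' c φ hφ := by
    have e : ∀ f : Fn E G U, algebraMap ℝ (Module.End ℝ (Fn E G U)) c f =
        algebraMap ℝ (Fn E G U) c * f := fun f => by
      rw [Module.algebraMap_end_apply, Algebra.smul_def]
    simp only [e]
    refine ⟨(IsSmoothFamily.const _).mul hφ, fun p v =>
      (famDeriv_mul (IsSmoothFamily.const _) hφ p v).trans ?_⟩
    rw [famDeriv_const, mul_zero, add_zero]

theorem mulLeft_mem_paramAlg (c : Fn E G U) : LinearMap.mulLeft ℝ c ∈ paramAlg E G U V N :=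
  fun φ hφ => ⟨(IsSmoothFamily.const _).mul hφ, fun p v => by
    refine (famDeriv_mul (IsSmoothFamily.const c) hφ p v).trans ?_
    rw [famDeriv_const, mul_zero, add_zero]
    rfl⟩

theorem derivation_mem_paramAlg [T2Space G] (X : Derivation ℝ (Fn E G U) (Fn E G U)) :
    (X : Module.End ℝ (Fn E G U)) ∈ paramAlg E G U V N := by
  obtain ⟨c, hc⟩ := derivation_eq_sum_frame X
  have : (X : Module.End ℝ (Fn E G U)) =
      ∑ i, LinearMap.mulLeft ℝ (c i) *
        ((frame i : Derivation ℝ (Fn E G U) (Fn E G U)) : Module.End ℝ (Fn E G U)) := by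
    ext1 f
    rw [LinearMap.sum_apply]
    exact hc f
  rw [this]
  refine Subalgebra.sum_mem _ fun i _ => Subalgebra.mul_mem _ (mulLeft_mem_paramAlg _) ?_
  cases i with
  | inl i => exact fun φ hφ => ⟨hφ.dirField _, fun p v => famDeriv_dirField hφ _ p v⟩
  | inr k => exact fun φ hφ => ⟨hφ.leftField _, fun p v => famDeriv_leftField hφ _ p v⟩

theorem diff_le_paramAlg [T2Space G] (D : Base F E H G) : D.Diff ≤ paramAlg E G D.U V N := by
  refine Algebra.adjoin_le ?_
  rintro _ (⟨c, rfl⟩ | ⟨X, rfl⟩)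
  · exact mulLeft_mem_paramAlg c
  · exact derivation_mem_paramAlg X

/-- Bidifferential operators commute with the derivative with respect to a parameter. -/
theorem famDeriv_bidiff [T2Space G] (D : Base F E H G) {C : D.Obs →ₗ[ℝ] D.Obs →ₗ[ℝ] D.Obs}
    (hC : C ∈ D.Bidiff) {φ ψ : N → D.Obs} (hφ : IsSmoothFamily V φ) (hψ : IsSmoothFamily V ψ) :
    ∃ h : IsSmoothFamily V fun n => C (φ n) (ψ n), ∀ p v,
      famDeriv (fun n => C (φ n) (ψ n)) h p v =
        C (famDeriv φ hφ p v) (ψ p) + C (φ p) (famDeriv ψ hψ p v) := by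
  induction hC using Submodule.span_induction with
  | mem C hC =>
    obtain ⟨P, hP, Q, hQ, rfl⟩ := hC
    obtain ⟨h1, h2⟩ := diff_le_paramAlg (V := V) (N := N) D hP φ hφ
    obtain ⟨h3, h4⟩ := diff_le_paramAlg (V := V) (N := N) D hQ ψ hψ
    refine ⟨h1.mul h3, fun p v => (famDeriv_mul h1 h3 p v).trans ?_⟩
    rw [h2, h4]
    change _ = P _ * Q _ + P _ * Q _
    ring
  | zero =>
    exact ⟨IsSmoothFamily.const 0, fun p v => (famDeriv_const _ p v).trans (by simp)⟩
  | add C C' _ _ h h' =>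
    obtain ⟨h1, h2⟩ := h
    obtain ⟨h3, h4⟩ := h'
    refine ⟨h1.add h3, fun p v => (famDeriv_add h1 h3 p v).trans ?_⟩
    rw [h2, h4]
    simp only [LinearMap.add_apply]
    abel
  | smul c C _ h =>
    obtain ⟨h1, h2⟩ := h
    have e : ∀ f : D.Obs, c • f = algebraMap ℝ D.Obs c * f := fun f => Algebra.smul_def c f
    simp only [LinearMap.smul_apply, e]
    refine ⟨(IsSmoothFamily.const _).mul h1, fun p v =>
      (famDeriv_mul (IsSmoothFamily.const (algebraMap ℝ D.Obs c)) h1 p v).trans ?_⟩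
    rw [famDeriv_const, h2]
    ring

end Families

/-! ### The adjoint action -/

section Adjoint

variable {F H : Type*} [NormedAddCommGroup F] [NormedSpace ℝ F] [FiniteDimensional ℝ F]
  [TopologicalSpace H] [ChartedSpace F H] [Group H] [LieGroup 𝓘(ℝ, F) ∞ H]

theorem contMDiff_conj (x : H) : ContMDiff 𝓘(ℝ, F) 𝓘(ℝ, F) ∞ (fun y : H => x * y * x⁻¹) :=
  contMDiff_mul_right.comp contMDiff_mul_left

theorem mvfderiv_Ad {f : H → ℝ} (hf : ContMDiff 𝓘(ℝ, F) 𝓘(ℝ, ℝ) ∞ f) (x : H) (v : F) :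
    mvfderiv 𝓘(ℝ, F) f 1 (Ad F x v) = mvfderiv 𝓘(ℝ, F) (fun y : H => f (x * y * x⁻¹)) 1 v := by
  have h := mvfderiv_comp_apply_of_eq (I := 𝓘(ℝ, F)) (I' := 𝓘(ℝ, F)) (f := fun y : H => x * y * x⁻¹)
    (g := f) (1 : H) (y := 1) ((hf 1).mdifferentiableAt (by simp))
    ((contMDiff_conj x 1).mdifferentiableAt (by simp)) (by simp) v
  exact h.symm

theorem Ad_one : Ad F (1 : H) = ContinuousLinearMap.id ℝ F := by
  have : (fun y : H => 1 * y * 1⁻¹) = id := by ext y; simp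
  rw [Ad, this]
  exact mfderiv_id

theorem Ad_mul (x y : H) : Ad F (x * y) = (Ad F x).comp (Ad F y) := by
  ext v
  have h := mfderiv_comp_apply_of_eq (I := 𝓘(ℝ, F)) (I' := 𝓘(ℝ, F)) (I'' := 𝓘(ℝ, F))
    (f := fun z : H => y * z * y⁻¹) (g := fun z : H => x * z * x⁻¹) (1 : H) (y := 1)
    ((contMDiff_conj x 1).mdifferentiableAt (by simp))
    ((contMDiff_conj y 1).mdifferentiableAt (by simp)) (by simp) v
  have e : (fun z : H => x * z * x⁻¹) ∘ (fun z : H => y * z * y⁻¹) =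
      fun z : H => x * y * z * (x * y)⁻¹ := by
    ext z; simp [mul_assoc]
  rw [e] at h
  exact h

variable [T2Space H]

/-- Smooth functions with prescribed differential at `1`. They turn statements on `Ad` into statements
on derivatives of real-valued functions. -/
theorem exists_mvfderiv_one_eq (F H : Type*) [NormedAddCommGroup F] [NormedSpace ℝ F]
    [FiniteDimensional ℝ F] [TopologicalSpace H] [ChartedSpace F H] [Group H]
    [LieGroup 𝓘(ℝ, F) ∞ H] [T2Space H] (ℓ : F →ₗ[ℝ] ℝ) :
    ∃ f : H → ℝ, ContMDiff 𝓘(ℝ, F) 𝓘(ℝ, ℝ) ∞ f ∧ ∀ v : F, mvfderiv 𝓘(ℝ, F) f 1 v = ℓ v := by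
  obtain ⟨f, hf⟩ := exists_mvfderiv_eq (I := 𝓘(ℝ, F)) (1 : H) ℓ
  exact ⟨f, f.contMDiff, hf⟩

theorem contMDiff_linear_Ad (ℓ : F →ₗ[ℝ] ℝ) (v : F) :
    ContMDiff 𝓘(ℝ, F) 𝓘(ℝ, ℝ) ∞ (fun x : H => ℓ (Ad F x v)) := by
  obtain ⟨f, hf, h⟩ := exists_mvfderiv_one_eq F H ℓ
  simp only [← h, mvfderiv_Ad hf]
  refine contMDiff_partial (J := 𝓘(ℝ, F)) (fun x y : H => f (x * y * x⁻¹)) ?_ 1 v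
  exact hf.comp (((contMDiff_mul 𝓘(ℝ, F) ∞).comp (contMDiff_fst.prodMk contMDiff_snd)).mul
    ((contMDiff_inv 𝓘(ℝ, F) ∞).comp contMDiff_fst))

theorem contMDiff_Ad : ContMDiff 𝓘(ℝ, F) 𝓘(ℝ, F →L[ℝ] F) ∞ (fun x : H => Ad F x) := by
  let w := Module.finBasis ℝ F
  have h : ∀ x : H, Ad F x = ∑ j, ∑ i, w.coord i (Ad F x (w j)) •
      (LinearMap.toContinuousLinearMap (w.coord j)).smulRight (w i) := by
    intro x
    ext v
    conv_lhs => rw [← w.sum_repr v]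
    simp only [map_sum, map_smul, sum_apply, smul_apply, ContinuousLinearMap.smulRight_apply,
      LinearMap.coe_toContinuousLinearMap', Module.Basis.coord_apply]
    refine Finset.sum_congr rfl fun j _ => ?_
    conv_lhs => rw [← w.sum_repr (Ad F x (w j)), Finset.smul_sum]
    exact Finset.sum_congr rfl fun i _ => smul_comm _ _ _
  rw [show (fun x : H => Ad F x) = _ from funext h]
  exact contMDiff_finsetSum fun j _ => contMDiff_finsetSum fun i _ =>
    (contMDiff_linear_Ad _ _).smul contMDiff_const

theorem mvfderiv_comp_inv {f : H → ℝ} (hf : ContMDiff 𝓘(ℝ, F) 𝓘(ℝ, ℝ) ∞ f) (v : F) :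
    mvfderiv 𝓘(ℝ, F) (fun y : H => f y⁻¹) 1 v = -mvfderiv 𝓘(ℝ, F) f 1 v := by
  have h := mvfderiv_diag (f := fun a b : H => f (a * b⁻¹)) (hf.comp (contMDiff_fst.mul
    ((contMDiff_inv 𝓘(ℝ, F) ∞).comp contMDiff_snd))) 1 v
  simp only [mul_inv_cancel, inv_one, mul_one, one_mul] at h
  have h0 : mvfderiv 𝓘(ℝ, F) (fun _ : H => f 1) 1 v = 0 :=
    DFunLike.congr_fun (mvfderiv_const (I := 𝓘(ℝ, F)) (M := H) (f 1) (x := 1)) v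
  linarith

/-- The derivative of `Ad` at `1` is the Lie bracket. -/
theorem mvfderiv_linear_Ad (ℓ : F →ₗ[ℝ] ℝ) (y v : LieAlg F H) :
    mvfderiv 𝓘(ℝ, F) (fun x : H => ℓ (Ad F x v)) 1 y = ℓ (⁅y, v⁆ : LieAlg F H) := by
  obtain ⟨f, hf, h⟩ := exists_mvfderiv_one_eq F H ℓ
  have e1 : (fun x : H => ℓ (Ad F x v)) =
      fun x : H => mvfderiv 𝓘(ℝ, F) (fun z : H => f (x * z * x⁻¹)) 1 v :=
    funext fun x => (h _).symm.trans (mvfderiv_Ad hf x v)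
  refine (congrArg (fun k : H → ℝ => mvfderiv 𝓘(ℝ, F) k 1 y) e1).trans (Eq.trans ?_ (h _))
  have hm : ContMDiff ((𝓘(ℝ, F).prod 𝓘(ℝ, F)).prod 𝓘(ℝ, F)) 𝓘(ℝ, ℝ) ∞
      (fun x : (H × H) × H => f (x.1.1 * x.2 * x.1.2⁻¹)) :=
    hf.comp (((contMDiff_fst.comp contMDiff_fst).mul contMDiff_snd).mul
      ((contMDiff_inv 𝓘(ℝ, F) ∞).comp (contMDiff_snd.comp contMDiff_fst)))
  refine (mvfderiv_diag (f := fun x x' : H => mvfderiv 𝓘(ℝ, F) (fun z : H => f (x * z * x'⁻¹)) 1 v)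
    (contMDiff_partial (J := 𝓘(ℝ, F).prod 𝓘(ℝ, F))
      (fun (x : H × H) (z : H) => f (x.1 * z * x.2⁻¹)) hm 1 v) 1 y).trans ?_
  have h2 : mvfderiv 𝓘(ℝ, F) (fun x' : H => mvfderiv 𝓘(ℝ, F) (fun z : H => f (1 * z * x'⁻¹)) 1 v) 1 y
      = -mvfderiv 𝓘(ℝ, F) (fun z : H => mvfderiv 𝓘(ℝ, F) (fun x : H => f (z * x)) 1 y) 1 v := by
    refine (mvfderiv_mvfderiv_comm (V := F) (W := F) (f := fun x' z : H => f (1 * z * x'⁻¹))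
      (hf.comp ((contMDiff_const.mul contMDiff_snd).mul
        ((contMDiff_inv 𝓘(ℝ, F) ∞).comp contMDiff_fst))) 1 y 1 v).trans ?_
    have e2 : ∀ z : H, mvfderiv 𝓘(ℝ, F) (fun x : H => f (1 * z * x⁻¹)) 1 y =
        -mvfderiv 𝓘(ℝ, F) (fun x : H => f (z * x)) 1 y := fun z => by
      rw [one_mul]
      exact mvfderiv_comp_inv (f := fun x => f (z * x)) (hf.comp contMDiff_mul_left) y
    simp only [e2]
    exact DFunLike.congr_fun (mvfderiv_fun_neg (I := 𝓘(ℝ, F)) (x := (1 : H))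
      (g := fun z : H => mvfderiv 𝓘(ℝ, F) (fun x : H => f (z * x)) 1 y)) v
  have h3 := lieDeriv_bracket f hf y v 1
  simp only [one_mul] at h3
  refine Eq.trans ?_ h3.symm
  rw [sub_eq_add_neg, ← h2]
  simp only [inv_one, mul_one]

end Adjoint

/-! ### The action of `G × H` on functions -/

section RightAction

variable {F E H G : Type*} [NormedAddCommGroup F] [NormedSpace ℝ F] [FiniteDimensional ℝ F]
  [NormedAddCommGroup E] [NormedSpace ℝ E] [FiniteDimensional ℝ E]
  [TopologicalSpace H] [ChartedSpace F H] [Group H] [LieGroup 𝓘(ℝ, F) ∞ H]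
  [TopologicalSpace G] [ChartedSpace E G] [Group G] [LieGroup 𝓘(ℝ, E) ∞ G]
  (D : Base F E H G)

namespace Base

theorem rightPull_one (f : D.Obs) : D.rightPull 1 f = f := by
  ext m
  change f (D.rightAct 1 m) = f m
  congr 1
  refine Prod.ext (Subtype.ext ?_) ?_
  · change (m.1 : StrongDual ℝ F).comp (Ad F (1 : H)) = m.1
    rw [Ad_one]
    rfl
  · change m.2 * D.incl 1 = m.2
    rw [map_one, mul_one]

theorem rightPull_mul (x y : H) (f : D.Obs) :
    D.rightPull (x * y) f = D.rightPull x (D.rightPull y f) := by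
  ext m
  change f (D.rightAct (x * y) m) = f (D.rightAct y (D.rightAct x m))
  congr 1
  refine Prod.ext (Subtype.ext ?_) ?_
  · change (m.1 : StrongDual ℝ F).comp (Ad F (x * y)) =
      ((m.1 : StrongDual ℝ F).comp (Ad F x)).comp (Ad F y)
    rw [Ad_mul]
    rfl
  · change m.2 * D.incl (x * y) = m.2 * D.incl x * D.incl y
    rw [map_mul, mul_assoc]

theorem leftPull_one (f : D.Obs) : leftPull (1 : G) f = f := by
  ext m
  change f (m.1, 1 * m.2) = f m
  rw [one_mul]

theorem leftPull_mul (a b : G) (f : D.Obs) : leftPull (a * b) f = leftPull b (leftPull a f) := by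
  ext m
  change f (m.1, a * b * m.2) = f (m.1, a * (b * m.2))
  rw [mul_assoc]

/-- The right translation by `x ∈ H` as an automorphism of the algebra of functions. -/
noncomputable def rightEquiv (x : H) : D.Obs ≃ₐ[ℝ] D.Obs :=
  AlgEquiv.ofLinearEquiv (LinearEquiv.ofLinearMap (D.rightPull x) (D.rightPull x⁻¹)
    (by ext1 f; change D.rightPull x (D.rightPull x⁻¹ f) = f
        rw [← rightPull_mul, mul_inv_cancel, rightPull_one])
    (by ext1 f; change D.rightPull x⁻¹ (D.rightPull x f) = f
        rw [← rightPull_mul, inv_mul_cancel, rightPull_one])) rfl fun _ _ => rfl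

/-- The left translation by `a ∈ G` as an automorphism of the algebra of functions. -/
noncomputable def leftEquiv (a : G) : D.Obs ≃ₐ[ℝ] D.Obs :=
  AlgEquiv.ofLinearEquiv (LinearEquiv.ofLinearMap (leftPull a) (leftPull a⁻¹)
    (by ext1 f; change leftPull a (leftPull a⁻¹ f) = f
        rw [← leftPull_mul, inv_mul_cancel, leftPull_one])
    (by ext1 f; change leftPull a⁻¹ (leftPull a f) = f
        rw [← leftPull_mul, mul_inv_cancel, leftPull_one])) rfl fun _ _ => rfl

theorem rightEquiv_apply (x : H) (f : D.Obs) : D.rightEquiv x f = D.rightPull x f := rfl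

theorem leftEquiv_apply (a : G) (f : D.Obs) : D.leftEquiv a f = leftPull a f := rfl

theorem isSmoothFamily_leftPull (f : D.Obs) :
    IsSmoothFamily E fun a : G => leftPull a f :=
  f.contMDiff.comp ((contMDiff_fst.comp contMDiff_snd).prodMk ((contMDiff_mul 𝓘(ℝ, E) ∞).comp
    (contMDiff_fst.prodMk (contMDiff_snd.comp contMDiff_snd))))

theorem contMDiff_coadjoint [T2Space H] : ContMDiff (𝓘(ℝ, F).prod 𝓘(ℝ, StrongDual ℝ F))
    𝓘(ℝ, StrongDual ℝ F) ∞ (fun x : H × D.U =>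
      (⟨(x.2 : StrongDual ℝ F).comp (Ad F x.1), D.invariant x.1 x.2 x.2.2⟩ : D.U)) := by
  rw [← ContMDiff.subtypeVal_comp_iff]
  exact ContMDiff.clm_comp (contMDiff_subtype_val.comp contMDiff_snd) (contMDiff_Ad.comp contMDiff_fst)

theorem isSmoothFamily_rightPull [T2Space H] (f : D.Obs) :
    IsSmoothFamily F fun x : H => D.rightPull x f :=
  f.contMDiff.comp ((D.contMDiff_coadjoint.comp (contMDiff_fst.prodMk
    (contMDiff_fst.comp contMDiff_snd))).prodMk ((contMDiff_mul 𝓘(ℝ, E) ∞).comp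
    ((contMDiff_snd.comp contMDiff_snd).prodMk (D.incl.contMDiff_toFun.comp contMDiff_fst))))

end Base

/-- The derivative of a function along a curve in the factor `U`. -/
theorem mvfderiv_comp_dirField {V N : Type*} [NormedAddCommGroup V] [NormedSpace ℝ V]
    [TopologicalSpace N] [ChartedSpace V N] [IsManifold 𝓘(ℝ, V) ∞ N] {U : Opens (StrongDual ℝ F)}
    (c : N → U) (hc : ContMDiff 𝓘(ℝ, V) 𝓘(ℝ, StrongDual ℝ F) ∞ c) (p : N) (v : V)
    (ξ : StrongDual ℝ F)
    (hξ : ∀ y, mvfderiv 𝓘(ℝ, V) (fun n => (c n : StrongDual ℝ F) y) p v = ξ y)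
    (f : Fn E G U) (g : G) :
    mvfderiv 𝓘(ℝ, V) (fun n => f (c n, g)) p v = dirField ξ f (c p, g) := by
  obtain ⟨ξ₀, hξ₀⟩ : ∃ ξ₀ : StrongDual ℝ F, ξ₀ = mfderiv 𝓘(ℝ, V) 𝓘(ℝ, StrongDual ℝ F) c p v :=
    ⟨_, rfl⟩
  have h : ∀ f : Fn E G U, mvfderiv 𝓘(ℝ, V) (fun n => f (c n, g)) p v = dirField ξ₀ f (c p, g) := by
    intro f
    rw [hξ₀]
    exact mvfderiv_comp_apply_of_eq (I := 𝓘(ℝ, StrongDual ℝ F)) (I' := 𝓘(ℝ, V)) (f := c)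
      (g := fun μ : U => f (μ, g)) p (y := c p) ((contMDiff_sliceU f g (c p)).mdifferentiableAt (by simp))
      ((hc p).mdifferentiableAt (by simp)) rfl v
  -- linear functions detect the velocity
  have e : ξ₀ = ξ := by
    refine ContinuousLinearMap.ext fun y => ?_
    have h1 := h (lin y)
    rw [dirField_lin] at h1
    exact h1.symm.trans (hξ y)
  rw [h, e]

end RightAction

section RightAction

variable {F E H G : Type*} [NormedAddCommGroup F] [NormedSpace ℝ F] [FiniteDimensional ℝ F]
  [NormedAddCommGroup E] [NormedSpace ℝ E] [FiniteDimensional ℝ E]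
  [TopologicalSpace H] [ChartedSpace F H] [Group H] [LieGroup 𝓘(ℝ, F) ∞ H]
  [TopologicalSpace G] [ChartedSpace E G] [Group G] [LieGroup 𝓘(ℝ, E) ∞ G]
  [T2Space G] {U : Opens (StrongDual ℝ F)}

theorem dirField_eq_sum (ξ : StrongDual ℝ F) (f : Fn E G U) :
    dirField ξ f = ∑ i, ξ (hBasis F i) • dirField (hDual F i) f := by
  ext m
  rw [smoothMap_sum_apply]
  conv_lhs => rw [sum_apply_smul_hDual ξ]
  refine (map_sum (mvfderiv 𝓘(ℝ, StrongDual ℝ F) (fun μ : U => f (μ, m.2)) m.1 :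
    StrongDual ℝ F →L[ℝ] ℝ) _ _).trans (Finset.sum_congr rfl fun i _ => ?_)
  exact map_smul (mvfderiv 𝓘(ℝ, StrongDual ℝ F) (fun μ : U => f (μ, m.2)) m.1 :
    StrongDual ℝ F →L[ℝ] ℝ) _ _

theorem leftField_eq_sum (x : LieAlg E G) (f : Fn E G U) :
    leftField x f = ∑ k, (gBasis E G).repr x k • leftField (gBasis E G k) f := by
  ext m
  rw [smoothMap_sum_apply]
  conv_lhs => rw [← (gBasis E G).sum_repr x]
  refine (map_sum (mvfderiv 𝓘(ℝ, E) (fun a : G => f (m.1, m.2 * a)) 1) _ _).trans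
    (Finset.sum_congr rfl fun i _ => ?_)
  exact map_smul (mvfderiv 𝓘(ℝ, E) (fun a : G => f (m.1, m.2 * a)) 1) _ _

variable (D : Base F E H G)

namespace Base

theorem leftPull_frame (a : G) (i : Fin (Module.finrank ℝ F) ⊕ Fin (Module.finrank ℝ E))
    (f : D.Obs) : leftPull a (frame i f) = frame i (leftPull a f) := by
  cases i with
  | inl i => rfl
  | inr k =>
    ext m
    change mvfderiv 𝓘(ℝ, E) (fun b : G => f (m.1, a * m.2 * b)) 1 _ =
      mvfderiv 𝓘(ℝ, E) (fun b : G => f (m.1, a * (m.2 * b))) 1 _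
    simp only [mul_assoc]

theorem rightPull_leftField (x : H) (v : LieAlg E G) (f : D.Obs) :
    D.rightPull x (leftField v f) = leftField (Ad E (D.incl x) v : E) (D.rightPull x f) := by
  ext m
  have h := mvfderiv_Ad (F := E) (f := fun a : G => f ((D.rightAct x m).1, m.2 * a * D.incl x))
    ((contMDiff_slice f _).comp (contMDiff_mul_right.comp contMDiff_mul_left)) (D.incl x) v
  refine Eq.trans ?_ h.symm
  change mvfderiv 𝓘(ℝ, E) (fun b : G => f ((D.rightAct x m).1, m.2 * D.incl x * b)) 1 _ = _
  congr 2
  ext b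
  congr 2
  group

theorem rightPull_dirField [T2Space H] (x : H) (ξ : StrongDual ℝ F) (f : D.Obs) :
    D.rightPull x (dirField ξ f) = dirField (ξ.comp (Ad F x⁻¹)) (D.rightPull x f) := by
  ext m
  have hc : ContMDiff 𝓘(ℝ, StrongDual ℝ F) 𝓘(ℝ, StrongDual ℝ F) ∞ (fun μ : D.U =>
      (⟨(μ : StrongDual ℝ F).comp (Ad F x), D.invariant x μ μ.2⟩ : D.U)) :=
    D.contMDiff_coadjoint.comp (contMDiff_const.prodMk contMDiff_id)
  refine (mvfderiv_comp_dirField _ hc m.1 (ξ.comp (Ad F x⁻¹)) ξ (fun y => ?_) f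
    (m.2 * D.incl x)).symm
  have h := congrArg (fun k : D.Obs => k m) (dirField_lin (U := D.U) (E := E) (G := G)
    (ξ.comp (Ad F x⁻¹)) (Ad F x y))
  refine Eq.trans h ?_
  change ξ (Ad F x⁻¹ (Ad F x y)) = ξ y
  rw [← ContinuousLinearMap.comp_apply (Ad F x⁻¹), ← Ad_mul, inv_mul_cancel, Ad_one]
  rfl

/-- The right translations transform the frame by constant matrices. -/
theorem exists_rightPull_frame [T2Space H] (x : H) :
    ∃ t : Fin (Module.finrank ℝ F) ⊕ Fin (Module.finrank ℝ E) →
      Fin (Module.finrank ℝ F) ⊕ Fin (Module.finrank ℝ E) → ℝ, ∀ i (f : D.Obs),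
      D.rightPull x (frame i f) = ∑ j, t i j • frame j (D.rightPull x f) := by
  refine ⟨fun i j => match i, j with
    | .inl i, .inl j => (hDual F i).comp (Ad F x⁻¹) (hBasis F j)
    | .inr k, .inr l => (gBasis E G).repr (Ad E (D.incl x) (gBasis E G k) : E) l
    | _, _ => 0, fun i f => ?_⟩
  rw [Fintype.sum_sum_type]
  cases i with
  | inl i =>
    simp only [zero_smul, Finset.sum_const_zero, add_zero]
    exact (D.rightPull_dirField x _ f).trans (dirField_eq_sum _ _)
  | inr k =>
    simp only [zero_smul, Finset.sum_const_zero, zero_add]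
    exact (D.rightPull_leftField x _ f).trans (leftField_eq_sum _ _)

theorem biOp_apply (c : D.Obs) (P Q : Module.End ℝ D.Obs) (f g : D.Obs) :
    D.biOp c P Q f g = c * (P f * Q g) := rfl

theorem bracket_lin (r : D.SmoothTensor) (y : F) (f : D.Obs) : D.bracket r (lin y) f =
    ∑ i, ∑ j, ((hBasis F).repr y i • lin (F := F) (hBracket F H i j)) * dirField (hDual F j) f +
      ∑ i, (hBasis F).repr y i • leftField (D.inclLie (hBasis F i)) f := by
  have hd : ∀ i, hDual F i y = (hBasis F).repr y i := fun i => rfl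
  simp only [bracket, LinearMap.add_apply, LinearMap.sum_apply, LinearMap.sub_apply, biOp_apply,
    dirField_lin, leftField_lin, zero_mul, mul_zero, Finset.sum_const_zero, add_zero, sub_zero,
    one_mul, hd]
  congr 1
  refine Finset.sum_congr rfl fun i _ => Finset.sum_congr rfl fun j _ => ?_
  rw [Algebra.smul_def]
  ring

/-- The bracket with the linear function `y ∈ 𝔥` generates the right action of `H`. -/
theorem famDeriv_rightPull [T2Space H] (r : D.SmoothTensor) (y : F) (f : D.Obs) :
    famDeriv _ (D.isSmoothFamily_rightPull f) 1 y = D.bracket r (lin y) f := by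
  ext m
  have hs : ContMDiff (𝓘(ℝ, F).prod 𝓘(ℝ, F)) 𝓘(ℝ, ℝ) ∞ (fun x : H × H =>
      f (⟨(m.1 : StrongDual ℝ F).comp (Ad F x.1), D.invariant x.1 m.1 m.1.2⟩,
        m.2 * D.incl x.2)) :=
    f.contMDiff.comp ((D.contMDiff_coadjoint.comp (contMDiff_fst.prodMk contMDiff_const)).prodMk
      (contMDiff_mul_left.comp (D.incl.contMDiff_toFun.comp contMDiff_snd)))
  refine (mvfderiv_diag (f := fun x x' : H =>
      f (⟨(m.1 : StrongDual ℝ F).comp (Ad F x), D.invariant x m.1 m.1.2⟩, m.2 * D.incl x'))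
      hs 1 y).trans ?_
  have h1 : (⟨(m.1 : StrongDual ℝ F).comp (Ad F (1 : H)), D.invariant 1 m.1 m.1.2⟩ : D.U) = m.1 :=
    Subtype.ext (by
      change (m.1 : StrongDual ℝ F).comp (Ad F (1 : H)) = m.1
      rw [Ad_one]; rfl)
  have e1 : mvfderiv 𝓘(ℝ, F) (fun x' : H =>
      f (⟨(m.1 : StrongDual ℝ F).comp (Ad F (1 : H)), D.invariant 1 m.1 m.1.2⟩,
        m.2 * D.incl x')) 1 y = leftField (D.inclLie y) f m := by
    rw [h1]
    exact mvfderiv_comp_apply_of_eq (I := 𝓘(ℝ, E)) (I' := 𝓘(ℝ, F)) (f := D.incl)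
      (g := fun a : G => f (m.1, m.2 * a)) 1 (y := 1)
      ((((contMDiff_slice f m.1).comp contMDiff_mul_left) 1).mdifferentiableAt (by simp))
      ((D.incl.contMDiff_toFun 1).mdifferentiableAt (by simp)) (map_one D.incl) y
  have e2 : mvfderiv 𝓘(ℝ, F) (fun x : H =>
      f (⟨(m.1 : StrongDual ℝ F).comp (Ad F x), D.invariant x m.1 m.1.2⟩,
        m.2 * D.incl 1)) 1 y = dirField (D.coadLie y m.1) f m := by
    rw [map_one, mul_one]
    refine (mvfderiv_comp_dirField (fun x : H =>
      (⟨(m.1 : StrongDual ℝ F).comp (Ad F x), D.invariant x m.1 m.1.2⟩ : D.U))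
      (D.contMDiff_coadjoint.comp (contMDiff_id.prodMk contMDiff_const)) 1 y
      (D.coadLie y m.1) (fun z => ?_) f m.2).trans ?_
    · exact mvfderiv_linear_Ad ((m.1 : StrongDual ℝ F) : F →ₗ[ℝ] ℝ) y z
    · rw [h1]
  refine (congrArg₂ (· + ·) e2 e1).trans ?_
  have e3 : ∀ j, D.coadLie y m.1 (hBasis F j) =
      ∑ i, (hBasis F).repr y i * (m.1 : StrongDual ℝ F) (hBracket F H i j) := by
    intro j
    have hy := (hBasis F).sum_repr y
    let ψ : F →ₗ[ℝ] ℝ := ((m.1 : StrongDual ℝ F) : F →ₗ[ℝ] ℝ) ∘ₗ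
      ((LieModule.toEnd ℝ (LieAlg F H) (LieAlg F H)).toLinearMap.flip (hBasis F j : F))
    change ψ y = ∑ i, (hBasis F).repr y i * ψ (hBasis F i)
    conv_lhs => rw [← hy, map_sum]
    exact Finset.sum_congr rfl fun i _ => map_smul ψ _ _
  have e4 : leftField (D.inclLie y) f =
      ∑ i, (hBasis F).repr y i • leftField (D.inclLie (hBasis F i)) f := by
    ext m
    rw [smoothMap_sum_apply]
    conv_lhs => rw [← (hBasis F).sum_repr y]
    refine (map_sum ((mvfderiv 𝓘(ℝ, E) (fun a : G => f (m.1, m.2 * a)) 1).toLinearMap ∘ₗ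
      D.inclLie) _ _).trans (Finset.sum_congr rfl fun i _ => ?_)
    exact map_smul ((mvfderiv 𝓘(ℝ, E) (fun a : G => f (m.1, m.2 * a)) 1).toLinearMap ∘ₗ
      D.inclLie) _ _
  rw [bracket_lin, dirField_eq_sum, e4]
  refine congrArg₂ (· + ·) ?_ rfl
  rw [Finset.sum_comm, smoothMap_sum_apply, smoothMap_sum_apply]
  refine Finset.sum_congr rfl fun j _ => ?_
  rw [smoothMap_sum_apply]
  change D.coadLie y m.1 (hBasis F j) * dirField (hDual F j) f m = _
  rw [e3, Finset.sum_mul]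
  rfl

end Base

end RightAction

/-! ### Infinitesimal and global invariance -/

section Equivariance

variable {F E H G : Type*} [NormedAddCommGroup F] [NormedSpace ℝ F] [FiniteDimensional ℝ F]
  [NormedAddCommGroup E] [NormedSpace ℝ E] [FiniteDimensional ℝ E]
  [TopologicalSpace H] [ChartedSpace F H] [Group H] [LieGroup 𝓘(ℝ, F) ∞ H]
  [TopologicalSpace G] [ChartedSpace E G] [Group G] [LieGroup 𝓘(ℝ, E) ∞ G]
  [T2Space G] {U : Opens (StrongDual ℝ F)}
  {V : Type*} [NormedAddCommGroup V] [NormedSpace ℝ V] [FiniteDimensional ℝ V]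
  {K : Type*} [TopologicalSpace K] [ChartedSpace V K] [Group K] [LieGroup 𝓘(ℝ, V) ∞ K]
  [T2Space K]

theorem IsSmoothFamily.comp_inv {φ : K → Fn E G U} (hφ : IsSmoothFamily V φ) :
    IsSmoothFamily V fun a => φ a⁻¹ :=
  ContMDiff.comp (g := fun x : K × (U × G) => φ x.1 x.2) hφ
    (((contMDiff_inv 𝓘(ℝ, V) ∞).comp contMDiff_fst).prodMk contMDiff_snd)

theorem famDeriv_comp_inv {φ : K → Fn E G U} (hφ : IsSmoothFamily V φ) (v : V) :
    famDeriv _ hφ.comp_inv 1 v = -famDeriv φ hφ 1 v := by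
  ext m
  exact mvfderiv_comp_inv (hφ.apply m) v

/-- The derivative of a function on a Lie group vanishes if the derivatives of all its left
translates vanish at `1`. -/
theorem mvfderiv_eq_zero_of_translates {ψ : K → ℝ} (hψ : ContMDiff 𝓘(ℝ, V) 𝓘(ℝ, ℝ) ∞ ψ) (p : K)
    (h : ∀ v : V, mvfderiv 𝓘(ℝ, V) (fun b => ψ (p * b)) 1 v = 0) (v : TangentSpace 𝓘(ℝ, V) p) :
    mvfderiv 𝓘(ℝ, V) ψ p v = 0 := by
  have h1 := mvfderiv_comp_apply_of_eq (I := 𝓘(ℝ, V)) (I' := 𝓘(ℝ, V)) (f := fun b : K => p⁻¹ * b)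
    (g := fun b : K => ψ (p * b)) p (y := 1)
    (((hψ.comp contMDiff_mul_left) 1).mdifferentiableAt (by simp))
    ((contMDiff_mul_left (I := 𝓘(ℝ, V)) (n := ∞) p).mdifferentiableAt (by simp))
    (inv_mul_cancel p) v
  have e : (fun b : K => ψ (p * b)) ∘ (fun b : K => p⁻¹ * b) = ψ := by
    ext b
    simp
  rw [e] at h1
  exact h1.trans (h _)

/-- A bidifferential operator which is infinitesimally invariant under a connected Lie group `K`
acting on `M` is `K`-invariant. The action is given by the pull-backs `T a f = f ∘ τ a`, with
`T` a homomorphism. -/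
theorem bidiff_equivariant [ConnectedSpace K] (D : Base F E H G) {C : D.Obs →ₗ[ℝ] D.Obs →ₗ[ℝ] D.Obs}
    (hC : C ∈ D.Bidiff) (T : K → Module.End ℝ D.Obs) (τ : K → D.U × G → D.U × G)
    (hτ : ∀ a f m, T a f m = f (τ a m))
    (hsm : ContMDiff (𝓘(ℝ, V).prod ((𝓘(ℝ, StrongDual ℝ F)).prod 𝓘(ℝ, E)))
      ((𝓘(ℝ, StrongDual ℝ F)).prod 𝓘(ℝ, E)) ∞ fun x : K × (D.U × G) => τ x.1 x.2)
    (h1 : ∀ f, T 1 f = f) (hmul : ∀ a b f, T (a * b) f = T a (T b f))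
    (hf : ∀ f, IsSmoothFamily V fun a => T a f)
    (hi : ∀ (v : V) f g, famDeriv _ (hf (C f g)) 1 v =
      C (famDeriv _ (hf f) 1 v) g + C f (famDeriv _ (hf g) 1 v))
    (a : K) (f g : D.Obs) : C (T a f) (T a g) = T a (C f g) := by
  have hτ1 : ∀ (k : D.Obs) m, k (τ 1 m) = k m := fun k m => by rw [← hτ, h1]
  -- the function `a ↦ T a (C (T a⁻¹ f) (T a⁻¹ g)) m` is constant
  have hsm' : ∀ (f g : D.Obs) (m : D.U × G), ContMDiff (𝓘(ℝ, V).prod 𝓘(ℝ, V)) 𝓘(ℝ, ℝ) ∞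
      (Function.uncurry fun a b : K => T b (C (T a⁻¹ f) (T a⁻¹ g)) m) := by
    intro f g m
    obtain ⟨h, -⟩ := famDeriv_bidiff D hC (hf f).comp_inv (hf g).comp_inv
    have h2 := ContMDiff.comp (g := fun x : K × (D.U × G) => C (T x.1⁻¹ f) (T x.1⁻¹ g) x.2) h
      (contMDiff_fst.prodMk (hsm.comp (contMDiff_snd.prodMk (contMDiff_const (c := m)))) :
        ContMDiff (𝓘(ℝ, V).prod 𝓘(ℝ, V)) _ ∞ fun x : K × K => (x.1, τ x.2 m))
    convert h2 using 1
    ext x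
    exact hτ _ _ _
  have hd : ∀ (f g : D.Obs) (m : D.U × G) (v : V),
      mvfderiv 𝓘(ℝ, V) (fun b : K => T b (C (T b⁻¹ f) (T b⁻¹ g)) m) 1 v = 0 := by
    intro f g m v
    refine (mvfderiv_diag (hsm' f g m) 1 v).trans ?_
    obtain ⟨h, h'⟩ := famDeriv_bidiff D hC (hf f).comp_inv (hf g).comp_inv
    have e1 : mvfderiv 𝓘(ℝ, V) (fun a : K => T 1 (C (T a⁻¹ f) (T a⁻¹ g)) m) 1 v =
        famDeriv _ h 1 v m := by
      simp only [h1]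
      rfl
    have e2 : mvfderiv 𝓘(ℝ, V) (fun b : K => T b (C (T 1⁻¹ f) (T 1⁻¹ g)) m) 1 v =
        famDeriv _ (hf (C f g)) 1 v m := by
      simp only [h1, inv_one]
      rfl
    refine (congrArg₂ (· + ·) e1 e2).trans ?_
    rw [h', hi, famDeriv_comp_inv (hf f), famDeriv_comp_inv (hf g)]
    simp only [inv_one, h1, map_neg, LinearMap.neg_apply]
    change (-(C _ g) m + -(C f _) m) + ((C _ g) m + (C f _) m) = 0
    ring
  have hψ : ∀ (f g : D.Obs) (m : D.U × G), ContMDiff 𝓘(ℝ, V) 𝓘(ℝ, ℝ) ∞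
      (fun b : K => T b (C (T b⁻¹ f) (T b⁻¹ g)) m) := fun f g m =>
    (hsm' f g m).comp (contMDiff_id.prodMk contMDiff_id)
  have key : ∀ (f g : D.Obs), T a (C (T a⁻¹ f) (T a⁻¹ g)) = C f g := by
    intro f g
    ext m
    have := eq_of_mvfderiv_eq_zero (hψ f g m) (fun p v =>
      mvfderiv_eq_zero_of_translates (hψ f g m) p (fun w => ?_) v) a 1
    · refine this.trans ?_
      rw [h1, inv_one, h1, h1]
    · refine Eq.trans ?_ (hd (T p⁻¹ f) (T p⁻¹ g) (τ p m) w)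
      congr 2
      ext b
      rw [hmul, hτ p, mul_inv_rev, hmul, hmul]
  have h := key (T a f) (T a g)
  rw [← hmul, ← hmul, inv_mul_cancel, h1, h1] at h
  exact h.symm

namespace Base

variable (D : Base F E H G)

theorem isSmoothFamily_leftPull_inv (f : D.Obs) :
    IsSmoothFamily E fun a : G => leftPull a⁻¹ f :=
  (D.isSmoothFamily_leftPull f).comp_inv

theorem famDeriv_leftPull_inv (x : E) (f : D.Obs) :
    famDeriv _ (D.isSmoothFamily_leftPull_inv f) 1 x = leftAction x f := by
  ext m
  exact (leftAction_apply x f m).symm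

theorem bidiff_leftPull [ConnectedSpace G] {C : D.Obs →ₗ[ℝ] D.Obs →ₗ[ℝ] D.Obs} (hC : C ∈ D.Bidiff)
    (hi : ∀ (x : LieAlg E G) f g,
      leftAction x (C f g) = C (leftAction x f) g + C f (leftAction x g)) (a : G) (f g : D.Obs) :
    C (leftPull a f) (leftPull a g) = leftPull a (C f g) := by
  have h := bidiff_equivariant (K := G) D hC (fun a => leftPull a⁻¹) (fun a m => (m.1, a⁻¹ * m.2))
    (fun a f m => rfl) ((contMDiff_fst.comp contMDiff_snd).prodMk (((contMDiff_inv 𝓘(ℝ, E) ∞).comp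
      contMDiff_fst).mul (contMDiff_snd.comp contMDiff_snd)))
    (fun f => by rw [inv_one, D.leftPull_one])
    (fun a b f => by rw [mul_inv_rev, D.leftPull_mul]) D.isSmoothFamily_leftPull_inv
    (fun v f g => by rw [D.famDeriv_leftPull_inv v f, D.famDeriv_leftPull_inv v g,
      D.famDeriv_leftPull_inv v (C f g)]; exact hi v f g) a⁻¹ f g
  simpa only [inv_inv] using h

theorem bidiff_rightPull [T2Space H] [ConnectedSpace H] (r : D.SmoothTensor)
    {C : D.Obs →ₗ[ℝ] D.Obs →ₗ[ℝ] D.Obs} (hC : C ∈ D.Bidiff)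
    (hi : ∀ (y : F) f g, D.bracket r (lin y) (C f g) =
      C (D.bracket r (lin y) f) g + C f (D.bracket r (lin y) g)) (x : H) (f g : D.Obs) :
    C (D.rightPull x f) (D.rightPull x g) = D.rightPull x (C f g) :=
  bidiff_equivariant (K := H) D hC D.rightPull D.rightAct (fun _ _ _ => rfl)
    ((D.contMDiff_coadjoint.comp (contMDiff_fst.prodMk
    (contMDiff_fst.comp contMDiff_snd))).prodMk ((contMDiff_mul 𝓘(ℝ, E) ∞).comp
    ((contMDiff_snd.comp contMDiff_snd).prodMk (D.incl.contMDiff_toFun.comp contMDiff_fst))))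
    D.rightPull_one D.rightPull_mul D.isSmoothFamily_rightPull
    (fun v f g => by simp only [D.famDeriv_rightPull r]; exact hi v f g) x f g

/-- The bracket with `y ∈ 𝔥` generates the right action of `H`, hence infinitesimal invariance is
compatibility with the derivations `{y, ·}` and with the infinitesimal left translations. -/
theorem invariant₂_of_infinitesimal [ConnectedSpace G] [T2Space H] [ConnectedSpace H]
    (r : D.SmoothTensor) {C : D.Obs →ₗ[ℝ] D.Obs →ₗ[ℝ] D.Obs} (hC : C ∈ D.Bidiff)
    (hl : ∀ (x : LieAlg E G) f g,
      leftAction x (C f g) = C (leftAction x f) g + C f (leftAction x g))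
    (hr : ∀ (y : F) f g, D.bracket r (lin y) (C f g) =
      C (D.bracket r (lin y) f) g + C f (D.bracket r (lin y) g)) : D.Invariant₂ C :=
  ⟨D.bidiff_leftPull hC hl, D.bidiff_rightPull r hC hr⟩

theorem Invariant.leftAction {P : Module.End ℝ D.Obs} (hP : P ∈ D.Diff) (h : D.Invariant P)
    (x : E) (f : D.Obs) : P (leftAction x f) = leftAction x (P f) := by
  obtain ⟨h1, h2⟩ := diff_le_paramAlg (V := E) (N := G) D hP _ (D.isSmoothFamily_leftPull_inv f)
  rw [← D.famDeriv_leftPull_inv x f, ← D.famDeriv_leftPull_inv x (P f), ← h2]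
  simp only [h.1]

theorem Invariant.bracket_lin [T2Space H] {P : Module.End ℝ D.Obs} (hP : P ∈ D.Diff)
    (h : D.Invariant P) (r : D.SmoothTensor) (y : F) (f : D.Obs) :
    P (D.bracket r (lin y) f) = D.bracket r (lin y) (P f) := by
  obtain ⟨h1, h2⟩ := diff_le_paramAlg (V := F) (N := H) D hP _ (D.isSmoothFamily_rightPull f)
  rw [← D.famDeriv_rightPull r y f, ← D.famDeriv_rightPull r y (P f), ← h2]
  simp only [h.2]

end Base

end Equivariance

/-! ### The action of the associator -/

section Associator

variable {L : Type*} [LieRing L] [LieAlgebra ℝ L]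

/-- The enveloping algebra is generated by the Lie algebra. -/
theorem mem_of_ι_mem (S : Subalgebra ℝ (UEA L))
    (h : ∀ x : L, UniversalEnvelopingAlgebra.ι ℝ x ∈ S) (u : UEA L) : u ∈ S := by
  let φ : L →ₗ⁅ℝ⁆ S :=
    { toFun := fun x => ⟨UniversalEnvelopingAlgebra.ι ℝ x, h x⟩
      map_add' := fun x y => Subtype.ext (map_add _ x y)
      map_smul' := fun c x => Subtype.ext (map_smul _ c x)
      map_lie' := fun {x y} => Subtype.ext ((UniversalEnvelopingAlgebra.ι ℝ).map_lie x y) }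
  have e : S.val.comp (UniversalEnvelopingAlgebra.lift ℝ φ) = AlgHom.id ℝ (UEA L) := by
    apply UniversalEnvelopingAlgebra.hom_ext
    ext x
    change ((UniversalEnvelopingAlgebra.lift ℝ φ (UniversalEnvelopingAlgebra.ι ℝ x) : S) : UEA L) = _
    rw [UniversalEnvelopingAlgebra.lift_ι_apply]
    rfl
  have := DFunLike.congr_fun e u
  change ((UniversalEnvelopingAlgebra.lift ℝ φ u : S) : UEA L) = u at this
  rw [← this]
  exact Subtype.property _

theorem antipode_one : antipode L 1 = 1 := by
  change MulOpposite.unop (antipodeOp L 1) = 1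
  rw [map_one]
  rfl

theorem antipode_mul (u v : UEA L) : antipode L (u * v) = antipode L v * antipode L u := by
  change MulOpposite.unop (antipodeOp L (u * v)) = _
  rw [map_mul]
  rfl

theorem antipode_ι (x : L) : antipode L (UniversalEnvelopingAlgebra.ι ℝ x) =
    -UniversalEnvelopingAlgebra.ι ℝ x := by
  change MulOpposite.unop (antipodeOp L (UniversalEnvelopingAlgebra.ι ℝ x)) = _
  rw [antipodeOp, UniversalEnvelopingAlgebra.lift_ι_apply]
  rfl

theorem antipode_algebraMap (c : ℝ) : antipode L (algebraMap ℝ _ c) = algebraMap ℝ _ c := by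
  rw [Algebra.algebraMap_eq_smul_one, map_smul, antipode_one]

theorem counit_ι (x : L) : counit L (UniversalEnvelopingAlgebra.ι ℝ x) = 0 := by
  rw [counit, UniversalEnvelopingAlgebra.lift_ι_apply]
  rfl

/-- A vector which is killed by the Lie algebra is an eigenvector of the enveloping algebra, with
the counit as its character. -/
theorem lift_antipode_apply {M : Type*} [AddCommGroup M] [Module ℝ M]
    (ρ : L →ₗ⁅ℝ⁆ Module.End ℝ M) (m : M) (h : ∀ x, ρ x m = 0) (u : UEA L) :
    UniversalEnvelopingAlgebra.lift ℝ ρ (antipode L u) m = counit L u • m := by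
  refine mem_of_ι_mem
    { carrier := {u | UniversalEnvelopingAlgebra.lift ℝ ρ (antipode L u) m = counit L u • m}
      mul_mem' := fun {u v} hu hv => ?_
      add_mem' := fun {u v} hu hv => ?_
      algebraMap_mem' := fun c => ?_ } (fun x => ?_) u
  · change _ = _ at hu hv ⊢
    rw [antipode_mul, map_mul, Module.End.mul_apply, hu, map_smul, hv, map_mul, mul_smul]
  · change _ = _ at hu hv ⊢
    rw [map_add, map_add, LinearMap.add_apply, hu, hv, map_add, add_smul]
  · change _ = _
    rw [antipode_algebraMap, AlgHom.commutes, AlgHom.commutes]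
    rfl
  · change _ = _
    rw [antipode_ι, map_neg, UniversalEnvelopingAlgebra.lift_ι_apply, LinearMap.neg_apply, h,
      counit_ι, zero_smul, neg_zero]

theorem coeff_inv_of_map_eq_one {A B : Type*} [Ring A] [Ring B] (φ : A →+* B)
    (Φ : (PowerSeries A)ˣ) (h : ∀ k, φ (PowerSeries.coeff k Φ.1) = if k = 0 then 1 else 0) (k : ℕ) :
    φ (PowerSeries.coeff k (Φ⁻¹).1) = if k = 0 then 1 else 0 := by
  have h1 : PowerSeries.map φ Φ.1 = 1 := by
    ext k
    rw [PowerSeries.coeff_map, h, PowerSeries.coeff_one]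
  have h2 : PowerSeries.map φ (Φ⁻¹).1 = 1 := by
    have := congrArg (PowerSeries.map φ) Φ.mul_inv
    rw [map_mul, map_one] at this
    rw [← this]
    change _ = PowerSeries.map φ Φ.1 * _
    rw [h1, one_mul]
  rw [← PowerSeries.coeff_map, h2, PowerSeries.coeff_one]

theorem coeff_zero_inv {A : Type*} [Ring A] (Φ : (PowerSeries A)ˣ)
    (h : PowerSeries.coeff 0 Φ.1 = 1) : PowerSeries.coeff 0 (Φ⁻¹).1 = 1 := by
  have := congrArg (PowerSeries.coeff 0) Φ.mul_inv
  rw [PowerSeries.coeff_mul, Finset.HasAntidiagonal.antidiagonal_zero, Finset.sum_singleton] at this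
  simpa [h] using this

theorem coeff_one_inv {A : Type*} [Ring A] (Φ : (PowerSeries A)ˣ)
    (h : PowerSeries.coeff 0 Φ.1 = 1) (h' : PowerSeries.coeff 1 Φ.1 = 0) :
    PowerSeries.coeff 1 (Φ⁻¹).1 = 0 := by
  have := congrArg (PowerSeries.coeff 1) Φ.mul_inv
  rw [PowerSeries.coeff_mul, Finset.Nat.antidiagonal_succ] at this
  simpa [h, h', coeff_zero_inv Φ h, PowerSeries.coeff_one] using this

variable {Z : L ⊗[ℝ] (L ⊗[ℝ] L)} {Φ : (PowerSeries (UEA₃ L))ˣ}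

theorem IsAssociator.counit₁_inv (hΦ : IsAssociator Z Φ) (k : ℕ) :
    TensorProduct.map (counit L).toLinearMap (TensorProduct.map LinearMap.id LinearMap.id)
      (PowerSeries.coeff k (Φ⁻¹).1) = if k = 0 then 1 ⊗ₜ (1 ⊗ₜ 1) else 0 := by
  rw [TensorProduct.map_id]
  exact coeff_inv_of_map_eq_one (Algebra.TensorProduct.map (counit L)
    (AlgHom.id ℝ (UEA L ⊗[ℝ] UEA L))).toRingHom Φ hΦ.counit₁ k

theorem IsAssociator.counit₂_inv (hΦ : IsAssociator Z Φ) (k : ℕ) :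
    TensorProduct.map LinearMap.id (TensorProduct.map (counit L).toLinearMap LinearMap.id)
      (PowerSeries.coeff k (Φ⁻¹).1) = if k = 0 then 1 ⊗ₜ (1 ⊗ₜ 1) else 0 :=
  coeff_inv_of_map_eq_one (Algebra.TensorProduct.map (AlgHom.id ℝ (UEA L))
    (Algebra.TensorProduct.map (counit L) (AlgHom.id ℝ (UEA L)))).toRingHom Φ hΦ.counit₂ k

theorem IsAssociator.counit₃_inv (hΦ : IsAssociator Z Φ) (k : ℕ) :
    TensorProduct.map LinearMap.id (TensorProduct.map LinearMap.id (counit L).toLinearMap)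
      (PowerSeries.coeff k (Φ⁻¹).1) = if k = 0 then 1 ⊗ₜ (1 ⊗ₜ 1) else 0 :=
  coeff_inv_of_map_eq_one (Algebra.TensorProduct.map (AlgHom.id ℝ (UEA L))
    (Algebra.TensorProduct.map (AlgHom.id ℝ (UEA L)) (counit L))).toRingHom Φ hΦ.counit₃ k

end Associator

section Action

variable {F E H G : Type*} [NormedAddCommGroup F] [NormedSpace ℝ F] [FiniteDimensional ℝ F]
  [NormedAddCommGroup E] [NormedSpace ℝ E] [FiniteDimensional ℝ E]
  [TopologicalSpace H] [ChartedSpace F H] [Group H] [LieGroup 𝓘(ℝ, F) ∞ H]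
  [TopologicalSpace G] [ChartedSpace E G] [Group G] [LieGroup 𝓘(ℝ, E) ∞ G]
  (D : Base F E H G)

namespace Base

/-- The linear map `u ↦ ρ(S u) f` on the enveloping algebra. -/
noncomputable def orbitMap (f : D.Obs) : UEA (LieAlg E G) →ₗ[ℝ] D.Obs :=
  (((UniversalEnvelopingAlgebra.lift ℝ (leftAction (U := D.U))).toLinearMap).flip f) ∘ₗ
    antipode (LieAlg E G)

theorem orbitMap_one (f : D.Obs) : D.orbitMap f 1 = f := by
  change UniversalEnvelopingAlgebra.lift ℝ (leftAction (U := D.U)) (antipode _ 1) f = f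
  rw [antipode_one, map_one]
  rfl

theorem orbitMap_lin (y : F) : D.orbitMap (lin y) =
    LinearMap.toSpanSingleton ℝ D.Obs (lin y) ∘ₗ (counit (LieAlg E G)).toLinearMap :=
  LinearMap.ext fun u => lift_antipode_apply _ _ (fun x => leftAction_lin x y) u

theorem act₃_antipode (w : UEA₃ (LieAlg E G)) (f g h : D.Obs) :
    D.act₃ (TensorProduct.map (antipode _) (TensorProduct.map (antipode _) (antipode _)) w)
      (f ⊗ₜ (g ⊗ₜ h)) =
    TensorProduct.map (D.orbitMap f) (TensorProduct.map (D.orbitMap g) (D.orbitMap h)) w := by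
  induction w using TensorProduct.induction_on with
  | zero => simp only [map_zero, LinearMap.zero_apply]
  | add w w' hw hw' => simp only [map_add, LinearMap.add_apply, hw, hw']
  | tmul u w =>
    induction w using TensorProduct.induction_on with
    | zero => simp only [TensorProduct.tmul_zero, map_zero, LinearMap.zero_apply]
    | add w w' hw hw' => simp only [TensorProduct.tmul_add, map_add, LinearMap.add_apply, hw, hw']
    | tmul v w => rfl

variable {Z : LieAlg E G ⊗[ℝ] (LieAlg E G ⊗[ℝ] LieAlg E G)}
  {Φ : (PowerSeries (UEA₃ (LieAlg E G)))ˣ}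

theorem act₃_zero (hΦ : IsAssociator Z Φ) (f g h : D.Obs) :
    D.act₃ (twistedCoeff Φ 0) (f ⊗ₜ (g ⊗ₜ h)) = f ⊗ₜ (g ⊗ₜ h) := by
  rw [twistedCoeff, act₃_antipode, coeff_zero_inv Φ hΦ.coeff_zero,
    Algebra.TensorProduct.one_def, Algebra.TensorProduct.one_def, TensorProduct.map_tmul,
    TensorProduct.map_tmul, orbitMap_one, orbitMap_one, orbitMap_one]

theorem act₃_one (hΦ : IsAssociator Z Φ) (t : D.Obs ⊗[ℝ] (D.Obs ⊗[ℝ] D.Obs)) :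
    D.act₃ (twistedCoeff Φ 1) t = 0 := by
  rw [twistedCoeff, coeff_one_inv Φ hΦ.coeff_zero hΦ.coeff_one, map_zero, map_zero,
    LinearMap.zero_apply]

/-- Linear functions are killed by `𝔤`, so that the counit axiom applies in their factor. -/
theorem act₃_lin₁ (hΦ : IsAssociator Z Φ) (k : ℕ) (y : F) (g h : D.Obs) :
    D.act₃ (twistedCoeff Φ k) (lin y ⊗ₜ (g ⊗ₜ h)) = if k = 0 then lin y ⊗ₜ (g ⊗ₜ h) else 0 := by
  rw [twistedCoeff, act₃_antipode, orbitMap_lin]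
  have e : TensorProduct.map (LinearMap.toSpanSingleton ℝ D.Obs (lin y) ∘ₗ
        (counit (LieAlg E G)).toLinearMap) (TensorProduct.map (D.orbitMap g) (D.orbitMap h)) =
      TensorProduct.map (LinearMap.toSpanSingleton ℝ D.Obs (lin y))
        (TensorProduct.map (D.orbitMap g) (D.orbitMap h)) ∘ₗ
      TensorProduct.map (counit (LieAlg E G)).toLinearMap
        (TensorProduct.map LinearMap.id LinearMap.id) := by
    rw [← TensorProduct.map_comp, ← TensorProduct.map_comp]
    rfl
  rw [e, LinearMap.comp_apply, hΦ.counit₁_inv]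
  split_ifs
  · rw [TensorProduct.map_tmul, TensorProduct.map_tmul, orbitMap_one, orbitMap_one,
      LinearMap.toSpanSingleton_apply, one_smul]
  · rw [map_zero]

theorem act₃_lin₂ (hΦ : IsAssociator Z Φ) (k : ℕ) (y : F) (f h : D.Obs) :
    D.act₃ (twistedCoeff Φ k) (f ⊗ₜ (lin y ⊗ₜ h)) = if k = 0 then f ⊗ₜ (lin y ⊗ₜ h) else 0 := by
  rw [twistedCoeff, act₃_antipode, orbitMap_lin]
  have e : TensorProduct.map (D.orbitMap f) (TensorProduct.map
        (LinearMap.toSpanSingleton ℝ D.Obs (lin y) ∘ₗ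
        (counit (LieAlg E G)).toLinearMap) (D.orbitMap h)) =
      TensorProduct.map (D.orbitMap f) (TensorProduct.map
        (LinearMap.toSpanSingleton ℝ D.Obs (lin y)) (D.orbitMap h)) ∘ₗ
      TensorProduct.map LinearMap.id
        (TensorProduct.map (counit (LieAlg E G)).toLinearMap LinearMap.id) := by
    rw [← TensorProduct.map_comp, ← TensorProduct.map_comp]
    rfl
  rw [e, LinearMap.comp_apply, hΦ.counit₂_inv]
  split_ifs
  · rw [TensorProduct.map_tmul, TensorProduct.map_tmul, orbitMap_one, orbitMap_one,
      LinearMap.toSpanSingleton_apply, one_smul]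
  · rw [map_zero]

theorem act₃_lin₃ (hΦ : IsAssociator Z Φ) (k : ℕ) (y : F) (f g : D.Obs) :
    D.act₃ (twistedCoeff Φ k) (f ⊗ₜ (g ⊗ₜ lin y)) = if k = 0 then f ⊗ₜ (g ⊗ₜ lin y) else 0 := by
  rw [twistedCoeff, act₃_antipode, orbitMap_lin]
  have e : TensorProduct.map (D.orbitMap f) (TensorProduct.map (D.orbitMap g)
        (LinearMap.toSpanSingleton ℝ D.Obs (lin y) ∘ₗ
        (counit (LieAlg E G)).toLinearMap)) =
      TensorProduct.map (D.orbitMap f) (TensorProduct.map (D.orbitMap g)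
        (LinearMap.toSpanSingleton ℝ D.Obs (lin y))) ∘ₗ
      TensorProduct.map LinearMap.id
        (TensorProduct.map LinearMap.id (counit (LieAlg E G)).toLinearMap) := by
    rw [← TensorProduct.map_comp, ← TensorProduct.map_comp]
    rfl
  rw [e, LinearMap.comp_apply, hΦ.counit₃_inv]
  split_ifs
  · rw [TensorProduct.map_tmul, TensorProduct.map_tmul, orbitMap_one, orbitMap_one,
      LinearMap.toSpanSingleton_apply, one_smul]
  · rw [map_zero]

end Base

end Action

/-! ### Splitting of invariant cocycles -/

section Alternation

variable {A : Type*} [CommRing A] [Algebra ℝ A]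

theorem IsCocycle.flip {C : A →ₗ[ℝ] A →ₗ[ℝ] A} (h : IsCocycle C) : IsCocycle C.flip :=
  fun f g k => by
  simp only [LinearMap.flip_apply]
  have := h k g f
  rw [mul_comm g f, mul_comm k g] at this
  linear_combination -this

/-- The skew-symmetric part of a Hochschild cocycle of a commutative algebra is a biderivation. -/
theorem IsCocycle.sub_flip_mul {C : A →ₗ[ℝ] A →ₗ[ℝ] A} (hC : IsCocycle C) (f g h : A) :
    C f (g * h) - C (g * h) f = g * (C f h - C h f) + h * (C f g - C g f) := by
  have h1 := hC f g h
  have h2 := hC g h f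
  have h3 := hC g f h
  rw [mul_comm g f] at h3
  rw [mul_comm h f] at h2
  linear_combination h1 - h3 + h2

end Alternation

section Splitting

variable {F E H G : Type*} [NormedAddCommGroup F] [NormedSpace ℝ F] [FiniteDimensional ℝ F]
  [NormedAddCommGroup E] [NormedSpace ℝ E] [FiniteDimensional ℝ E]
  [TopologicalSpace H] [ChartedSpace F H] [Group H] [LieGroup 𝓘(ℝ, F) ∞ H]
  [TopologicalSpace G] [ChartedSpace E G] [Group G] [LieGroup 𝓘(ℝ, E) ∞ G]
  [T2Space G] (D : Base F E H G)

namespace Base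

theorem mulLeft_mem_diff (c : D.Obs) : LinearMap.mulLeft ℝ c ∈ D.Diff :=
  Algebra.subset_adjoin (Or.inl ⟨c, rfl⟩)

theorem derivation_mem_diff (X : Derivation ℝ D.Obs D.Obs) : (X : Module.End ℝ D.Obs) ∈ D.Diff :=
  Algebra.subset_adjoin (Or.inr ⟨X, rfl⟩)

theorem smul_mem_diff (c : D.Obs) {P : Module.End ℝ D.Obs} (hP : P ∈ D.Diff) : c • P ∈ D.Diff :=
  Subalgebra.mul_mem _ (D.mulLeft_mem_diff c) hP

theorem exists_mem_ordLT {P : Module.End ℝ D.Obs} (hP : P ∈ D.Diff) : ∃ k, P ∈ ordLT D.Obs k := by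
  induction hP using Algebra.adjoin_induction with
  | mem P hP =>
    obtain ⟨c, rfl⟩ | ⟨X, rfl⟩ := hP
    · exact ⟨1, smul_one_mem_ordLT c⟩
    · exact ⟨2, derivation_mem_ordLT X⟩
  | algebraMap c =>
    refine ⟨1, ?_⟩
    have : algebraMap ℝ (Module.End ℝ D.Obs) c = (algebraMap ℝ D.Obs c) • 1 := by
      ext1 f
      rw [Module.algebraMap_end_apply, Algebra.smul_def]
      rfl
    rw [this]
    exact smul_one_mem_ordLT _
  | add P Q _ _ hP hQ =>
    obtain ⟨j, hj⟩ := hP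
    obtain ⟨k, hk⟩ := hQ
    exact ⟨j + k, Submodule.add_mem _ (ordLT_mono (by omega) hj) (ordLT_mono (by omega) hk)⟩
  | mul P Q _ _ hP hQ =>
    obtain ⟨j, hj⟩ := hP
    obtain ⟨k, hk⟩ := hQ
    exact ⟨j + k, mul_mem_ordLT hj hk⟩

theorem exists_forall_mem_ordLT {C : D.Obs →ₗ[ℝ] D.Obs →ₗ[ℝ] D.Obs} (hC : C ∈ D.Bidiff) :
    ∃ k, ∀ f, C f ∈ ordLT D.Obs k := by
  induction hC using Submodule.span_induction with
  | mem C hC =>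
    obtain ⟨P, hP, Q, hQ, rfl⟩ := hC
    obtain ⟨k, hk⟩ := D.exists_mem_ordLT hQ
    exact ⟨k, fun f => Submodule.smul_mem _ (P f) hk⟩
  | zero => exact ⟨0, fun f => Submodule.zero_mem _⟩
  | add C C' _ _ h h' =>
    obtain ⟨j, hj⟩ := h
    obtain ⟨k, hk⟩ := h'
    exact ⟨j + k, fun f => Submodule.add_mem _ (ordLT_mono (by omega) (hj f))
      (ordLT_mono (by omega) (hk f))⟩
  | smul c C _ h =>
    obtain ⟨k, hk⟩ := h
    refine ⟨k, fun f => ?_⟩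
    have : (c • C) f = algebraMap ℝ D.Obs c • C f := by
      ext1 g
      change c • C f g = algebraMap ℝ D.Obs c * C f g
      rw [Algebra.smul_def]
    rw [this]
    exact Submodule.smul_mem _ _ (hk f)

theorem symOp_mem_diff {ι : Type*} [Fintype ι] (e : ι → Derivation ℝ D.Obs D.Obs) (k : ℕ)
    (T : List ι → D.Obs) : symOp e k T ∈ D.Diff := by
  induction k generalizing T with
  | zero => exact D.smul_mem_diff _ (Subalgebra.one_mem _)
  | succ k ih =>
    rw [symOp_succ]
    exact Subalgebra.sum_mem _ fun i _ => Subalgebra.mul_mem _ (ih _) (D.derivation_mem_diff _)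

theorem normalOps_le_diff {ι : Type*} [Fintype ι] [DecidableEq ι]
    (b : Module.Basis ι D.Obs (Derivation ℝ D.Obs D.Obs)) {k : ℕ} {P : Module.End ℝ D.Obs}
    (hP : P ∈ normalOps b k) : P ∈ D.Diff := by
  induction k generalizing P with
  | zero =>
    rw [show P = 0 from hP]
    exact Subalgebra.zero_mem _
  | succ k ih =>
    obtain ⟨Q, hQ, rfl | ⟨-, T, -, rfl⟩⟩ := mem_normalOps_succ b hP
    · exact ih hQ
    · exact Subalgebra.add_mem _ (ih hQ) (D.symOp_mem_diff _ _ _)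

theorem flip_mem_bidiff {C : D.Obs →ₗ[ℝ] D.Obs →ₗ[ℝ] D.Obs} (hC : C ∈ D.Bidiff) :
    C.flip ∈ D.Bidiff := by
  induction hC using Submodule.span_induction with
  | mem C hC =>
    obtain ⟨P, hP, Q, hQ, rfl⟩ := hC
    refine Submodule.subset_span ⟨Q, hQ, P, hP, ?_⟩
    ext1 f
    ext1 g
    exact mul_comm _ _
  | zero => exact Submodule.zero_mem _
  | add C C' _ _ h h' => exact Submodule.add_mem _ h h'
  | smul c C _ h => exact Submodule.smul_mem _ c h

theorem compl₁₂_mem_bidiff {C : D.Obs →ₗ[ℝ] D.Obs →ₗ[ℝ] D.Obs} (hC : C ∈ D.Bidiff)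
    {R S : Module.End ℝ D.Obs} (hR : R ∈ D.Diff) (hS : S ∈ D.Diff) :
    C.compl₁₂ R S ∈ D.Bidiff := by
  induction hC using Submodule.span_induction with
  | mem C hC =>
    obtain ⟨P, hP, Q, hQ, rfl⟩ := hC
    exact Submodule.subset_span ⟨P * R, Subalgebra.mul_mem _ hP hR, Q * S,
      Subalgebra.mul_mem _ hQ hS, rfl⟩
  | zero => exact Submodule.zero_mem _
  | add C C' _ _ h h' => exact Submodule.add_mem _ h h'
  | smul c C _ h => exact Submodule.smul_mem _ c h

theorem compr₂_mem_bidiff {P : Module.End ℝ D.Obs} (hP : P ∈ D.Diff)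
    {C : D.Obs →ₗ[ℝ] D.Obs →ₗ[ℝ] D.Obs} (hC : C ∈ D.Bidiff) : C.compr₂ P ∈ D.Bidiff := by
  induction hP using Algebra.adjoin_induction generalizing C with
  | mem P hP =>
    induction hC using Submodule.span_induction with
    | mem C hC =>
      obtain ⟨R, hR, S, hS, rfl⟩ := hC
      obtain ⟨c, rfl⟩ | ⟨X, rfl⟩ := hP
      · refine Submodule.subset_span ⟨_, Subalgebra.mul_mem _ (D.mulLeft_mem_diff c) hR, S, hS, ?_⟩
        ext1 f
        ext1 g
        exact (mul_assoc _ _ _).symm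
      · have : ((LinearMap.mul ℝ D.Obs).compl₁₂ R S).compr₂ (X : Module.End ℝ D.Obs) =
            (LinearMap.mul ℝ D.Obs).compl₁₂ ((X : Module.End ℝ D.Obs) * R) S +
            (LinearMap.mul ℝ D.Obs).compl₁₂ R ((X : Module.End ℝ D.Obs) * S) := by
          ext1 f
          ext1 g
          change X (R f * S g) = X (R f) * S g + R f * X (S g)
          rw [Derivation.leibniz, smul_eq_mul, smul_eq_mul]
          ring
        rw [this]
        exact Submodule.add_mem _
          (Submodule.subset_span ⟨_, Subalgebra.mul_mem _ (D.derivation_mem_diff X) hR, S, hS, rfl⟩)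
          (Submodule.subset_span ⟨R, hR, _, Subalgebra.mul_mem _ (D.derivation_mem_diff X) hS, rfl⟩)
    | zero => 
      convert Submodule.zero_mem D.Bidiff
      ext1 f
      ext1 g
      exact map_zero P
    | add C C' _ _ h h' =>
      convert Submodule.add_mem _ h h' using 1
      ext1 f
      ext1 g
      exact map_add P _ _
    | smul c C _ h =>
      convert Submodule.smul_mem _ c h using 1
      ext1 f
      ext1 g
      exact map_smul P _ _
  | algebraMap c => exact Submodule.smul_mem _ c hC
  | add P Q _ _ h h' => exact Submodule.add_mem _ (h hC) (h' hC)
  | mul P Q _ _ h h' => exact h (h' hC)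

theorem rightPull_lin (x : H) (y : F) : D.rightPull x (lin y) = lin (Ad F x y) := rfl

theorem lin_add (y z : F) : (lin (y + z) : D.Obs) = lin y + lin z := by
  ext m
  exact map_add (m.1 : StrongDual ℝ F) y z

theorem lin_smul (c : ℝ) (y : F) : (lin (c • y) : D.Obs) = c • lin y := by
  ext m
  exact map_smul (m.1 : StrongDual ℝ F) c y

/-- The embedding of `𝔥` as the linear functions. -/
noncomputable def linMap : F →ₗ[ℝ] D.Obs where
  toFun := lin
  map_add' := D.lin_add
  map_smul' := D.lin_smul

/-- The vector field in the directions of `𝔥*` which agrees with `P` on linear functions. -/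
noncomputable def linPart (P : Module.End ℝ D.Obs) : Derivation ℝ D.Obs D.Obs :=
  ∑ i, P (lin (hBasis F i)) • dirDer (hDual F i)

theorem linPart_apply (P : Module.End ℝ D.Obs) (f : D.Obs) :
    D.linPart P f = ∑ i, P (lin (hBasis F i)) * dirField (hDual F i) f := by
  rw [linPart, ← Derivation.coeFnAddMonoidHom_apply, map_sum, Finset.sum_apply]
  rfl

theorem linPart_lin (P : Module.End ℝ D.Obs) (y : F) : D.linPart P (lin y) = P (lin y) := by
  rw [linPart_apply]
  conv_rhs => rw [← (hBasis F).sum_repr y]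
  change _ = (P ∘ₗ D.linMap) _
  rw [map_sum]
  refine Finset.sum_congr rfl fun i _ => ?_
  rw [dirField_lin, map_smul, Algebra.smul_def, mul_comm]
  rfl

theorem invariant_linPart [T2Space H] {P : Module.End ℝ D.Obs} (hP : D.Invariant P) :
    D.Invariant (D.linPart P : Module.End ℝ D.Obs) := by
  constructor
  · intro a f
    change D.linPart P (leftPull a f) = leftPull a (D.linPart P f)
    rw [linPart_apply, linPart_apply, map_sum]
    refine Finset.sum_congr rfl fun i _ => ?_
    change _ = leftPull a (P (lin (hBasis F i))) * leftPull a (dirField (hDual F i) f)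
    rw [← hP.1]
    rfl
  · intro x f
    change D.linPart P (D.rightPull x f) = D.rightPull x (D.linPart P f)
    have e : ∀ j, P (lin (hBasis F j)) =
        ∑ i, hDual F i (Ad F x⁻¹ (hBasis F j)) • D.rightPull x (P (lin (hBasis F i))) := by
      intro j
      have h1 : hBasis F j = Ad F x (Ad F x⁻¹ (hBasis F j)) := by
        rw [← ContinuousLinearMap.comp_apply (Ad F x), ← Ad_mul, mul_inv_cancel, Ad_one]
        rfl
      conv_lhs => rw [h1, ← D.rightPull_lin, hP.2, ← (hBasis F).sum_repr (Ad F x⁻¹ (hBasis F j))]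
      change (D.rightPull x ∘ₗ P ∘ₗ D.linMap) _ = _
      rw [map_sum]
      exact Finset.sum_congr rfl fun i _ => map_smul _ _ _
    rw [linPart_apply, linPart_apply, map_sum]
    have h2 : ∀ i, D.rightPull x (P (lin (hBasis F i)) * dirField (hDual F i) f) =
        ∑ j, (hDual F i (Ad F x⁻¹ (hBasis F j)) • D.rightPull x (P (lin (hBasis F i)))) *
          dirField (hDual F j) (D.rightPull x f) := by
      intro i
      change D.rightPull x (P (lin (hBasis F i))) * D.rightPull x (dirField (hDual F i) f) = _
      rw [rightPull_dirField, dirField_eq_sum, Finset.mul_sum]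
      refine Finset.sum_congr rfl fun j _ => ?_
      rw [mul_smul_comm, smul_mul_assoc]
      rfl
    simp only [h2]
    rw [Finset.sum_comm]
    refine Finset.sum_congr rfl fun j _ => ?_
    rw [e j, Finset.sum_mul]

theorem Invariant.sub {P Q : Module.End ℝ D.Obs} (hP : D.Invariant P) (hQ : D.Invariant Q) :
    D.Invariant (P - Q) :=
  ⟨fun a f => by rw [LinearMap.sub_apply, LinearMap.sub_apply, hP.1, hQ.1, map_sub],
    fun x f => by rw [LinearMap.sub_apply, LinearMap.sub_apply, hP.2, hQ.2, map_sub]⟩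

/-- An invariant bidifferential Hochschild cocycle is the sum of its skew-symmetric part and the
coboundary of an invariant differential operator which kills the linear functions. -/
theorem exists_split [T2Space H] {C : D.Obs →ₗ[ℝ] D.Obs →ₗ[ℝ] D.Obs} (hC : C ∈ D.Bidiff)
    (hc : IsCocycle C) (hi : D.Invariant₂ C) :
    ∃ P ∈ D.Diff, D.Invariant P ∧ (∀ y : F, P (lin y) = 0) ∧
      ∀ f g, C f g = (1 / 2 : ℝ) • (C f g - C g f) + D.hoch P f g := by
  classical
  obtain ⟨b, hb⟩ := exists_basis_eq_frame F E G D.U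
  let S : D.Obs →ₗ[ℝ] D.Obs →ₗ[ℝ] D.Obs := (1 / 2 : ℝ) • (C + C.flip)
  have hS : ∀ f g, S f g = (1 / 2 : ℝ) • (C f g + C g f) := fun f g => rfl
  have hSc : IsCocycle S := fun f g h => by
    have := (hc.add hc.flip) f g h
    simp only [S, LinearMap.smul_apply, mul_smul_comm, smul_mul_assoc, ← smul_sub, ← smul_add]
    rw [this, smul_zero]
  obtain ⟨m, hm⟩ := D.exists_forall_mem_ordLT
    (Submodule.smul_mem _ (1 / 2 : ℝ) (Submodule.add_mem _ hC (D.flip_mem_bidiff hC)))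
  obtain ⟨P, hP, hSP⟩ := exists_hochMap_eq b S hSc (fun f g => by rw [hS, hS, add_comm]) hm
  have hd := D.normalOps_le_diff b hP
  have hPi : D.Invariant P := by
    constructor
    · intro a f
      refine Eq.symm (map_apply_of_hochMap_invariant (A := D.Obs) (D.leftEquiv a) (fun i j => if i = j then 1 else 0)
        (fun i f => ?_) hP (fun f g => ?_) f)
      · rw [hb, leftEquiv_apply, leftPull_frame]
        simp [leftEquiv_apply]
      · simp only [← hSP, leftEquiv_apply, hS, map_smul, map_add, hi.1]
    · intro x f
      obtain ⟨t, ht⟩ := D.exists_rightPull_frame x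
      refine Eq.symm (map_apply_of_hochMap_invariant (A := D.Obs) (D.rightEquiv x) t
        (fun i f => ?_) hP (fun f g => ?_) f)
      · rw [hb]
        exact ht i f
      · simp only [← hSP, rightEquiv_apply, hS, map_smul, map_add, hi.2]
  -- the coboundary of a derivation vanishes, which leaves the freedom to correct `P` by one
  refine ⟨P - (D.linPart P : Module.End ℝ D.Obs), Subalgebra.sub_mem _ hd (D.derivation_mem_diff _),
    hPi.sub D (D.invariant_linPart hPi), fun y => ?_, fun f g => ?_⟩
  · change P (lin y) - D.linPart P (lin y) = 0
    rw [linPart_lin, sub_self]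
  · have h1 : D.hoch (P - (D.linPart P : Module.End ℝ D.Obs)) f g = S f g := by
      rw [hSP, hochMap_apply]
      change f * (P g - D.linPart P g) - (P (f * g) - D.linPart P (f * g)) +
        (P f - D.linPart P f) * g = _
      rw [Derivation.leibniz, smul_eq_mul, smul_eq_mul]
      ring
    rw [h1, hS, ← smul_add, sub_add_add_cancel, ← two_smul ℝ (C f g), smul_smul]
    norm_num

end Base

end Splitting

/-! ### Formal series of linear maps -/

section Convolution

open Finset.HasAntidiagonal

variable {X Y Z W X' Y' Z' W' V : Type*} [AddCommGroup X] [Module ℝ X] [AddCommGroup Y] [Module ℝ Y]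
  [AddCommGroup Z] [Module ℝ Z] [AddCommGroup W] [Module ℝ W]
  [AddCommGroup X'] [Module ℝ X'] [AddCommGroup Y'] [Module ℝ Y']
  [AddCommGroup Z'] [Module ℝ Z'] [AddCommGroup W'] [Module ℝ W'] [AddCommGroup V] [Module ℝ V]

/-- The product of the formal power series `∑ ħ^k x_k` and `∑ ħ^k y_k` with respect to a bilinear
map `β`. Formal series are encoded by the sequences of their coefficients. -/
noncomputable def conv (β : X →ₗ[ℝ] Y →ₗ[ℝ] Z) (x : ℕ → X) (y : ℕ → Y) (N : ℕ) : Z :=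
  ∑ p ∈ antidiagonal N, β (x p.1) (y p.2)

theorem conv_add_left (β : X →ₗ[ℝ] Y →ₗ[ℝ] Z) (x x' : ℕ → X) (y : ℕ → Y) :
    conv β (x + x') y = conv β x y + conv β x' y := by
  ext N
  simp only [conv, Pi.add_apply, map_add, LinearMap.add_apply, Finset.sum_add_distrib]

theorem conv_add_right (β : X →ₗ[ℝ] Y →ₗ[ℝ] Z) (x : ℕ → X) (y y' : ℕ → Y) :
    conv β x (y + y') = conv β x y + conv β x y' := by
  ext N
  simp only [conv, Pi.add_apply, map_add, Finset.sum_add_distrib]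

theorem conv_sub_left (β : X →ₗ[ℝ] Y →ₗ[ℝ] Z) (x x' : ℕ → X) (y : ℕ → Y) :
    conv β (x - x') y = conv β x y - conv β x' y := by
  ext N
  simp only [conv, Pi.sub_apply, map_sub, LinearMap.sub_apply, Finset.sum_sub_distrib]

theorem conv_sub_right (β : X →ₗ[ℝ] Y →ₗ[ℝ] Z) (x : ℕ → X) (y y' : ℕ → Y) :
    conv β x (y - y') = conv β x y - conv β x y' := by
  ext N
  simp only [conv, Pi.sub_apply, map_sub, Finset.sum_sub_distrib]

theorem conv_assoc (β₁ : Z →ₗ[ℝ] W →ₗ[ℝ] V) (β₂ : X →ₗ[ℝ] Y →ₗ[ℝ] Z) (β₃ : X →ₗ[ℝ] X' →ₗ[ℝ] V)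
    (β₄ : Y →ₗ[ℝ] W →ₗ[ℝ] X') (h : ∀ x y w, β₁ (β₂ x y) w = β₃ x (β₄ y w))
    (x : ℕ → X) (y : ℕ → Y) (w : ℕ → W) :
    conv β₁ (conv β₂ x y) w = conv β₃ x (conv β₄ y w) := by
  ext N
  simp only [conv, map_sum, LinearMap.sum_apply, h]
  rw [Finset.sum_sigma', Finset.sum_sigma']
  refine Finset.sum_nbij' (fun s => ⟨(s.2.1, s.2.2 + s.1.2), (s.2.2, s.1.2)⟩)
    (fun s => ⟨(s.1.1 + s.2.1, s.2.2), (s.1.1, s.2.1)⟩) ?_ ?_ ?_ ?_ ?_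
  all_goals
    simp only [Finset.mem_sigma, mem_antidiagonal]
    rintro ⟨⟨a, b⟩, ⟨c, d⟩⟩ ⟨h1, h2⟩
    simp only at h1 h2 ⊢
  · exact ⟨by omega, trivial⟩
  · exact ⟨by omega, trivial⟩
  · subst h2; rfl
  · subst h2; rfl

theorem conv_comm (β : X →ₗ[ℝ] Y →ₗ[ℝ] Z) (β' : Y →ₗ[ℝ] X →ₗ[ℝ] Z) (x : ℕ → X) (y : ℕ → Y)
    (h : ∀ j k, β (x j) (y k) = β' (y k) (x j)) : conv β x y = conv β' y x := by
  ext N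
  simp only [conv, h]
  exact Finset.Nat.sum_antidiagonal_swap (f := fun p => β' (y p.1) (x p.2))

theorem sum_antidiagonal_interchange (φ : ℕ → ℕ → ℕ → ℕ → V) (N : ℕ) :
    ∑ p ∈ antidiagonal N, ∑ q ∈ antidiagonal p.1, ∑ s ∈ antidiagonal p.2, φ q.1 q.2 s.1 s.2 =
      ∑ p ∈ antidiagonal N, ∑ q ∈ antidiagonal p.1, ∑ s ∈ antidiagonal p.2,
        φ q.1 s.1 q.2 s.2 := by
  simp only [← Finset.sum_product', Finset.sum_sigma']
  refine Finset.sum_nbij' (fun s => ⟨(s.2.1.1 + s.2.2.1, s.2.1.2 + s.2.2.2),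
      ((s.2.1.1, s.2.2.1), (s.2.1.2, s.2.2.2))⟩)
    (fun s => ⟨(s.2.1.1 + s.2.2.1, s.2.1.2 + s.2.2.2),
      ((s.2.1.1, s.2.2.1), (s.2.1.2, s.2.2.2))⟩) ?_ ?_ ?_ ?_ ?_
  all_goals
    simp only [Finset.mem_sigma, mem_antidiagonal, Finset.mem_product]
    rintro ⟨⟨a, b⟩, ⟨c, d⟩, ⟨e, f⟩⟩ ⟨h1, h2, h3⟩
    simp only at h1 h2 h3 ⊢
  · exact ⟨by omega, trivial, trivial⟩
  · exact ⟨by omega, trivial, trivial⟩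
  · subst h2 h3; rfl
  · subst h2 h3; rfl

/-- The interchange law for products of four series. -/
theorem conv_interchange (β₁ : Z →ₗ[ℝ] Z' →ₗ[ℝ] V) (β₂ : X →ₗ[ℝ] Y →ₗ[ℝ] Z)
    (β₃ : X' →ₗ[ℝ] Y' →ₗ[ℝ] Z') (β₄ : W →ₗ[ℝ] W' →ₗ[ℝ] V) (β₅ : X →ₗ[ℝ] X' →ₗ[ℝ] W)
    (β₆ : Y →ₗ[ℝ] Y' →ₗ[ℝ] W')
    (h : ∀ x y x' y', β₁ (β₂ x y) (β₃ x' y') = β₄ (β₅ x x') (β₆ y y'))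
    (x : ℕ → X) (y : ℕ → Y) (x' : ℕ → X') (y' : ℕ → Y') :
    conv β₁ (conv β₂ x y) (conv β₃ x' y') = conv β₄ (conv β₅ x x') (conv β₆ y y') := by
  ext N
  simp only [conv, map_sum, LinearMap.sum_apply, h]
  have e := sum_antidiagonal_interchange
    (fun a b c d => β₄ (β₅ (x a) (x' c)) (β₆ (y b) (y' d))) N
  refine Eq.trans ?_ (e.trans ?_)
  · exact Finset.sum_congr rfl fun p _ => Finset.sum_comm
  · exact Finset.sum_congr rfl fun p _ => Finset.sum_comm

theorem conv_single_left (β : X →ₗ[ℝ] Y →ₗ[ℝ] Z) (k : ℕ) (x : X) (y : ℕ → Y) (N : ℕ) :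
    conv β (Pi.single k x) y N = if k ≤ N then β x (y (N - k)) else 0 := by
  rw [conv]
  split_ifs with h
  · rw [Finset.sum_eq_single (k, N - k)]
    · rw [Pi.single_eq_same]
    · rintro ⟨a, b⟩ hab hne
      rw [mem_antidiagonal] at hab
      have : a ≠ k := fun hk => hne (by subst hk; ext <;> simp; simp at hab; omega)
      rw [Pi.single_eq_of_ne this, map_zero, LinearMap.zero_apply]
    · intro h'
      exact absurd (mem_antidiagonal.2 (by omega)) h'
  · refine Finset.sum_eq_zero ?_
    rintro ⟨a, b⟩ hab
    rw [mem_antidiagonal] at hab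
    have : a ≠ k := by simp at hab; omega
    rw [Pi.single_eq_of_ne this, map_zero, LinearMap.zero_apply]

theorem conv_flip (β : X →ₗ[ℝ] Y →ₗ[ℝ] Z) (x : ℕ → X) (y : ℕ → Y) :
    conv β x y = conv β.flip y x := conv_comm _ _ _ _ fun _ _ => rfl

theorem conv_single_right (β : X →ₗ[ℝ] Y →ₗ[ℝ] Z) (k : ℕ) (x : ℕ → X) (y : Y) (N : ℕ) :
    conv β x (Pi.single k y) N = if k ≤ N then β (x (N - k)) y else 0 := by
  rw [conv_flip, conv_single_left]
  rfl

theorem conv_single_single (β : X →ₗ[ℝ] Y →ₗ[ℝ] Z) (j k : ℕ) (x : X) (y : Y) :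
    conv β (Pi.single j x) (Pi.single k y) = Pi.single (j + k) (β x y) := by
  ext N
  rw [conv_single_left]
  split_ifs with h
  · by_cases h' : N = j + k
    · subst h'
      simp
    · rw [Pi.single_eq_of_ne h', Pi.single_eq_of_ne (by omega), map_zero]
  · rw [Pi.single_eq_of_ne (by omega)]

theorem conv_of_left_eq_zero (β : X →ₗ[ℝ] Y →ₗ[ℝ] Z) {n : ℕ} {x : ℕ → X} (h : ∀ k ≤ n, x k = 0)
    (y : ℕ → Y) : conv β x y (n + 1) = β (x (n + 1)) (y 0) := by
  rw [conv, Finset.sum_eq_single (n + 1, 0)]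
  · rintro ⟨a, b⟩ hab hne
    rw [mem_antidiagonal] at hab
    rw [h a, map_zero, LinearMap.zero_apply]
    by_contra hlt
    exact hne (by ext <;> simp at hab ⊢ <;> omega)
  · intro h'
    exact absurd (mem_antidiagonal.2 (by simp)) h'

theorem conv_of_left_eq_zero_succ (β : X →ₗ[ℝ] Y →ₗ[ℝ] Z) {n : ℕ} {x : ℕ → X}
    (h : ∀ k ≤ n, x k = 0) (y : ℕ → Y) :
    conv β x y (n + 2) = β (x (n + 2)) (y 0) + β (x (n + 1)) (y 1) := by
  rw [conv, Finset.sum_eq_add (a := (n + 2, 0)) (b := (n + 1, 1)) (by simp)]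
  · rintro ⟨a, b⟩ hab hne
    rw [mem_antidiagonal] at hab
    rw [h a, map_zero, LinearMap.zero_apply]
    by_contra hlt
    simp only [ne_eq, Prod.mk.injEq, not_and] at hne hab
    omega
  · intro h'
    exact absurd (mem_antidiagonal.2 (by simp)) h'
  · intro h'
    exact absurd (mem_antidiagonal.2 (by simp)) h'

theorem conv_of_right_eq_zero (β : X →ₗ[ℝ] Y →ₗ[ℝ] Z) {n : ℕ} (x : ℕ → X) {y : ℕ → Y}
    (h : ∀ k ≤ n, y k = 0) : conv β x y (n + 1) = β (x 0) (y (n + 1)) := by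
  rw [conv_flip, conv_of_left_eq_zero _ h]
  rfl

theorem conv_of_right_eq_zero_succ (β : X →ₗ[ℝ] Y →ₗ[ℝ] Z) {n : ℕ} (x : ℕ → X) {y : ℕ → Y}
    (h : ∀ k ≤ n, y k = 0) :
    conv β x y (n + 2) = β (x 0) (y (n + 2)) + β (x 1) (y (n + 1)) := by
  rw [conv_flip, conv_of_left_eq_zero_succ _ h]
  rfl

theorem conv_one (β : X →ₗ[ℝ] Y →ₗ[ℝ] Z) (x : ℕ → X) (y : ℕ → Y) :
    conv β x y 1 = β (x 0) (y 1) + β (x 1) (y 0) := by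
  rw [conv, Finset.Nat.antidiagonal_succ]
  simp

theorem conv_eq_zero_of_left (β : X →ₗ[ℝ] Y →ₗ[ℝ] Z) {n : ℕ} {x : ℕ → X} (h : ∀ k ≤ n, x k = 0)
    (y : ℕ → Y) : ∀ k ≤ n, conv β x y k = 0 := by
  intro k hk
  refine Finset.sum_eq_zero fun p hp => ?_
  rw [mem_antidiagonal] at hp
  rw [h p.1 (by omega), map_zero, LinearMap.zero_apply]

theorem conv_eq_zero_of_right (β : X →ₗ[ℝ] Y →ₗ[ℝ] Z) {n : ℕ} (x : ℕ → X) {y : ℕ → Y}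
    (h : ∀ k ≤ n, y k = 0) : ∀ k ≤ n, conv β x y k = 0 := by
  rw [conv_flip]
  exact conv_eq_zero_of_left _ h _

theorem conv_congr (β : X →ₗ[ℝ] Y →ₗ[ℝ] Z) {n : ℕ} {x x' : ℕ → X} (h : ∀ k ≤ n, x k = x' k)
    (y : ℕ → Y) : ∀ k ≤ n, conv β x y k = conv β x' y k := by
  intro k hk
  refine Finset.sum_congr rfl fun p hp => ?_
  rw [mem_antidiagonal] at hp
  rw [h p.1 (by omega)]

/-- The composition of series of linear maps. -/
noncomputable def compS (S : ℕ → Y →ₗ[ℝ] Z) (T : ℕ → X →ₗ[ℝ] Y) : ℕ → X →ₗ[ℝ] Z :=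
  conv (LinearMap.llcomp ℝ X Y Z) S T

/-- The tensor product of series of linear maps. -/
noncomputable def tensS (S : ℕ → X →ₗ[ℝ] X') (T : ℕ → Y →ₗ[ℝ] Y') :
    ℕ → X ⊗[ℝ] Y →ₗ[ℝ] X' ⊗[ℝ] Y' :=
  conv (TensorProduct.mapBilinear (RingHom.id ℝ) X Y X' Y') S T

/-- A linear map as a constant series. -/
noncomputable def cstS (T : X →ₗ[ℝ] Y) : ℕ → X →ₗ[ℝ] Y := Pi.single 0 T

theorem compS_assoc (S : ℕ → Z →ₗ[ℝ] W) (T : ℕ → Y →ₗ[ℝ] Z) (R : ℕ → X →ₗ[ℝ] Y) :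
    compS (compS S T) R = compS S (compS T R) :=
  conv_assoc _ _ _ _ (fun _ _ _ => rfl) _ _ _

theorem cstS_compS (T : Y →ₗ[ℝ] Z) (S : ℕ → X →ₗ[ℝ] Y) (N : ℕ) :
    compS (cstS T) S N = T ∘ₗ S N := by
  rw [compS, cstS, conv_single_left, if_pos (Nat.zero_le _)]
  rfl

theorem compS_cstS (S : ℕ → Y →ₗ[ℝ] Z) (T : X →ₗ[ℝ] Y) (N : ℕ) :
    compS S (cstS T) N = S N ∘ₗ T := by
  rw [compS, cstS, conv_single_right, if_pos (Nat.zero_le _)]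
  rfl

theorem cstS_id_compS (S : ℕ → X →ₗ[ℝ] Y) : compS (cstS LinearMap.id) S = S :=
  funext fun N => cstS_compS _ _ N

theorem compS_cstS_id (S : ℕ → X →ₗ[ℝ] Y) : compS S (cstS LinearMap.id) = S :=
  funext fun N => compS_cstS _ _ N

theorem tensS_compS {X'' Y'' : Type*} [AddCommGroup X''] [Module ℝ X''] [AddCommGroup Y'']
    [Module ℝ Y''] (S : ℕ → X' →ₗ[ℝ] X'') (T : ℕ → Y' →ₗ[ℝ] Y'') (S' : ℕ → X →ₗ[ℝ] X')
    (T' : ℕ → Y →ₗ[ℝ] Y') :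
    compS (tensS S T) (tensS S' T') = tensS (compS S S') (compS T T') := by
  refine conv_interchange _ _ _ _ _ _ (fun a b c d => ?_) _ _ _ _
  apply TensorProduct.ext
  ext x y
  rfl

theorem tensS_cstS (S : X →ₗ[ℝ] X') (T : Y →ₗ[ℝ] Y') :
    tensS (cstS S) (cstS T) = cstS (TensorProduct.map S T) :=
  conv_single_single _ _ _ _ _

theorem tensS_cstS_left (S : X →ₗ[ℝ] X') (T : ℕ → Y →ₗ[ℝ] Y') (N : ℕ) :
    tensS (cstS S) T N = TensorProduct.map S (T N) := by
  rw [tensS, cstS, conv_single_left, if_pos (Nat.zero_le _)]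
  rfl

theorem tensS_cstS_right (S : ℕ → X →ₗ[ℝ] X') (T : Y →ₗ[ℝ] Y') (N : ℕ) :
    tensS S (cstS T) N = TensorProduct.map (S N) T := by
  rw [tensS, cstS, conv_single_right, if_pos (Nat.zero_le _)]
  rfl

/-- The associativity constraint is natural with respect to series of linear maps. -/
theorem tensS_assoc (S : ℕ → X →ₗ[ℝ] X') (T : ℕ → Y →ₗ[ℝ] Y') (R : ℕ → Z →ₗ[ℝ] Z') :
    compS (tensS (tensS S T) R) (cstS (TensorProduct.assoc ℝ X Y Z).symm.toLinearMap) =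
      compS (cstS (TensorProduct.assoc ℝ X' Y' Z').symm.toLinearMap) (tensS S (tensS T R)) := by
  ext1 N
  rw [cstS_compS, compS_cstS]
  apply TensorProduct.ext
  ext1 x
  apply TensorProduct.ext
  ext y z
  have h := congrFun (conv_assoc (TensorProduct.mk ℝ (X' ⊗[ℝ] Y') Z') (TensorProduct.mk ℝ X' Y')
    ((TensorProduct.mk ℝ X' (Y' ⊗[ℝ] Z')).compr₂
      (TensorProduct.assoc ℝ X' Y' Z').symm.toLinearMap)
    (TensorProduct.mk ℝ Y' Z') (fun _ _ _ => rfl) (fun a => S a x) (fun a => T a y)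
    (fun a => R a z)) N
  refine Eq.trans ?_ (h.trans ?_)
  · change (conv _ (conv _ S T) R N : (X ⊗[ℝ] Y) ⊗[ℝ] Z →ₗ[ℝ] _) ((x ⊗ₜ y) ⊗ₜ z) = _
    simp only [conv, map_sum, LinearMap.sum_apply]
    rfl
  · change _ = (TensorProduct.assoc ℝ X' Y' Z').symm
      ((conv _ S (conv _ T R) N : X ⊗[ℝ] (Y ⊗[ℝ] Z) →ₗ[ℝ] _) (x ⊗ₜ (y ⊗ₜ z)))
    simp only [conv, map_sum, LinearMap.sum_apply]
    rfl

end Convolution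

/-! ### Products which are associative up to a series of operators -/

section AbstractStarProducts

open Finset.HasAntidiagonal

variable {A : Type*} [CommRing A] [Algebra ℝ A]

/-- The series of linear maps `A ⊗ A → A` of a star-product. -/
noncomputable def mulS (C : ℕ → A →ₗ[ℝ] A →ₗ[ℝ] A) : ℕ → A ⊗[ℝ] A →ₗ[ℝ] A :=
  fun k => TensorProduct.lift (C k)

/-- `m ⊗ id`, on `A ⊗ (A ⊗ A)`. -/
noncomputable def leftS (m : ℕ → A ⊗[ℝ] A →ₗ[ℝ] A) : ℕ → A ⊗[ℝ] (A ⊗[ℝ] A) →ₗ[ℝ] A ⊗[ℝ] A :=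
  compS (tensS m (cstS LinearMap.id)) (cstS (TensorProduct.assoc ℝ A A A).symm.toLinearMap)

/-- `(id ⊗ m) ∘ Θ`. -/
noncomputable def rightS (Θ : ℕ → Module.End ℝ (A ⊗[ℝ] (A ⊗[ℝ] A))) (m : ℕ → A ⊗[ℝ] A →ₗ[ℝ] A) :
    ℕ → A ⊗[ℝ] (A ⊗[ℝ] A) →ₗ[ℝ] A ⊗[ℝ] A :=
  compS (tensS (cstS LinearMap.id) m) Θ

/-- Associativity of the product `∑ ħ^k C_k` up to the series `Θ` of operators on `A ⊗ A ⊗ A`. -/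
def IsAssoc (Θ : ℕ → Module.End ℝ (A ⊗[ℝ] (A ⊗[ℝ] A))) (C : ℕ → A →ₗ[ℝ] A →ₗ[ℝ] A) : Prop :=
  ∀ N f g h, ∑ p ∈ antidiagonal N, C p.1 (C p.2 f g) h =
    ∑ p ∈ antidiagonal N, ∑ q ∈ antidiagonal p.2,
      TensorProduct.lift (C p.1) ((TensorProduct.lift (C q.1)).lTensor A (Θ q.2 (f ⊗ₜ (g ⊗ₜ h))))

variable {Θ : ℕ → Module.End ℝ (A ⊗[ℝ] (A ⊗[ℝ] A))} {C : ℕ → A →ₗ[ℝ] A →ₗ[ℝ] A}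

theorem leftS_apply (m : ℕ → A ⊗[ℝ] A →ₗ[ℝ] A) (N : ℕ) (f g h : A) :
    leftS m N (f ⊗ₜ (g ⊗ₜ h)) = m N (f ⊗ₜ g) ⊗ₜ h := by
  rw [leftS, compS_cstS, tensS_cstS_right]
  rfl

theorem rightS_apply (m : ℕ → A ⊗[ℝ] A →ₗ[ℝ] A) (N : ℕ) (t : A ⊗[ℝ] (A ⊗[ℝ] A)) :
    rightS Θ m N t = ∑ q ∈ antidiagonal N, (m q.1).lTensor A (Θ q.2 t) := by
  rw [rightS, compS, conv, LinearMap.sum_apply]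
  refine Finset.sum_congr rfl fun q _ => ?_
  rw [tensS_cstS_left]
  rfl

/-- Associativity in terms of series of linear maps. -/
theorem isAssoc_iff :
    IsAssoc Θ C ↔ compS (mulS C) (leftS (mulS C)) = compS (mulS C) (rightS Θ (mulS C)) := by
  have e1 : ∀ N f g h, compS (mulS C) (leftS (mulS C)) N (f ⊗ₜ (g ⊗ₜ h)) =
      ∑ p ∈ antidiagonal N, C p.1 (C p.2 f g) h := by
    intro N f g h
    rw [compS, conv, LinearMap.sum_apply]
    refine Finset.sum_congr rfl fun p _ => ?_
    change mulS C p.1 (leftS (mulS C) p.2 _) = _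
    rw [leftS_apply]
    rfl
  have e2 : ∀ N f g h, compS (mulS C) (rightS Θ (mulS C)) N (f ⊗ₜ (g ⊗ₜ h)) =
      ∑ p ∈ antidiagonal N, ∑ q ∈ antidiagonal p.2,
      TensorProduct.lift (C p.1) ((TensorProduct.lift (C q.1)).lTensor A
        (Θ q.2 (f ⊗ₜ (g ⊗ₜ h)))) := by
    intro N f g h
    rw [compS, conv, LinearMap.sum_apply]
    refine Finset.sum_congr rfl fun p _ => ?_
    change mulS C p.1 (rightS Θ (mulS C) p.2 _) = _
    rw [rightS_apply, map_sum]
    rfl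
  constructor
  · intro h
    ext1 N
    apply TensorProduct.ext
    ext1 f
    apply TensorProduct.ext
    ext1 g
    ext1 k
    exact (e1 N f g k).trans ((h N f g k).trans (e2 N f g k).symm)
  · intro h N f g k
    rw [← e1, ← e2, h]

variable {C₁ C₂ : ℕ → A →ₗ[ℝ] A →ₗ[ℝ] A}

/-- The linearization of the associativity equation at the difference of two star-products. -/
theorem IsAssoc.sub (h₁ : IsAssoc Θ C₁) (h₂ : IsAssoc Θ C₂) :
    compS (mulS (C₁ - C₂)) (leftS (mulS C₁)) + compS (mulS C₂) (leftS (mulS (C₁ - C₂))) =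
      compS (mulS (C₁ - C₂)) (rightS Θ (mulS C₁)) +
        compS (mulS C₂) (rightS Θ (mulS (C₁ - C₂))) := by
  have e1 := isAssoc_iff.1 h₁
  have e2 := isAssoc_iff.1 h₂
  have hd : mulS (C₁ - C₂) = mulS C₁ - mulS C₂ := by
    ext1 k
    apply TensorProduct.ext
    ext1 f
    ext1 g
    rfl
  have hl : leftS (mulS C₁ - mulS C₂) = leftS (mulS C₁) - leftS (mulS C₂) := by
    simp only [leftS, tensS, compS, conv_sub_left]
  have hr : rightS Θ (mulS C₁ - mulS C₂) = rightS Θ (mulS C₁) - rightS Θ (mulS C₂) := by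
    simp only [rightS, tensS, compS, conv_sub_left, conv_sub_right]
  rw [hd, hl, hr]
  simp only [compS, conv_sub_left, conv_sub_right] at e1 e2 ⊢
  rw [e1, e2]
  abel

theorem rightS_zero (h0 : Θ 0 = 1) (m : ℕ → A ⊗[ℝ] A →ₗ[ℝ] A)
    (f g h : A) : rightS Θ m 0 (f ⊗ₜ (g ⊗ₜ h)) = f ⊗ₜ m 0 (g ⊗ₜ h) := by
  rw [rightS_apply, antidiagonal_zero, Finset.sum_singleton, h0]
  rfl

theorem rightS_one (h0 : Θ 0 = 1) (h1 : Θ 1 = 0) (m : ℕ → A ⊗[ℝ] A →ₗ[ℝ] A)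
    (f g h : A) : rightS Θ m 1 (f ⊗ₜ (g ⊗ₜ h)) = f ⊗ₜ m 1 (g ⊗ₜ h) := by
  rw [rightS_apply, Finset.Nat.antidiagonal_succ]
  simp [h0, h1]

theorem tensS_eq_zero {m : ℕ → A ⊗[ℝ] A →ₗ[ℝ] A} {n : ℕ} (hm : ∀ k ≤ n, m k = 0) :
    ∀ k ≤ n, tensS (cstS (LinearMap.id : A →ₗ[ℝ] A)) m k = 0 :=
  conv_eq_zero_of_right _ _ hm

theorem rightS_of_eq_zero (h0 : Θ 0 = 1) {m : ℕ → A ⊗[ℝ] A →ₗ[ℝ] A} {n : ℕ}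
    (hm : ∀ k ≤ n, m k = 0) (f g h : A) :
    rightS Θ m (n + 1) (f ⊗ₜ (g ⊗ₜ h)) = f ⊗ₜ m (n + 1) (g ⊗ₜ h) := by
  rw [rightS, compS, conv_of_left_eq_zero _ (tensS_eq_zero hm), h0, tensS_cstS_left]
  rfl

theorem rightS_of_eq_zero_succ (h0 : Θ 0 = 1) (h1 : Θ 1 = 0)
    {m : ℕ → A ⊗[ℝ] A →ₗ[ℝ] A} {n : ℕ} (hm : ∀ k ≤ n, m k = 0) (f g h : A) :
    rightS Θ m (n + 2) (f ⊗ₜ (g ⊗ₜ h)) = f ⊗ₜ m (n + 2) (g ⊗ₜ h) := by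
  rw [rightS, compS, conv_of_left_eq_zero_succ _ (tensS_eq_zero hm), h0, h1, map_zero, add_zero,
    tensS_cstS_left]
  rfl

theorem leftS_eq_zero {m : ℕ → A ⊗[ℝ] A →ₗ[ℝ] A} {n : ℕ}
    (hm : ∀ k ≤ n, m k = 0) : ∀ k ≤ n, leftS m k = 0 := by
  intro k hk
  rw [leftS, compS_cstS, tensS_cstS_right, hm k hk, TensorProduct.map_zero_left,
    LinearMap.zero_comp]

theorem rightS_eq_zero {m : ℕ → A ⊗[ℝ] A →ₗ[ℝ] A} {n : ℕ}
    (hm : ∀ k ≤ n, m k = 0) : ∀ k ≤ n, rightS Θ m k = 0 := by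
  intro k hk
  rw [rightS, compS]
  exact conv_eq_zero_of_left _ (tensS_eq_zero hm) _ k hk

theorem mulS_sub_eq_zero {n : ℕ} (hn : ∀ k ≤ n, C₁ k = C₂ k) :
    ∀ k ≤ n, mulS (C₁ - C₂) k = 0 := by
  intro k hk
  ext f g
  change C₁ k f g - C₂ k f g = 0
  rw [hn k hk, sub_self]

/-- The first difference of two star-products is a Hochschild cocycle. -/
theorem IsAssoc.isCocycle_sub (h0 : Θ 0 = 1) (h₁ : IsAssoc Θ C₁) (h₂ : IsAssoc Θ C₂)
    (z₁ : ∀ f g, C₁ 0 f g = f * g) (z₂ : ∀ f g, C₂ 0 f g = f * g) {n : ℕ}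
    (hn : ∀ k ≤ n, C₁ k = C₂ k) {B : A →ₗ[ℝ] A →ₗ[ℝ] A}
    (hB : ∀ f g, B f g = C₁ (n + 1) f g - C₂ (n + 1) f g) : IsCocycle B := by
  intro f g h
  have hd := mulS_sub_eq_zero hn
  have e := LinearMap.congr_fun (congrFun (h₁.sub h₂) (n + 1)) (f ⊗ₜ (g ⊗ₜ h))
  simp only [Pi.add_apply, compS] at e
  rw [conv_of_left_eq_zero _ hd, conv_of_left_eq_zero _ hd,
    conv_of_right_eq_zero _ _ (leftS_eq_zero hd),
    conv_of_right_eq_zero _ _ (rightS_eq_zero hd)] at e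
  simp only [LinearMap.add_apply, LinearMap.llcomp_apply, leftS_apply, rightS_zero h0,
    rightS_of_eq_zero h0 hd, mulS, TensorProduct.lift.tmul, z₁, z₂, Pi.sub_apply,
    LinearMap.sub_apply, ← hB] at e
  linear_combination -e

/-- The next order of the associativity equation for the difference of two star-products. -/
theorem IsAssoc.sub_succ (h0 : Θ 0 = 1) (h1 : Θ 1 = 0) (h₁ : IsAssoc Θ C₁) (h₂ : IsAssoc Θ C₂)
    (z₁ : ∀ f g, C₁ 0 f g = f * g) (z₂ : ∀ f g, C₂ 0 f g = f * g) {n : ℕ}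
    (hn : ∀ k ≤ n, C₁ k = C₂ k) (h0n : 1 ≤ n)
    {B B' : A →ₗ[ℝ] A →ₗ[ℝ] A} (hB : ∀ f g, B f g = C₁ (n + 1) f g - C₂ (n + 1) f g)
    (hB' : ∀ f g, B' f g = C₁ (n + 2) f g - C₂ (n + 2) f g) (f g h : A) :
    B' (f * g) h + B (C₁ 1 f g) h + (B' f g * h + C₁ 1 (B f g) h) =
      B' f (g * h) + B f (C₁ 1 g h) + (f * B' g h + C₁ 1 f (B g h)) := by
  have hd := mulS_sub_eq_zero hn
  have e := LinearMap.congr_fun (congrFun (h₁.sub h₂) (n + 2)) (f ⊗ₜ (g ⊗ₜ h))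
  simp only [Pi.add_apply, compS] at e
  rw [conv_of_left_eq_zero_succ _ hd, conv_of_left_eq_zero_succ _ hd,
    conv_of_right_eq_zero_succ _ _ (leftS_eq_zero hd),
    conv_of_right_eq_zero_succ _ _ (rightS_eq_zero hd)] at e
  simp only [LinearMap.add_apply, LinearMap.llcomp_apply, leftS_apply, rightS_zero h0,
    rightS_of_eq_zero h0 hd, rightS_of_eq_zero_succ h0 h1 hd, rightS_one h0 h1, mulS,
    TensorProduct.lift.tmul, z₁, z₂, Pi.sub_apply, LinearMap.sub_apply, ← hn 1 h0n,
    ← hB, ← hB'] at e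
  exact e

/-- The first order term of a star-product is a Hochschild cocycle. -/
theorem IsAssoc.isCocycle_one (h0 : Θ 0 = 1) (h1 : Θ 1 = 0) (hC : IsAssoc Θ C)
    (z : ∀ f g, C 0 f g = f * g) : IsCocycle (C 1) := by
  intro f g h
  have e := LinearMap.congr_fun (congrFun (isAssoc_iff.1 hC) 1) (f ⊗ₜ (g ⊗ₜ h))
  rw [compS, compS, conv_one, conv_one] at e
  simp only [LinearMap.add_apply, LinearMap.llcomp_apply, leftS_apply, rightS_zero h0,
    rightS_one h0 h1, mulS, TensorProduct.lift.tmul, z] at e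
  linear_combination -e

/-- The alternation over three arguments of the associativity equation. The terms with the unknown
`A'` cancel, and the other ones give the Schouten bracket of the skew-symmetric parts. -/
theorem schouten_eq_zero_of_assoc {A' B C : A →ₗ[ℝ] A →ₗ[ℝ] A}
    (h : ∀ f g h, A' (f * g) h + B (C f g) h + (A' f g * h + C (B f g) h) =
      A' f (g * h) + B f (C g h) + (f * A' g h + C f (B g h)))
    {b c : A →ₗ[ℝ] A →ₗ[ℝ] A} (hb : ∀ f g, b f g = (1 / 2 : ℝ) • (B f g - B g f))
    (hc : ∀ f g, c f g = (1 / 2 : ℝ) • (C f g - C g f)) (f g k : A) :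
    c (b f g) k + c (b g k) f + c (b k f) g + (b (c f g) k + b (c g k) f + b (c k f) g) = 0 := by
  have h1 := h f g k
  have h2 := h g k f
  have h3 := h k f g
  have h4 := h g f k
  have h5 := h k g f
  have h6 := h f k g
  rw [mul_comm k f] at h2 h3
  rw [mul_comm g f] at h4 h5
  rw [mul_comm k g] at h5 h6
  simp only [hb, hc, map_smul, map_sub, LinearMap.smul_apply, LinearMap.sub_apply, ← smul_sub,
    ← smul_add, smul_smul]
  refine Eq.trans (congrArg _ ?_) (smul_zero _)
  linear_combination h1 + h2 + h3 - h4 - h5 - h6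

/-- The product transported by the series of operators `Q` with inverse `R`:
`f *' g = Q (R f * R g)`. -/
noncomputable def transport (Q R : ℕ → Module.End ℝ A) (C : ℕ → A →ₗ[ℝ] A →ₗ[ℝ] A) (N : ℕ) :
    A →ₗ[ℝ] A →ₗ[ℝ] A :=
  TensorProduct.curry (compS Q (compS (mulS C) (tensS R R)) N)

theorem mulS_transport (Q R : ℕ → Module.End ℝ A) (C : ℕ → A →ₗ[ℝ] A →ₗ[ℝ] A) :
    mulS (transport Q R C) = compS Q (compS (mulS C) (tensS R R)) := by
  ext1 N
  apply TensorProduct.ext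
  ext
  rfl

theorem transport_apply (Q R : ℕ → Module.End ℝ A) (C : ℕ → A →ₗ[ℝ] A →ₗ[ℝ] A) (N : ℕ) :
    transport Q R C N = ∑ p ∈ antidiagonal N, ∑ q ∈ antidiagonal p.2, ∑ s ∈ antidiagonal q.2,
      ((C q.1).compl₁₂ (R s.1) (R s.2)).compr₂ (Q p.1) := by
  ext f g
  simp only [transport, compS, tensS, conv, map_sum, LinearMap.sum_apply,
    TensorProduct.curry_apply]
  rfl

variable {Q R : ℕ → Module.End ℝ A}

/-- Transport preserves associativity up to a series `Θ` which commutes with `R ⊗ R ⊗ R`. -/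
theorem IsAssoc.transport (hC : IsAssoc Θ C) (hRQ : compS R Q = cstS LinearMap.id)
    (hΘ : compS (tensS R (tensS R R)) Θ = compS Θ (tensS R (tensS R R))) :
    IsAssoc Θ (transport Q R C) := by
  rw [isAssoc_iff] at hC ⊢
  have hm := mulS_transport Q R C
  have hRm : compS R (mulS (QPois.transport Q R C)) = compS (mulS C) (tensS R R) := by
    rw [hm, ← compS_assoc, hRQ, cstS_id_compS]
  have e1 : compS (tensS R R) (leftS (mulS (QPois.transport Q R C))) =
      compS (leftS (mulS C)) (tensS R (tensS R R)) := by
    rw [leftS, leftS, ← compS_assoc, tensS_compS, hRm, compS_cstS_id, compS_assoc, ← tensS_assoc,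
      ← compS_assoc, tensS_compS, cstS_id_compS]
  have e2 : compS (tensS R R) (rightS Θ (mulS (QPois.transport Q R C))) =
      compS (rightS Θ (mulS C)) (tensS R (tensS R R)) := by
    rw [rightS, rightS, ← compS_assoc, tensS_compS, hRm, compS_cstS_id, compS_assoc, ← hΘ,
      ← compS_assoc, tensS_compS, cstS_id_compS]
  generalize leftS (mulS (QPois.transport Q R C)) = l at e1 ⊢
  generalize rightS Θ (mulS (QPois.transport Q R C)) = l' at e2 ⊢
  rw [hm, compS_assoc, compS_assoc, e1, compS_assoc, compS_assoc, e2, ← compS_assoc (mulS C), hC,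
    compS_assoc]

/-- The transported product is characterized by `Q f *' Q g = Q (f * g)`. -/
theorem compS_mulS_transport (hRQ : compS R Q = cstS LinearMap.id) :
    compS (mulS (transport Q R C)) (tensS Q Q) = compS Q (mulS C) := by
  rw [mulS_transport, compS_assoc, compS_assoc, tensS_compS, hRQ, tensS_cstS, TensorProduct.map_id,
    compS_cstS_id]

theorem compS_mulS_tensS_apply (N : ℕ) (f g : A) : compS (mulS C) (tensS Q Q) N (f ⊗ₜ g) =
    ∑ p ∈ antidiagonal N, ∑ q ∈ antidiagonal p.2, C p.1 (Q q.1 f) (Q q.2 g) := by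
  simp only [compS, tensS, conv, map_sum, LinearMap.sum_apply]
  rfl

theorem compS_mulS_apply (N : ℕ) (f g : A) : compS Q (mulS C) N (f ⊗ₜ g) =
    ∑ p ∈ antidiagonal N, Q p.1 (C p.2 f g) := by
  simp only [compS, conv, LinearMap.sum_apply]
  rfl

/-- A product which agrees with the transported one up to a given order is determined by the
transformation formula up to that order. -/
theorem transport_eq_of_le (hQR : compS Q R = cstS LinearMap.id) {C' : ℕ → A →ₗ[ℝ] A →ₗ[ℝ] A}
    {n : ℕ} (h : ∀ k ≤ n, compS (mulS C') (tensS Q Q) k = compS Q (mulS C) k) :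
    ∀ k ≤ n, transport Q R C k = C' k := by
  intro k hk
  have h1 : compS (compS (mulS C') (tensS Q Q)) (tensS R R) k =
      compS (compS Q (mulS C)) (tensS R R) k := conv_congr _ h _ k hk
  rw [compS_assoc, tensS_compS, hQR, tensS_cstS, TensorProduct.map_id, compS_cstS_id,
    compS_assoc] at h1
  rw [transport, ← h1]
  ext
  rfl

/-- The commutators with an element which is fixed by `Q` are conjugated by `Q`. -/
theorem transport_sub (hQR : compS Q R = cstS LinearMap.id) (y : A)
    (hy : ∀ k, R k y = if k = 0 then y else 0) {T : Module.End ℝ A} {n : ℕ}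
    (hT : ∀ k f, C k y f - C k f y = if k = n then T f else 0)
    (hQT : ∀ k f, Q k (T f) = T (Q k f)) (k : ℕ) (f : A) :
    transport Q R C k y f - transport Q R C k f y = if k = n then T f else 0 := by
  let ν : A →ₗ[ℝ] A ⊗[ℝ] A := TensorProduct.mk ℝ A A y - (TensorProduct.mk ℝ A A).flip y
  have h1 : compS (tensS R R) (cstS ν) = compS (cstS ν) R := by
    ext1 N
    rw [compS_cstS, cstS_compS]
    ext f
    have hl : tensS R R N (y ⊗ₜ f) = y ⊗ₜ R N f := by
      rw [tensS, conv, LinearMap.sum_apply, Finset.sum_eq_single (0, N)]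
      · change R 0 y ⊗ₜ R N f = _
        rw [hy, if_pos rfl]
      · rintro ⟨a, b⟩ hab hne
        rw [mem_antidiagonal] at hab
        change R a y ⊗ₜ R b f = _
        rw [hy, if_neg, TensorProduct.zero_tmul]
        rintro rfl
        simp only [zero_add] at hab
        exact hne (by rw [hab])
      · intro h'
        exact absurd (mem_antidiagonal.2 (by simp)) h'
    have hr : tensS R R N (f ⊗ₜ y) = R N f ⊗ₜ y := by
      rw [tensS, conv, LinearMap.sum_apply, Finset.sum_eq_single (N, 0)]
      · change R N f ⊗ₜ R 0 y = _
        rw [hy, if_pos rfl]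
      · rintro ⟨a, b⟩ hab hne
        rw [mem_antidiagonal] at hab
        change R a f ⊗ₜ R b y = _
        rw [hy, if_neg, TensorProduct.tmul_zero]
        rintro rfl
        simp only [add_zero] at hab
        exact hne (by rw [hab])
      · intro h'
        exact absurd (mem_antidiagonal.2 (by simp)) h'
    change tensS R R N (y ⊗ₜ f - f ⊗ₜ y) = y ⊗ₜ R N f - R N f ⊗ₜ y
    rw [map_sub, hl, hr]
  have h2 : compS (mulS C) (cstS ν) = Pi.single n T := by
    ext1 N
    rw [compS_cstS]
    ext f
    change mulS C N (y ⊗ₜ f - f ⊗ₜ y) = _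
    rw [map_sub]
    refine (hT N f).trans ?_
    by_cases hN : N = n
    · subst hN
      rw [if_pos rfl, Pi.single_eq_same]
    · rw [if_neg hN, Pi.single_eq_of_ne hN]
      rfl
  have h3 : compS Q (Pi.single n T) = compS (Pi.single n T) Q := by
    refine conv_comm _ (LinearMap.llcomp ℝ A A A) _ _ fun j k => ?_
    by_cases hk : k = n
    · subst hk
      rw [Pi.single_eq_same]
      ext f
      exact hQT j f
    · rw [Pi.single_eq_of_ne hk, map_zero, map_zero]
      rfl
  have h4 : compS (mulS (transport Q R C)) (cstS ν) = Pi.single n T := by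
    rw [mulS_transport, compS_assoc, compS_assoc, h1, ← compS_assoc (mulS C), h2, ← compS_assoc, h3,
      compS_assoc, hQR, compS_cstS_id]
  have h5 := LinearMap.congr_fun (congrFun h4 k) f
  rw [compS_cstS] at h5
  have h6 : transport Q R C k y f - transport Q R C k f y =
      mulS (transport Q R C) k (y ⊗ₜ f - f ⊗ₜ y) := by
    rw [map_sub]
    rfl
  rw [h6]
  refine h5.trans ?_
  by_cases hN : k = n
  · subst hN
    rw [if_pos rfl, Pi.single_eq_same]
  · rw [if_neg hN, Pi.single_eq_of_ne hN]
    rfl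

end AbstractStarProducts

/-! ### Differences of strongly invariant star-products -/

section StarProducts

open Finset.HasAntidiagonal

variable {F E H G : Type*} [NormedAddCommGroup F] [NormedSpace ℝ F] [FiniteDimensional ℝ F]
  [NormedAddCommGroup E] [NormedSpace ℝ E] [FiniteDimensional ℝ E]
  [TopologicalSpace H] [ChartedSpace F H] [Group H] [LieGroup 𝓘(ℝ, F) ∞ H]
  [TopologicalSpace G] [ChartedSpace E G] [Group G] [LieGroup 𝓘(ℝ, E) ∞ G]
  {D : Base F E H G}

theorem sum_antidiagonal_ite_snd {M : Type*} [AddCommMonoid M] (φ : ℕ → M) (N : ℕ) :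
    ∑ p ∈ antidiagonal (N + 1), (if p.2 = 1 then φ p.1 else 0) = φ N := by
  rw [Finset.sum_eq_single (N, 1), if_pos rfl]
  · rintro ⟨a, b⟩ hab hne
    rw [mem_antidiagonal] at hab
    refine if_neg fun hb => hne ?_
    simp only at hab hb
    ext <;> simp <;> omega
  · exact fun h => absurd (mem_antidiagonal.2 (by rfl)) h

theorem sum_antidiagonal_ite_fst {M : Type*} [AddCommMonoid M] (φ : ℕ → M) (N : ℕ) :
    ∑ p ∈ antidiagonal (N + 1), (if p.1 = 1 then φ p.2 else 0) = φ N := by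
  rw [← sum_antidiagonal_ite_snd φ N]
  exact Finset.Nat.sum_antidiagonal_swap (f := fun p => if p.2 = 1 then φ p.1 else 0)

namespace Base

variable {r : D.SmoothTensor} {Z : LieAlg E G ⊗[ℝ] (LieAlg E G ⊗[ℝ] LieAlg E G)}
  {Φ : (PowerSeries (UEA₃ (LieAlg E G)))ˣ} {C : ℕ → D.Obs →ₗ[ℝ] D.Obs →ₗ[ℝ] D.Obs}

/-- A star-product is associative on three functions on which the associator acts trivially. -/
theorem IsQuantization.assoc_of_trivial (hC : D.IsQuantization r Φ C) (N : ℕ) {f g h : D.Obs}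
    (ht : ∀ k, D.act₃ (twistedCoeff Φ k) (f ⊗ₜ (g ⊗ₜ h)) = if k = 0 then f ⊗ₜ (g ⊗ₜ h) else 0) :
    ∑ p ∈ antidiagonal N, C p.1 (C p.2 f g) h = ∑ p ∈ antidiagonal N, C p.1 f (C p.2 g h) := by
  rw [hC.assoc]
  refine Finset.sum_congr rfl fun p _ => ?_
  rw [Finset.sum_eq_single (p.2, 0)]
  · rw [ht, if_pos rfl]
    rfl
  · rintro ⟨a, b⟩ hab hne
    rw [mem_antidiagonal] at hab
    have hb : b ≠ 0 := fun hb => hne (by subst hb; simp at hab; rw [hab])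
    rw [ht, if_neg hb, map_zero, map_zero]
  · intro h'
    exact absurd (mem_antidiagonal.2 (by simp)) h'

/-- The brackets with linear functions are derivations of a strongly invariant star-product: they
are inner derivations, and the associator is trivial on linear functions. -/
theorem IsStronglyInvariant.bracket_lin (hΦ : IsAssociator Z Φ)
    (hC : D.IsStronglyInvariant r Φ C) (N : ℕ) (y : F) (f g : D.Obs) :
    D.bracket r (lin y) (C N f g) =
      C N (D.bracket r (lin y) f) g + C N f (D.bracket r (lin y) g) := by
  have h1 := hC.assoc_of_trivial (N + 1) fun k => D.act₃_lin₁ hΦ k y f g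
  have h2 := hC.assoc_of_trivial (N + 1) fun k => D.act₃_lin₂ hΦ k y f g
  have h3 := hC.assoc_of_trivial (N + 1) fun k => D.act₃_lin₃ hΦ k y f g
  have e1 : ∑ p ∈ antidiagonal (N + 1), C p.1 (C p.2 (lin y) f) g -
      ∑ p ∈ antidiagonal (N + 1), C p.1 (C p.2 f (lin y)) g = C N (D.bracket r (lin y) f) g := by
    rw [← Finset.sum_sub_distrib, ← sum_antidiagonal_ite_snd (fun k => C k _ g)]
    refine Finset.sum_congr rfl fun p _ => ?_
    rw [← LinearMap.sub_apply, ← map_sub, hC.momentum]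
    split_ifs <;> simp
  have e2 : ∑ p ∈ antidiagonal (N + 1), C p.1 f (C p.2 (lin y) g) -
      ∑ p ∈ antidiagonal (N + 1), C p.1 f (C p.2 g (lin y)) = C N f (D.bracket r (lin y) g) := by
    rw [← Finset.sum_sub_distrib, ← sum_antidiagonal_ite_snd (fun k => C k f _)]
    refine Finset.sum_congr rfl fun p _ => ?_
    rw [← map_sub, hC.momentum]
    split_ifs <;> simp
  have e3 : ∑ p ∈ antidiagonal (N + 1), C p.1 (lin y) (C p.2 f g) -
      ∑ p ∈ antidiagonal (N + 1), C p.1 (C p.2 f g) (lin y) = D.bracket r (lin y) (C N f g) := by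
    rw [← Finset.sum_sub_distrib,
      ← sum_antidiagonal_ite_fst (fun k => D.bracket r (lin y) (C k f g))]
    exact Finset.sum_congr rfl fun p _ => hC.momentum _ _ _
  rw [← e1, ← e2, ← e3, h1, h2, h3]
  abel

/-- The terms of a strongly invariant star-product are `G × H`-invariant, and not only
`𝔤`-invariant. -/
theorem IsStronglyInvariant.invariant₂ [T2Space G] [ConnectedSpace G] [T2Space H]
    [ConnectedSpace H] (hΦ : IsAssociator Z Φ) (hC : D.IsStronglyInvariant r Φ C) (k : ℕ) :
    D.Invariant₂ (C k) :=
  D.invariant₂_of_infinitesimal r (hC.bidiff k) (hC.invariant k) (hC.bracket_lin hΦ k)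

/-- The action of the associator as a series of operators on `𝒪_M ⊗ 𝒪_M ⊗ 𝒪_M`. -/
noncomputable def assocS (D : Base F E H G) (Φ : (PowerSeries (UEA₃ (LieAlg E G)))ˣ) :
    ℕ → Module.End ℝ (D.Obs ⊗[ℝ] (D.Obs ⊗[ℝ] D.Obs)) := fun k => D.act₃ (twistedCoeff Φ k)

theorem assocS_zero (hΦ : IsAssociator Z Φ) : D.assocS Φ 0 = 1 := by
  apply TensorProduct.ext
  ext1 f
  apply TensorProduct.ext
  ext1 g
  ext1 h
  exact D.act₃_zero hΦ f g h

theorem assocS_one (hΦ : IsAssociator Z Φ) : D.assocS Φ 1 = 0 :=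
  LinearMap.ext fun t => D.act₃_one hΦ t

theorem IsQuantization.isAssoc (hC : D.IsQuantization r Φ C) : IsAssoc (D.assocS Φ) C := hC.assoc

variable {C₁ C₂ : ℕ → D.Obs →ₗ[ℝ] D.Obs →ₗ[ℝ] D.Obs}

theorem piOp_eq (hC : D.IsQuantization r Φ C) (f g : D.Obs) :
    D.piOp r f g = (1 / 2 : ℝ) • (C 1 f g - C 1 g f) := by
  rw [hC.one]
  rfl

/-- The first order term of a star-product is the sum of `π_r` and a coboundary. -/
theorem exists_isFirstOrder [T2Space G] [ConnectedSpace G] [T2Space H] [ConnectedSpace H]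
    (hΦ : IsAssociator Z Φ) (hC : D.IsStronglyInvariant r Φ C) :
    ∃ P, D.IsFirstOrder r (C 1) P := by
  obtain ⟨P, hP, hi, hk, he⟩ := D.exists_split (hC.bidiff 1)
    (hC.isAssoc.isCocycle_one (assocS_zero hΦ) (assocS_one hΦ) hC.zero) (hC.invariant₂ hΦ 1)
  exact ⟨P, hP, hi, hk, fun f g => by rw [piOp_eq hC.toIsQuantization]; exact he f g⟩

theorem mem_bidiff_of_eq_sub {A A₁ A₂ : D.Obs →ₗ[ℝ] D.Obs →ₗ[ℝ] D.Obs} (h₁ : A₁ ∈ D.Bidiff)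
    (h₂ : A₂ ∈ D.Bidiff) (h : ∀ f g, A f g = A₁ f g - A₂ f g) : A ∈ D.Bidiff := by
  have e : A = A₁ + (-1 : ℝ) • A₂ := LinearMap.ext₂ fun f g => by
    rw [h]
    change _ = A₁ f g + (-1 : ℝ) • A₂ f g
    rw [neg_one_smul, sub_eq_add_neg]
  rw [e]
  exact Submodule.add_mem _ h₁ (Submodule.smul_mem _ _ h₂)

/-- An invariant bidifferential cocycle is split by its skew-symmetric part. -/
theorem exists_isSplitting_of_isCocycle [T2Space G] [T2Space H] {A : D.Obs →ₗ[ℝ] D.Obs →ₗ[ℝ] D.Obs} (hA : A ∈ D.Bidiff)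
    (hc : IsCocycle A) (hi : D.Invariant₂ A) (hk : ∀ (y : F) f, A (lin y) f = A f (lin y))
    (hs : ∀ B : D.Obs →ₗ[ℝ] D.Obs →ₗ[ℝ] D.Obs,
      (∀ f g, B f g = (1 / 2 : ℝ) • (A f g - A g f)) →
        ∀ f g h, D.schoutenBiv (D.piOp r) B f g h = 0) :
    ∃ B E₀, D.IsSplitting r A B E₀ := by
  obtain ⟨P, hP, hPi, hPk, he⟩ := D.exists_split hA hc hi
  obtain ⟨B, hB⟩ : ∃ B : D.Obs →ₗ[ℝ] D.Obs →ₗ[ℝ] D.Obs,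
      ∀ f g, B f g = (1 / 2 : ℝ) • (A f g - A g f) := ⟨(1 / 2 : ℝ) • (A - A.flip), fun _ _ => rfl⟩
  refine ⟨B, P,
    { bivector := ⟨fun f => ?_, fun f g h => ?_⟩
      invariantB := ⟨fun a f g => ?_, fun x f g => ?_⟩
      killsB := fun y f => ?_
      closed := hs B hB
      diff := hP
      invariantP := hPi
      killsP := hPk
      eq := fun f g => ?_ }⟩
  · rw [hB, sub_self, smul_zero]
  · rw [hB, hc.sub_flip_mul, hB, hB, mul_smul_comm, mul_smul_comm, ← smul_add]
  · rw [hB, hB, hi.1, hi.1, map_smul, map_sub]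
  · rw [hB, hB, hi.2, hi.2, map_smul, map_sub]
  · rw [hB, hk, sub_self, smul_zero]
  · rw [hB]
    exact he f g

/-- The first difference of two star-products is a Poisson cocycle. -/
theorem IsQuantization.schoutenBiv_eq_zero (hΦ : IsAssociator Z Φ)
    (h₁ : D.IsQuantization r Φ C₁) (h₂ : D.IsQuantization r Φ C₂) {n : ℕ}
    (hn : ∀ k ≤ n, C₁ k = C₂ k) {A B : D.Obs →ₗ[ℝ] D.Obs →ₗ[ℝ] D.Obs}
    (hA : ∀ f g, A f g = C₁ (n + 1) f g - C₂ (n + 1) f g)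
    (hB : ∀ f g, B f g = (1 / 2 : ℝ) • (A f g - A g f)) (f g h : D.Obs) :
    D.schoutenBiv (D.piOp r) B f g h = 0 := by
  obtain rfl | h0 := Nat.eq_zero_or_pos n
  · -- for `n = 0` the skew-symmetric part vanishes, since both products quantize `π_r`
    have hB0 : ∀ f g, B f g = 0 := fun f g => by
      have e : A f g - A g f = (C₁ 1 f g - C₁ 1 g f) - (C₂ 1 f g - C₂ 1 g f) := by
        rw [hA, hA]
        abel
      rw [hB, e, h₁.one, h₂.one, sub_self, smul_zero]
    simp only [schoutenBiv, hB0, map_zero, add_zero]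
    change (0 : D.Obs) + 0 + 0 = 0
    rw [add_zero, add_zero]
  · obtain ⟨A', hA'⟩ : ∃ A' : D.Obs →ₗ[ℝ] D.Obs →ₗ[ℝ] D.Obs,
        ∀ f g, A' f g = C₁ (n + 2) f g - C₂ (n + 2) f g := ⟨C₁ (n + 2) - C₂ (n + 2), fun _ _ => rfl⟩
    have h3 := h₁.isAssoc.sub_succ (assocS_zero hΦ) (assocS_one hΦ) h₂.isAssoc h₁.zero h₂.zero hn
      h0 hA hA'
    exact schouten_eq_zero_of_assoc h3 hB (piOp_eq h₁) f g h

/-- The first difference of two strongly invariant star-products is the sum of a Poisson cocycle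
and a coboundary. -/
theorem exists_isSplitting [T2Space G] [ConnectedSpace G] [T2Space H] [ConnectedSpace H]
    (hΦ : IsAssociator Z Φ) (h₁ : D.IsStronglyInvariant r Φ C₁)
    (h₂ : D.IsStronglyInvariant r Φ C₂) {n : ℕ} (hn : ∀ k ≤ n, C₁ k = C₂ k) :
    ∃ B E₀, D.IsSplitting r (C₁ (n + 1) - C₂ (n + 1)) B E₀ := by
  obtain ⟨A, hA, hA'⟩ : ∃ A, A = C₁ (n + 1) - C₂ (n + 1) ∧
      ∀ f g, A f g = C₁ (n + 1) f g - C₂ (n + 1) f g := ⟨_, rfl, fun _ _ => rfl⟩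
  rw [← hA]
  refine exists_isSplitting_of_isCocycle (mem_bidiff_of_eq_sub (h₁.bidiff _) (h₂.bidiff _) hA')
    (h₁.isAssoc.isCocycle_sub (assocS_zero hΦ) h₂.isAssoc h₁.zero h₂.zero hn hA')
    ⟨fun a f g => ?_, fun x f g => ?_⟩ (fun y f => ?_) fun B hB f g h =>
      h₁.toIsQuantization.schoutenBiv_eq_zero hΦ h₂.toIsQuantization hn hA' hB f g h
  · rw [hA', hA', (h₁.invariant₂ hΦ _).1, (h₂.invariant₂ hΦ _).1, map_sub]
  · rw [hA', hA', (h₁.invariant₂ hΦ _).2, (h₂.invariant₂ hΦ _).2, map_sub]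
  · have e := (h₁.momentum (n + 1) y f).trans (h₂.momentum (n + 1) y f).symm
    rw [hA', hA', sub_eq_sub_iff_sub_eq_sub]
    exact e

end Base

end StarProducts

/-! ### Formal series of operators as equivalences -/

section AbstractEquivalences

open Finset.HasAntidiagonal

variable {A : Type*} [CommRing A] [Algebra ℝ A]

theorem compS_single_left (k : ℕ) (T : Module.End ℝ A) (C : ℕ → A →ₗ[ℝ] A →ₗ[ℝ] A) (N : ℕ)
    (f g : A) :
    compS (Pi.single k T) (mulS C) N (f ⊗ₜ g) = if k ≤ N then T (C (N - k) f g) else 0 := by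
  rw [compS, conv_single_left]
  split_ifs <;> rfl

theorem compS_single_right (k : ℕ) (S T : Module.End ℝ A) (C : ℕ → A →ₗ[ℝ] A →ₗ[ℝ] A) (N : ℕ)
    (f g : A) :
    compS (mulS C) (Pi.single k (TensorProduct.map S T)) N (f ⊗ₜ g) =
      if k ≤ N then C (N - k) (S f) (T g) else 0 := by
  rw [compS, conv_single_right]
  split_ifs <;> rfl

theorem tensS_single_single (j k : ℕ) (S T : Module.End ℝ A) :
    tensS (Pi.single j S) (Pi.single k T) = Pi.single (j + k) (TensorProduct.map S T) :=
  conv_single_single _ _ _ _ _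

/-- The commutator of `C₁` with a derivation `X`, when `C₁` is the sum of `c` and the coboundary of
`P`: it is the sum of the Lie derivative of `c` and the coboundary of `[X, P]`. -/
theorem derivation_comm_first_order {C c : A →ₗ[ℝ] A →ₗ[ℝ] A} {P : Module.End ℝ A}
    (X : Derivation ℝ A A) (hP : ∀ f g, C f g = c f g + (f * P g - P (f * g) + P f * g)) (f g : A) :
    X (C f g) - C (X f) g - C f (X g) = X (c f g) - c (X f) g - c f (X g) +
      (f * (X (P g) - P (X g)) - (X (P (f * g)) - P (X (f * g))) + (X (P f) - P (X f)) * g) := by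
  simp only [hP, map_add, map_sub, X.leibniz, smul_eq_mul]
  have e1 : P (g * X f) = P (X f * g) := by rw [mul_comm]
  rw [e1]
  ring

/-- The equivalence `1 + ħ^n X + ħ^(n + 1) W` removes the difference of two star-products up to
order `n + 1`. -/
theorem compS_eq_of_splitting {C₁ C₂ : ℕ → A →ₗ[ℝ] A →ₗ[ℝ] A} (z₁ : ∀ f g, C₁ 0 f g = f * g)
    (z₂ : ∀ f g, C₂ 0 f g = f * g) {n : ℕ} (hn : ∀ k ≤ n, C₁ k = C₂ k)
    {c : A →ₗ[ℝ] A →ₗ[ℝ] A} {E P W : Module.End ℝ A} {X : Derivation ℝ A A}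
    (hE : ∀ f g, C₁ (n + 1) f g - C₂ (n + 1) f g =
      c (X f) g + c f (X g) - X (c f g) + (f * E g - E (f * g) + E f * g))
    (hP : ∀ f g, C₁ 1 f g = c f g + (f * P g - P (f * g) + P f * g)) (hX : 1 ≤ n ∨ X = 0)
    (hW : ∀ f, W f = E f + (X (P f) - P (X f)) + if n = 1 then (1 / 2 : ℝ) • X (X f) else 0)
    {Q : ℕ → Module.End ℝ A}
    (hQ : Q = Pi.single 0 1 + Pi.single n (X : Module.End ℝ A) + Pi.single (n + 1) W) :
    ∀ k ≤ n + 1, compS (mulS C₂) (tensS Q Q) k = compS Q (mulS C₁) k := by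
  intro k hk
  have hl : ∀ f g, compS Q (mulS C₁) k (f ⊗ₜ g) = C₁ k f g +
      (if n ≤ k then X (C₁ (k - n) f g) else 0) +
      (if n + 1 ≤ k then W (C₁ (k - (n + 1)) f g) else 0) := by
    intro f g
    have e1 := compS_single_left 0 1 C₁ k f g
    have e2 := compS_single_left n (X : Module.End ℝ A) C₁ k f g
    have e3 := compS_single_left (n + 1) W C₁ k f g
    rw [if_pos (Nat.zero_le k)] at e1
    refine Eq.trans ?_ (congrArg₂ (· + ·) (congrArg₂ (· + ·) e1 e2) e3)
    rw [hQ]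
    simp only [compS, conv_add_left]
    rfl
  have hr : ∀ f g, compS (mulS C₂) (tensS Q Q) k (f ⊗ₜ g) = C₂ k f g +
      (if n ≤ k then C₂ (k - n) (X f) g + C₂ (k - n) f (X g) else 0) +
      (if n + 1 ≤ k then C₂ (k - (n + 1)) (W f) g + C₂ (k - (n + 1)) f (W g) else 0) +
      (if n + n ≤ k then C₂ (k - (n + n)) (X f) (X g) else 0) +
      (if n + (n + 1) ≤ k then C₂ (k - (n + (n + 1))) (X f) (W g) else 0) +
      (if n + 1 + n ≤ k then C₂ (k - (n + 1 + n)) (W f) (X g) else 0) := by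
    intro f g
    have e := fun j S T => compS_single_right j S T C₂ k f g
    have h9 := e (n + 1 + (n + 1)) W W
    rw [if_neg (by omega)] at h9
    have hs : compS (mulS C₂) (tensS Q Q) k (f ⊗ₜ g) =
        compS (mulS C₂) (Pi.single (0 + 0) (TensorProduct.map 1 1)) k (f ⊗ₜ g) +
        compS (mulS C₂) (Pi.single (0 + n) (TensorProduct.map 1 X)) k (f ⊗ₜ g) +
        compS (mulS C₂) (Pi.single (0 + (n + 1)) (TensorProduct.map 1 W)) k (f ⊗ₜ g) +
        compS (mulS C₂) (Pi.single (n + 0) (TensorProduct.map X 1)) k (f ⊗ₜ g) +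
        compS (mulS C₂) (Pi.single (n + n) (TensorProduct.map X X)) k (f ⊗ₜ g) +
        compS (mulS C₂) (Pi.single (n + (n + 1)) (TensorProduct.map X W)) k (f ⊗ₜ g) +
        compS (mulS C₂) (Pi.single (n + 1 + 0) (TensorProduct.map W 1)) k (f ⊗ₜ g) +
        compS (mulS C₂) (Pi.single (n + 1 + n) (TensorProduct.map W X)) k (f ⊗ₜ g) +
        compS (mulS C₂) (Pi.single (n + 1 + (n + 1)) (TensorProduct.map W W)) k (f ⊗ₜ g) := by
      simp only [← tensS_single_single, hQ]
      simp only [compS, tensS, conv_add_left, conv_add_right]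
      simp only [Pi.add_apply, LinearMap.add_apply]
      abel
    rw [hs, h9, e, e, e, e, e, e, e, e]
    simp only [zero_add, add_zero, Nat.zero_le, if_true, Nat.sub_zero]
    simp only [Module.End.one_apply, Derivation.coeFn_coe]
    split_ifs <;> abel
  -- the transformation formula at order `n + 1`
  have key : ∀ f g, C₁ (n + 1) f g + X (C₁ 1 f g) + W (f * g) =
      C₂ (n + 1) f g + (C₁ 1 (X f) g + C₁ 1 f (X g)) + (W f * g + f * W g) +
        if n = 1 then X f * X g else 0 := by
    intro f g
    have e1 := hE f g
    have e2 := derivation_comm_first_order X hP f g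
    have e3 : W f * g + f * W g - W (f * g) + (if n = 1 then X f * X g else 0) =
        f * E g - E (f * g) + E f * g +
        (f * (X (P g) - P (X g)) - (X (P (f * g)) - P (X (f * g))) + (X (P f) - P (X f)) * g) := by
      rw [hW, hW, hW]
      split_ifs
      · have h2 : (1 / 2 : ℝ) • X (X (f * g)) = (1 / 2 : ℝ) • X (X f) * g +
            f * ((1 / 2 : ℝ) • X (X g)) + X f * X g := by
          have h3 : X (X (f * g)) = X (X f) * g + f * X (X g) + (2 : ℝ) • (X f * X g) := by
            simp only [X.leibniz, smul_eq_mul, map_add, two_smul]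
            ring
          rw [h3, smul_add, smul_add, smul_smul, mul_smul_comm, smul_mul_assoc]
          norm_num
        rw [h2]
        ring
      · ring
    linear_combination e1 + e2 - e3
  apply TensorProduct.ext
  ext f g
  change compS (mulS C₂) (tensS Q Q) k (f ⊗ₜ g) = compS Q (mulS C₁) k (f ⊗ₜ g)
  rw [hl, hr]
  obtain h0 | rfl := hX
  · rw [if_neg (show ¬ n + (n + 1) ≤ k by omega), if_neg (show ¬ n + 1 + n ≤ k by omega), add_zero,
      add_zero]
    obtain hlt | rfl | rfl : k < n ∨ k = n ∨ k = n + 1 := by omega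
    · rw [if_neg (by omega), if_neg (by omega), if_neg (by omega), if_neg (by omega),
        if_neg (by omega), hn k hlt.le]
      simp only [add_zero]
    · rw [if_pos le_rfl, if_neg (by omega), if_neg (by omega), if_pos le_rfl, if_neg (by omega),
        hn k le_rfl, Nat.sub_self, z₁, z₂, z₂, X.leibniz, smul_eq_mul, smul_eq_mul, mul_comm g,
        mul_comm (X f), add_comm (g * X f), add_zero, add_zero, mul_comm g]
    · rw [if_pos (Nat.le_succ n), if_pos le_rfl, if_pos (Nat.le_succ n), if_pos le_rfl,
        Nat.add_sub_cancel_left, Nat.sub_self, z₁, z₂, z₂, key, ← hn 1 h0]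
      congr 1
      by_cases h1 : n = 1
      · subst h1
        rw [if_pos le_rfl, if_pos rfl, z₂]
      · rw [if_neg (by omega), if_neg h1]
  · simp only [Derivation.zero_apply, map_zero, LinearMap.zero_apply, mul_zero, ite_self, add_zero]
      at key ⊢
    obtain hle | rfl : k ≤ n ∨ k = n + 1 := by omega
    · rw [if_neg (by omega), if_neg (by omega), hn k hle]
    · rw [if_pos le_rfl, if_pos le_rfl, Nat.sub_self, z₁, z₂, z₂, key]

/-- A series of operators with constant term `1` in a subalgebra has an inverse in it. -/
theorem exists_compS_inverse (S : Subalgebra ℝ (Module.End ℝ A)) {Q : ℕ → Module.End ℝ A}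
    (hQ : ∀ k, Q k ∈ S) (h0 : Q 0 = 1) :
    ∃ R : ℕ → Module.End ℝ A, (∀ k, R k ∈ S) ∧ compS Q R = cstS LinearMap.id ∧
      compS R Q = cstS LinearMap.id := by
  let q : PowerSeries S := PowerSeries.mk fun k => ⟨Q k, hQ k⟩
  have hq : PowerSeries.constantCoeff q = ((1 : Sˣ) : S) := by
    apply Subtype.ext
    exact h0
  have hm : ∀ a b : PowerSeries S, compS (fun k => ((PowerSeries.coeff k a : S) : Module.End ℝ A))
      (fun k => ((PowerSeries.coeff k b : S) : Module.End ℝ A)) =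
      fun k => ((PowerSeries.coeff k (a * b) : S) : Module.End ℝ A) := by
    intro a b
    ext1 k
    rw [PowerSeries.coeff_mul, AddSubmonoidClass.coe_finsetSum]
    rfl
  have h1 : (fun k => ((PowerSeries.coeff k (1 : PowerSeries S) : S) : Module.End ℝ A)) =
      cstS LinearMap.id := by
    ext1 k
    rw [PowerSeries.coeff_one, cstS]
    split_ifs with h
    · subst h
      rw [Pi.single_eq_same]
      rfl
    · rw [Pi.single_eq_of_ne h]
      rfl
  have hqQ : (fun k => ((PowerSeries.coeff k q : S) : Module.End ℝ A)) = Q := by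
    ext1 k
    simp only [q, PowerSeries.coeff_mk]
  refine ⟨fun k => (PowerSeries.coeff k (PowerSeries.invOfUnit q 1) : S), fun k => Subtype.property _,
    ?_, ?_⟩
  · have h := hm q (PowerSeries.invOfUnit q 1)
    rw [PowerSeries.mul_invOfUnit q 1 hq, h1, hqQ] at h
    exact h
  · have h := hm (PowerSeries.invOfUnit q 1) q
    rw [PowerSeries.invOfUnit_mul q 1 hq, h1, hqQ] at h
    exact h

/-- The elements fixed by a series of operators are fixed by its inverse. -/
theorem apply_of_compS_eq_id {Q R : ℕ → Module.End ℝ A} (hRQ : compS R Q = cstS LinearMap.id)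
    {y : A} (hy : ∀ k, Q k y = if k = 0 then y else 0) (N : ℕ) :
    R N y = if N = 0 then y else 0 := by
  have h := LinearMap.congr_fun (congrFun hRQ N) y
  rw [compS, conv, LinearMap.sum_apply, Finset.sum_eq_single (N, 0)] at h
  · have e : R N (Q 0 y) = R N y := by rw [hy, if_pos rfl]
    refine e.symm.trans (h.trans ?_)
    rw [cstS]
    split_ifs with h
    · subst h
      rw [Pi.single_eq_same]
      rfl
    · rw [Pi.single_eq_of_ne h]
      rfl
  · rintro ⟨a, b⟩ hab hne
    rw [mem_antidiagonal] at hab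
    change R a (Q b y) = 0
    rw [hy, if_neg, map_zero]
    rintro rfl
    exact hne (by simp only [add_zero] at hab; rw [hab])
  · intro h'
    exact absurd (mem_antidiagonal.2 (by simp)) h'

theorem tensS₃_comm {R : ℕ → Module.End ℝ A} {Θ : ℕ → Module.End ℝ (A ⊗[ℝ] (A ⊗[ℝ] A))}
    (h : ∀ i j k l t, TensorProduct.map (R i) (TensorProduct.map (R j) (R k)) (Θ l t) =
      Θ l (TensorProduct.map (R i) (TensorProduct.map (R j) (R k)) t)) :
    compS (tensS R (tensS R R)) Θ = compS Θ (tensS R (tensS R R)) := by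
  refine conv_comm _ _ _ _ fun N l => LinearMap.ext fun t => ?_
  change tensS R (tensS R R) N (Θ l t) = Θ l (tensS R (tensS R R) N t)
  simp only [tensS, conv, map_sum, LinearMap.sum_apply]
  exact Finset.sum_congr rfl fun p _ => Finset.sum_congr rfl fun q _ => h _ _ _ _ _

/-- The transported product satisfies `Q (f * g) = Q f *' Q g`. -/
theorem sum_transport {Q R : ℕ → Module.End ℝ A} {C : ℕ → A →ₗ[ℝ] A →ₗ[ℝ] A}
    (hRQ : compS R Q = cstS LinearMap.id) (N : ℕ) (f g : A) :
    ∑ p ∈ antidiagonal N, Q p.1 (C p.2 f g) =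
      ∑ p ∈ antidiagonal N, ∑ q ∈ antidiagonal p.2,
        transport Q R C p.1 (Q q.1 f) (Q q.2 g) := by
  rw [← compS_mulS_apply, ← compS_mulS_tensS_apply, compS_mulS_transport hRQ]

/-- Operators commuting with a derivation of a product also do after transport. -/
theorem transport_leibniz {Q R : ℕ → Module.End ℝ A} {C : ℕ → A →ₗ[ℝ] A →ₗ[ℝ] A}
    {T : Module.End ℝ A} (hQ : ∀ k f, Q k (T f) = T (Q k f)) (hR : ∀ k f, R k (T f) = T (R k f))
    (hC : ∀ k f g, T (C k f g) = C k (T f) g + C k f (T g)) (N : ℕ) (f g : A) :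
    T (transport Q R C N f g) = transport Q R C N (T f) g + transport Q R C N f (T g) := by
  simp only [transport_apply, LinearMap.sum_apply, map_sum, LinearMap.compr₂_apply,
    LinearMap.compl₁₂_apply, hR, ← Finset.sum_add_distrib, ← map_add, ← hC, hQ]

end AbstractEquivalences

/-! ### Strongly invariant equivalences -/

section Equivalences

open Finset.HasAntidiagonal

variable {F E H G : Type*} [NormedAddCommGroup F] [NormedSpace ℝ F] [FiniteDimensional ℝ F]
  [NormedAddCommGroup E] [NormedSpace ℝ E] [FiniteDimensional ℝ E]
  [TopologicalSpace H] [ChartedSpace F H] [Group H] [LieGroup 𝓘(ℝ, F) ∞ H]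
  [TopologicalSpace G] [ChartedSpace E G] [Group G] [LieGroup 𝓘(ℝ, E) ∞ G]

namespace Base

variable (D : Base F E H G)

/-- The `G × H`-invariant differential operators. -/
noncomputable def invDiff : Subalgebra ℝ (Module.End ℝ D.Obs) :=
  D.Diff ⊓ Subalgebra.centralizer ℝ (Set.range leftPull ∪ Set.range D.rightPull)

theorem mem_invDiff {P : Module.End ℝ D.Obs} : P ∈ D.invDiff ↔ P ∈ D.Diff ∧ D.Invariant P := by
  rw [invDiff, Algebra.mem_inf, Subalgebra.mem_centralizer_iff]
  refine and_congr_right fun _ => ⟨fun h => ⟨fun a f => ?_, fun x f => ?_⟩, ?_⟩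
  · exact (LinearMap.congr_fun (h _ (Or.inl ⟨a, rfl⟩)) f).symm
  · exact (LinearMap.congr_fun (h _ (Or.inr ⟨x, rfl⟩)) f).symm
  · rintro h _ (⟨a, rfl⟩ | ⟨x, rfl⟩)
    · exact LinearMap.ext fun f => (h.1 a f).symm
    · exact LinearMap.ext fun f => (h.2 x f).symm

theorem lift_leftAction_comm {P : Module.End ℝ D.Obs}
    (hP : ∀ (x : LieAlg E G) f, P (leftAction x f) = leftAction x (P f)) (u : UEA (LieAlg E G))
    (f : D.Obs) :
    P (UniversalEnvelopingAlgebra.lift ℝ (leftAction (U := D.U)) u f) =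
      UniversalEnvelopingAlgebra.lift ℝ (leftAction (U := D.U)) u (P f) := by
  have h := mem_of_ι_mem ((Subalgebra.centralizer ℝ {P}).comap
    (UniversalEnvelopingAlgebra.lift ℝ (leftAction (U := D.U)))) (fun x => by
      rw [Subalgebra.mem_comap, Subalgebra.mem_centralizer_iff]
      rintro _ rfl
      rw [UniversalEnvelopingAlgebra.lift_ι_apply]
      exact LinearMap.ext fun f => hP x f) u
  rw [Subalgebra.mem_comap, Subalgebra.mem_centralizer_iff] at h
  exact LinearMap.congr_fun (h P rfl) f

theorem act₃_comm {P Q R : Module.End ℝ D.Obs}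
    (hP : ∀ (x : LieAlg E G) f, P (leftAction x f) = leftAction x (P f))
    (hQ : ∀ (x : LieAlg E G) f, Q (leftAction x f) = leftAction x (Q f))
    (hR : ∀ (x : LieAlg E G) f, R (leftAction x f) = leftAction x (R f))
    (T : UEA₃ (LieAlg E G)) (t : D.Obs ⊗[ℝ] (D.Obs ⊗[ℝ] D.Obs)) :
    TensorProduct.map P (TensorProduct.map Q R) (D.act₃ T t) =
      D.act₃ T (TensorProduct.map P (TensorProduct.map Q R) t) := by
  induction T using TensorProduct.induction_on with
  | zero => simp only [map_zero, LinearMap.zero_apply]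
  | add T T' h h' => simp only [map_add, LinearMap.add_apply, h, h']
  | tmul u T =>
    induction T using TensorProduct.induction_on with
    | zero => simp only [TensorProduct.tmul_zero, map_zero, LinearMap.zero_apply]
    | add T T' h h' => simp only [TensorProduct.tmul_add, map_add, LinearMap.add_apply, h, h']
    | tmul v w =>
      induction t using TensorProduct.induction_on with
      | zero => simp only [map_zero]
      | add t t' h h' => simp only [map_add, h, h']
      | tmul f t =>
        induction t using TensorProduct.induction_on with
        | zero => simp only [TensorProduct.tmul_zero, map_zero]
        | add t t' h h' => simp only [TensorProduct.tmul_add, map_add, h, h']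
        | tmul g k =>
          exact congrArg₂ (· ⊗ₜ[ℝ] ·) (D.lift_leftAction_comm hP u f)
            (congrArg₂ (· ⊗ₜ[ℝ] ·) (D.lift_leftAction_comm hQ v g) (D.lift_leftAction_comm hR w k))

variable {D}
variable {r : D.SmoothTensor} {Z : LieAlg E G ⊗[ℝ] (LieAlg E G ⊗[ℝ] LieAlg E G)}
  {Φ : (PowerSeries (UEA₃ (LieAlg E G)))ˣ} {C C₁ C₂ : ℕ → D.Obs →ₗ[ℝ] D.Obs →ₗ[ℝ] D.Obs}
  {Q R : ℕ → Module.End ℝ D.Obs}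

theorem transport_mem_bidiff [T2Space G] (hC : ∀ k, C k ∈ D.Bidiff) (hQ : ∀ k, Q k ∈ D.Diff)
    (hR : ∀ k, R k ∈ D.Diff) (N : ℕ) : transport Q R C N ∈ D.Bidiff := by
  rw [transport_apply]
  exact Submodule.sum_mem _ fun p _ => Submodule.sum_mem _ fun q _ => Submodule.sum_mem _ fun s _ =>
    D.compr₂_mem_bidiff (hQ _) (D.compl₁₂_mem_bidiff (hC _) (hR _) (hR _))

/-- A strongly invariant equivalence transforms a strongly invariant star-product into a strongly
invariant star-product, provided that the terms of degree `0` and `1` of the latter are those of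
some quantization. -/
theorem IsStronglyInvariant.transport [T2Space G] [ConnectedSpace G] [T2Space H]
    (hC : D.IsStronglyInvariant r Φ C) (hQ : D.IsStrongEquivalence Q)
    (hR : ∀ k, R k ∈ D.invDiff) (hQR : compS Q R = cstS LinearMap.id)
    (hRQ : compS R Q = cstS LinearMap.id)
    (h₂ : D.IsQuantization r Φ C₂) (h0 : QPois.transport Q R C 0 = C₂ 0)
    (h1 : QPois.transport Q R C 1 = C₂ 1) :
    D.IsStronglyInvariant r Φ (QPois.transport Q R C) := by
  have hRd := fun k => (D.mem_invDiff.1 (hR k)).1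
  have hRi := fun k => (D.mem_invDiff.1 (hR k)).2
  have hRl := fun k (x : LieAlg E G) f => (hRi k).leftAction D (hRd k) x f
  have hQl := fun k (x : LieAlg E G) f => (hQ.invariant k).leftAction D (hQ.diff k) x f
  exact
    { bidiff := transport_mem_bidiff hC.bidiff hQ.diff hRd
      invariant := fun k x => transport_leibniz (fun k => hQl k x) (fun k => hRl k x)
        (fun k => hC.invariant k x) k
      zero := fun f g => by
        rw [h0]
        exact h₂.zero f g
      one := fun f g => by
        rw [h1]
        exact h₂.one f g
      assoc := hC.isAssoc.transport hRQ (tensS₃_comm fun i j k l t =>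
        D.act₃_comm (hRl i) (hRl j) (hRl k) _ t)
      momentum := fun k y f => transport_sub hQR (lin y)
        (apply_of_compS_eq_id hRQ fun k => hQ.fixes k y) (fun k f => hC.momentum k y f)
        (fun k f => (hQ.invariant k).bracket_lin D (hQ.diff k) r y f) k f }

theorem obsEquiv_eq (n : ℕ) (X E₀ P : Module.End ℝ D.Obs) :
    D.obsEquiv n X E₀ P = Pi.single 0 1 + Pi.single n X +
      Pi.single (n + 1) (E₀ + (X * P - P * X) + if n = 1 then (1 / 2 : ℝ) • (X * X) else 0) := by
  ext1 k
  simp only [obsEquiv, Pi.add_apply, Pi.single_apply]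

theorem isStrongEquivalence_obsEquiv {n : ℕ} {X E₀ P : Module.End ℝ D.Obs} (hX : X ∈ D.invDiff)
    (hE : E₀ ∈ D.invDiff) (hP : P ∈ D.invDiff) (kX : ∀ y : F, X (lin y) = 0)
    (kE : ∀ y : F, E₀ (lin y) = 0) (kP : ∀ y : F, P (lin y) = 0) (hn : 1 ≤ n ∨ X = 0) :
    D.IsStrongEquivalence (D.obsEquiv n X E₀ P) := by
  have hm : ∀ k, D.obsEquiv n X E₀ P k ∈ D.invDiff := by
    intro k
    refine add_mem (add_mem ?_ ?_) ?_
    · split_ifs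
      exacts [one_mem _, zero_mem _]
    · split_ifs
      exacts [hX, zero_mem _]
    · split_ifs
      · exact add_mem (add_mem hE (sub_mem (mul_mem hX hP) (mul_mem hP hX)))
          (Subalgebra.smul_mem _ (mul_mem hX hX) _)
      · exact add_mem (add_mem hE (sub_mem (mul_mem hX hP) (mul_mem hP hX))) (zero_mem _)
      · exact zero_mem _
  refine ⟨?_, fun k => (D.mem_invDiff.1 (hm k)).1, fun k => (D.mem_invDiff.1 (hm k)).2,
    fun k y => ?_⟩
  · rw [obsEquiv, if_pos rfl, if_neg (Nat.succ_ne_zero n).symm]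
    obtain h | rfl := hn
    · rw [if_neg (by omega), add_zero, add_zero]
    · rw [ite_self, add_zero, add_zero]
  · have hW : (E₀ + (X * P - P * X) + if n = 1 then (1 / 2 : ℝ) • (X * X) else 0 :
        Module.End ℝ D.Obs) (lin y) = 0 := by
      split_ifs <;>
      simp only [LinearMap.add_apply, LinearMap.sub_apply, Module.End.mul_apply,
        LinearMap.smul_apply, kX, kE, kP, map_zero, sub_zero, add_zero,
        smul_zero]
    have e : D.obsEquiv n X E₀ P k (lin y) = (if k = 0 then lin y else 0) +
        (if k = n then X (lin y) else 0) + (if k = n + 1 then (E₀ + (X * P - P * X) +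
          if n = 1 then (1 / 2 : ℝ) • (X * X) else 0 : Module.End ℝ D.Obs) (lin y) else 0) := by
      simp only [obsEquiv]
      split_ifs <;> rfl
    rw [e, kX, hW, ite_self, ite_self, add_zero, add_zero]

/-- The equivalence built from a splitting and a primitive of its bivector field transforms the
first star-product into one which agrees with the second one in one more degree. -/
theorem exists_transforms [T2Space G] [ConnectedSpace G] [T2Space H] 
    (h₁ : D.IsStronglyInvariant r Φ C₁) (h₂ : D.IsStronglyInvariant r Φ C₂) {n : ℕ}
    (hn : ∀ k ≤ n, C₁ k = C₂ k) {A B : D.Obs →ₗ[ℝ] D.Obs →ₗ[ℝ] D.Obs} 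
    (hA : ∀ f g, C₁ (n + 1) f g - C₂ (n + 1) f g = A f g) {E₀ P : Module.End ℝ D.Obs}
    {X : Derivation ℝ D.Obs D.Obs} (hB : D.IsSplitting r A B E₀) (hP : D.IsFirstOrder r (C₁ 1) P)
    (hX : ∀ f g, B f g = D.schoutenVec (D.piOp r) X f g) (h0 : 1 ≤ n ∨ X = 0)
    (hQ : D.IsStrongEquivalence (D.obsEquiv n X E₀ P)) :
    ∃ C' : ℕ → D.Obs →ₗ[ℝ] D.Obs →ₗ[ℝ] D.Obs,
      D.Transforms (D.obsEquiv n X E₀ P) C₁ C' ∧ D.IsStronglyInvariant r Φ C' ∧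
        ∀ k ≤ n + 1, C' k = C₂ k := by
  obtain ⟨R, hR, hQR, hRQ⟩ := exists_compS_inverse D.invDiff
    (fun k => D.mem_invDiff.2 ⟨hQ.diff k, hQ.invariant k⟩) hQ.zero
  have hC : ∀ k ≤ n + 1, transport (D.obsEquiv n X E₀ P) R C₁ k = C₂ k := by
    refine transport_eq_of_le hQR (compS_eq_of_splitting h₁.zero h₂.zero hn (c := D.piOp r)
      (E := E₀) (P := P) (X := X) (fun f g => ?_) (fun f g => hP.eq f g) h0 (fun f => ?_)
      (obsEquiv_eq n X E₀ P))
    · rw [hA, hB.eq, hX]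
      rfl
    · by_cases h : n = 1
      · rw [if_pos h, if_pos h]
        rfl
      · rw [if_neg h, if_neg h]
        rfl
  exact ⟨_, sum_transport hRQ, h₁.transport hQ hR hQR hRQ h₂.toIsQuantization
    (hC 0 (Nat.zero_le _)) (hC 1 (Nat.le_add_left _ _)), hC⟩

end Base

end Equivalences

end QPois

theorem mainTheorem9 {F E H G : Type*}
    [NormedAddCommGroup F] [NormedSpace ℝ F] [FiniteDimensional ℝ F]
    [NormedAddCommGroup E] [NormedSpace ℝ E] [FiniteDimensional ℝ E]
    [TopologicalSpace H] [ChartedSpace F H] [Group H] [LieGroup 𝓘(ℝ, F) ∞ H]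
    [T2Space H] [SecondCountableTopology H] [ConnectedSpace H]
    [TopologicalSpace G] [ChartedSpace E G] [Group G] [LieGroup 𝓘(ℝ, E) ∞ G]
    [T2Space G] [SecondCountableTopology G] [ConnectedSpace G]
    (D : QPois.Base F E H G)
    (Z : QPois.LieAlg E G ⊗[ℝ] (QPois.LieAlg E G ⊗[ℝ] QPois.LieAlg E G))
    (r : D.SmoothTensor) (hr : D.IsRMatrix r Z)
    (Φ : (PowerSeries (QPois.UEA₃ (QPois.LieAlg E G)))ˣ) (hΦ : QPois.IsAssociator Z Φ)
    (C₁ C₂ : ℕ → D.Obs →ₗ[ℝ] D.Obs →ₗ[ℝ] D.Obs)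
    (h₁ : D.IsStronglyInvariant r Φ C₁) (h₂ : D.IsStronglyInvariant r Φ C₂)
    (n : ℕ) (hn : ∀ k ≤ n, C₁ k = C₂ k) :
    (∃ (B : D.Obs →ₗ[ℝ] D.Obs →ₗ[ℝ] D.Obs) (E₀ : Module.End ℝ D.Obs),
      D.IsSplitting r (C₁ (n + 1) - C₂ (n + 1)) B E₀) ∧
    (∃ P : Module.End ℝ D.Obs, D.IsFirstOrder r (C₁ 1) P) ∧
    (∃ P : Module.End ℝ D.Obs, D.IsFirstOrder r (C₂ 1) P) ∧
    ∀ (B : D.Obs →ₗ[ℝ] D.Obs →ₗ[ℝ] D.Obs) (E₀ P : Module.End ℝ D.Obs)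
      (X : Derivation ℝ D.Obs D.Obs),
      D.IsSplitting r (C₁ (n + 1) - C₂ (n + 1)) B E₀ →
      D.IsFirstOrder r (C₁ 1) P →
      D.Invariant (X : Module.End ℝ D.Obs) →
      (∀ y : F, X (QPois.lin y) = 0) →
      (∀ f g, B f g = D.schoutenVec (D.piOp r) X f g) →
      (1 ≤ n ∨ X = 0) →
      D.IsStrongEquivalence (D.obsEquiv n X E₀ P) ∧
      ∃ C' : ℕ → D.Obs →ₗ[ℝ] D.Obs →ₗ[ℝ] D.Obs,
        D.Transforms (D.obsEquiv n X E₀ P) C₁ C' ∧ D.IsStronglyInvariant r Φ C' ∧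
        ∀ k ≤ n + 1, C' k = C₂ k := by
  refine ⟨QPois.Base.exists_isSplitting hΦ h₁ h₂ hn, QPois.Base.exists_isFirstOrder hΦ h₁,
    QPois.Base.exists_isFirstOrder hΦ h₂, fun B E₀ P X hB hP hX kX hBX h0 => ?_⟩
  have hQ : D.IsStrongEquivalence (D.obsEquiv n X E₀ P) :=
    QPois.Base.isStrongEquivalence_obsEquiv (D.mem_invDiff.2 ⟨D.derivation_mem_diff X, hX⟩)
      (D.mem_invDiff.2 ⟨hB.diff, hB.invariantP⟩) (D.mem_invDiff.2 ⟨hP.diff, hP.invariant⟩) kX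
      hB.killsP hP.kills (h0.imp_right fun h => by rw [h]; rfl)
  exact ⟨hQ, QPois.Base.exists_transforms h₁ h₂ hn (fun _ _ => rfl) hB hP hBX h0 hQ⟩
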